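/- **Setting.** Let $J$ be a set of $n\ge 2$ unit-size jobs with a strict partial order $\prec$ (the precedence order), to be scheduled on $m$ identical machines. For a time horizon $T\in\mathbb N$ let $K(T)$ be the polyhedron of all $x=(x_{j,t},x_{j,I})$, with one variable $x_{j,t}$ for each job $j$ and time slot $t\in[T]=\{1,\dots,T\}$ and one variable $x_{j,I}$ for each job $j$ and interval $I=\{a,\dots,b\}$, $1\le a\le b\le T$, that satisfy $$\sum_{t=1}^T x_{j,t}=1\ (j\in J),\qquad \sum_{j\in J}x_{j,t}\le m\ (t\in[T]),\qquad \sum_{t'\in[T],\,t'\le t}x_{i,t'}\ \ge \sum_{t'\in[T],\,t'\le t+1}x_{j,t'}\ \ (i\prec j,\ t\in\{0,\dots,T\}),$$ $$x_{j,I}=\sum_{t\in I}x_{j,t}\ (j\in J,\ I\text{ an interval}),\qquad 0\le x_{j,t}\le 1\ (j\in J,\ t\in[T]).$$ For a polyhedron $K=\{x\in\mathbb R^V: Ax\ge b\}$ with finitely many variables $V$ (an equation being written as two inequalities), $\mathrm{Las}_r(K)$ is the set of all $y\in\mathbb R^{2^V}$ with $y_\emptyset=1$, $(y_{I\cup I'})_{|I|,|I'|\le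 r}\succeq 0$, and $\big(\sum_{i\in V}A_{\ell i}\,y_{I\cup I'\cup\{i\}}-b_\ell\,y_{I\cup I'}\big)_{|I|,|I'|\le r}\succeq 0$ for every row $\ell$. A feasible schedule is a map $\sigma:J\to\{1,2,\dots\}$ with $|\sigma^{-1}(t)|\le m$ for all $t$ and $\sigma(i)<\sigma(j)$ whenever $i\prec j$; its makespan is $\max_{j}\sigma(j)$. Running time is measured on a random access machine with arrays of natural numbers and arrays of real numbers, started with $n$, $m$, $T$, the incidence matrix of $\prec$, the number $\varepsilon$, and a table of the entries $y_I$ with $|I|\le 2r+1$ in memory. An elementary operation takes one step: on natural numbers $+$, truncated $-$, division with remainder, comparison and indirect addressing (and also $\times$, where the bit lengths of the two factors are charged in addition); on reals only the constants $0,1$, the operations $+,-$, comparison and reading or writing memory. **Theorem.** There are absolute constants $C,K$ and one program $P$ for this machine such that the following holds for all $n\ge 2$, all $m$, $T$, $\prec$ as above, all real $\varepsilon>0$ and all $r\in\mathbb N$ with $$ r\ \ge\ (\log_2 n)^{\,C\cdot\frac{m^2}{\varepsilon^2}\cdot\log_2\log_2 n}.$$ Started on any $y\in\mathrm{Las}_r(K(T))$,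 the program $P$ halts after at most $n^{K r}$ steps and outputs a feasible schedule $\sigma$ with makespan $\max_{j\in J}\sigma(j)\le(1+\varepsilon)\,T$. -/

import Mathlib

open scoped BigOperators

/-! ## The Lasserre hierarchy -/

section Lasserre

/-- The moment matrix `(y_{I ∪ J})_{|I|, |J| ≤ r}`. -/
def momentMatrix {V : Type} [DecidableEq V] (r : ℕ) (y : Finset V → ℝ) :
    Matrix {I : Finset V // I.card ≤ r} {I : Finset V // I.card ≤ r} ℝ :=
  Matrix.of fun I J => y (I.1 ∪ J.1)

/-- The moment matrix of slacks of the inequality `∑ i, a i * x i ≥ β`, with the entries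
`∑ i, a i * y_{I ∪ J ∪ {i}} - β * y_{I ∪ J}` for `|I|, |J| ≤ r`. -/
def slackMatrix {V : Type} [Fintype V] [DecidableEq V] (r : ℕ) (y : Finset V → ℝ)
    (a : V → ℝ) (β : ℝ) :
    Matrix {I : Finset V // I.card ≤ r} {I : Finset V // I.card ≤ r} ℝ :=
  Matrix.of fun I J => ∑ i, a i * y (I.1 ∪ J.1 ∪ {i}) - β * y (I.1 ∪ J.1)

/-- The `r`-th level `Las_r(K)` of the Lasserre hierarchy of `K = {x | A x ≥ b}`. Only the
entries `y I` with `|I| ≤ 2 r + 1` are constrained. -/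
def lasserre {V R : Type} [Fintype V] [DecidableEq V] (r : ℕ) (A : Matrix R V ℝ) (b : R → ℝ) :
    Set (Finset V → ℝ) :=
  {y | (momentMatrix r y).PosSemidef ∧
       (∀ l : R, (slackMatrix r y (A l) (b l)).PosSemidef) ∧
       y ∅ = 1}

end Lasserre

/-! ## The time-indexed linear program -/

section Scheduling

/-- An instance with `n` unit size jobs, `m` identical machines, and a strict partial order
`prec` on the jobs, `prec i j` meaning that `i` must be completed before `j` starts. -/
structure SchedInstance where
  n : ℕ
  m : ℕ
  prec : Fin n → Fin n → Prop
  irrefl : ∀ i, ¬ prec i i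
  trans : ∀ i j k, prec i j → prec j k → prec i k

/-- The variables of the time-indexed program with horizon `T`. The time slots `1, …, T` are
represented by `Fin T`, where `t : Fin T` stands for the slot `t + 1`. -/
inductive LPVar (n T : ℕ) : Type
  /-- the variable `x_{j,t}` -/
  | slot (j : Fin n) (t : Fin T) : LPVar n T
  /-- the variable `x_{j,I}` of the interval `I = {a, …, b}`, `a ≤ b` -/
  | span (j : Fin n) (I : {p : Fin T × Fin T // p.1 ≤ p.2}) : LPVar n T
  deriving DecidableEq, Fintype

/-- The inequalities of the time-indexed program; each equation is a pair of inequalities. -/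
inductive LPRow (S : SchedInstance) (T : ℕ) : Type
  /-- `∑ t, x_{j,t} ≥ 1` -/
  | assignGe (j : Fin S.n) : LPRow S T
  /-- `-∑ t, x_{j,t} ≥ -1` -/
  | assignLe (j : Fin S.n) : LPRow S T
  /-- `-∑ j, x_{j,t} ≥ -m` -/
  | load (t : Fin T) : LPRow S T
  /-- `∑_{t' ≤ t} x_{i,t'} - ∑_{t' ≤ t+1} x_{j,t'} ≥ 0`, for `i ≺ j` and `t = 0, …, T`, where
  `t'` ranges over slots -/
  | order (i j : Fin S.n) (h : S.prec i j) (t : Fin (T + 1)) : LPRow S T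
  /-- `x_{j,I} - ∑_{t ∈ I} x_{j,t} ≥ 0` -/
  | spanGe (j : Fin S.n) (I : {p : Fin T × Fin T // p.1 ≤ p.2}) : LPRow S T
  /-- `-x_{j,I} + ∑_{t ∈ I} x_{j,t} ≥ 0` -/
  | spanLe (j : Fin S.n) (I : {p : Fin T × Fin T // p.1 ≤ p.2}) : LPRow S T
  /-- `x_{j,t} ≥ 0` -/
  | lower (j : Fin S.n) (t : Fin T) : LPRow S T
  /-- `-x_{j,t} ≥ -1` -/
  | upper (j : Fin S.n) (t : Fin T) : LPRow S T

/-- The coefficient of `x_{j',t'}` (or `x_{j',I'}`) in each row. -/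
def lpMatrix (S : SchedInstance) (T : ℕ) : Matrix (LPRow S T) (LPVar S.n T) ℝ
  | .assignGe j, .slot j' _ => if j' = j then 1 else 0
  | .assignGe _, .span _ _ => 0
  | .assignLe j, .slot j' _ => if j' = j then -1 else 0
  | .assignLe _, .span _ _ => 0
  | .load t, .slot _ t' => if t' = t then -1 else 0
  | .load _, .span _ _ => 0
  | .order i j _ t, .slot j' t' =>
      (if j' = i ∧ t'.val + 1 ≤ t.val then 1 else 0)
        - (if j' = j ∧ t'.val + 1 ≤ t.val + 1 then 1 else 0)
  | .order _ _ _ _, .span _ _ => 0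
  | .spanGe j I, .slot j' t' => if j' = j ∧ I.1.1 ≤ t' ∧ t' ≤ I.1.2 then -1 else 0
  | .spanGe j I, .span j' I' => if j' = j ∧ I' = I then 1 else 0
  | .spanLe j I, .slot j' t' => if j' = j ∧ I.1.1 ≤ t' ∧ t' ≤ I.1.2 then 1 else 0
  | .spanLe j I, .span j' I' => if j' = j ∧ I' = I then -1 else 0
  | .lower j t, .slot j' t' => if j' = j ∧ t' = t then 1 else 0
  | .lower _ _, .span _ _ => 0
  | .upper j t, .slot j' t' => if j' = j ∧ t' = t then -1 else 0
  | .upper _ _, .span _ _ => 0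

/-- The right hand sides; the program `K(T)` is `{x | lpMatrix S T *ᵥ x ≥ lpRhs S T}`. -/
def lpRhs (S : SchedInstance) (T : ℕ) : LPRow S T → ℝ
  | .assignGe _ => 1
  | .assignLe _ => -1
  | .load _ => -(S.m : ℝ)
  | .order _ _ _ _ => 0
  | .spanGe _ _ => 0
  | .spanLe _ _ => 0
  | .lower _ _ => 0
  | .upper _ _ => -1

/-- `Las_r(K(T))`. -/
def schedLasserre (S : SchedInstance) (T r : ℕ) : Set (Finset (LPVar S.n T) → ℝ) :=
  lasserre r (lpMatrix S T) (lpRhs S T)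

/-- `σ` is a feasible schedule: it uses the time slots `1, 2, …`, no slot receives more than `m`
jobs, and the precedence order is respected. -/
def IsFeasibleSchedule (S : SchedInstance) (σ : Fin S.n → ℕ) : Prop :=
  (∀ j, 1 ≤ σ j) ∧
  (∀ t : ℕ, (Finset.univ.filter fun j => σ j = t).card ≤ S.m) ∧
  (∀ i j, S.prec i j → σ i < σ j)

end Scheduling

/-! ## A random access machine with real registers

Programs are finite pieces of text in a structured language. A program uses finitely many arrays
of natural numbers and finitely many arrays of reals, with arrays addressed by computed natural
numbers. Every elementary operation costs one step, except that a product of natural numbers is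
charged the bit lengths of its factors in addition, so that the bit length of a number never
exceeds that of the largest number in the input and the program text plus the running time. On reals there are only the constants
`0` and `1`, addition, subtraction and comparison. In particular reals cannot be rounded, and
every such program is also a program of the usual real random access machine. -/

namespace RealRam

/-- The content of the memory: `s.nat a i` is cell `i` of the natural number array `a`, and
`s.real a i` is cell `i` of the real array `a`. -/
structure State where
  nat : ℕ → ℕ → ℕ
  real : ℕ → ℕ → ℝ

/-- Expressions for natural numbers. -/
inductive NExp : Type
  | lit (c : ℕ) : NExp
  | get (a : ℕ) (i : NExp) : NExp
  | plus (e f : NExp) : NExp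
  | minus (e f : NExp) : NExp
  | times (e f : NExp) : NExp
  | quot (e f : NExp) : NExp
  | rem (e f : NExp) : NExp

/-- The value of an expression (truncated subtraction, rounded division). -/
def NExp.val (s : State) : NExp → ℕ
  | .lit c => c
  | .get a i => s.nat a (i.val s)
  | .plus e f => e.val s + f.val s
  | .minus e f => e.val s - f.val s
  | .times e f => e.val s * f.val s
  | .quot e f => e.val s / f.val s
  | .rem e f => e.val s % f.val s

/-- The number of steps that the evaluation takes. -/
def NExp.cost (s : State) : NExp → ℕ
  | .lit _ => 1
  | .get _ i => i.cost s + 1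
  | .plus e f => e.cost s + f.cost s + 1
  | .minus e f => e.cost s + f.cost s + 1
  | .times e f => e.cost s + f.cost s + (e.val s).size + (f.val s).size + 1
  | .quot e f => e.cost s + f.cost s + 1
  | .rem e f => e.cost s + f.cost s + 1

/-- Expressions for reals. -/
inductive RExp : Type
  | zero : RExp
  | one : RExp
  | get (a : ℕ) (i : NExp) : RExp
  | plus (e f : RExp) : RExp
  | minus (e f : RExp) : RExp

noncomputable def RExp.val (s : State) : RExp → ℝ
  | .zero => 0
  | .one => 1
  | .get a i => s.real a (i.val s)
  | .plus e f => e.val s + f.val s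
  | .minus e f => e.val s - f.val s

def RExp.cost (s : State) : RExp → ℕ
  | .zero => 1
  | .one => 1
  | .get _ i => i.cost s + 1
  | .plus e f => e.cost s + f.cost s + 1
  | .minus e f => e.cost s + f.cost s + 1

/-- Tests. -/
inductive Test : Type
  | natLe (e f : NExp) : Test
  | realLe (e f : RExp) : Test
  | neg (p : Test) : Test
  | conj (p q : Test) : Test

def Test.Holds (s : State) : Test → Prop
  | .natLe e f => e.val s ≤ f.val s
  | .realLe e f => e.val s ≤ f.val s
  | .neg p => ¬ p.Holds s
  | .conj p q => p.Holds s ∧ q.Holds s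

def Test.cost (s : State) : Test → ℕ
  | .natLe e f => e.cost s + f.cost s + 1
  | .realLe e f => e.cost s + f.cost s + 1
  | .neg p => p.cost s + 1
  | .conj p q => p.cost s + q.cost s + 1

/-- Programs. -/
inductive Prog : Type
  | skip : Prog
  /-- assign the value of `e` to cell `i` of the natural number array `a` -/
  | setNat (a : ℕ) (i e : NExp) : Prog
  /-- assign the value of `e` to cell `i` of the real array `a` -/
  | setReal (a : ℕ) (i : NExp) (e : RExp) : Prog
  | seq (p q : Prog) : Prog
  | branch (b : Test) (p q : Prog) : Prog
  /-- repeat `p` as long as `b` holds -/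
  | loop (b : Test) (p : Prog) : Prog

/-- The state after assigning `v` to cell `i` of the natural number array `a`. -/
def State.putNat (s : State) (a i v : ℕ) : State :=
  { s with nat := Function.update s.nat a (Function.update (s.nat a) i v) }

/-- The state after assigning `v` to cell `i` of the real array `a`. -/
noncomputable def State.putReal (s : State) (a i : ℕ) (v : ℝ) : State :=
  { s with real := Function.update s.real a (Function.update (s.real a) i v) }

/-- `Exec p s s' t`: started in the state `s`, the program `p` halts after exactly `t` steps, in
the state `s'`. -/
inductive Exec : Prog → State → State → ℕ → Prop
  | skip (s : State) : Exec .skip s s 1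
  | setNat (s : State) (a : ℕ) (i e : NExp) :
      Exec (.setNat a i e) s (s.putNat a (i.val s) (e.val s)) (i.cost s + e.cost s + 1)
  | setReal (s : State) (a : ℕ) (i : NExp) (e : RExp) :
      Exec (.setReal a i e) s (s.putReal a (i.val s) (e.val s)) (i.cost s + e.cost s + 1)
  | seq {p q : Prog} {s s' s'' : State} {t t' : ℕ} :
      Exec p s s' t → Exec q s' s'' t' → Exec (.seq p q) s s'' (t + t')
  | branchTrue {b : Test} {p q : Prog} {s s' : State} {t : ℕ} :
      b.Holds s → Exec p s s' t → Exec (.branch b p q) s s' (b.cost s + 1 + t)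
  | branchFalse {b : Test} {p q : Prog} {s s' : State} {t : ℕ} :
      ¬ b.Holds s → Exec q s s' t → Exec (.branch b p q) s s' (b.cost s + 1 + t)
  | loopFalse {b : Test} {p : Prog} {s : State} :
      ¬ b.Holds s → Exec (.loop b p) s s (b.cost s + 1)
  | loopTrue {b : Test} {p : Prog} {s s' s'' : State} {t t' : ℕ} :
      b.Holds s → Exec p s s' t → Exec (.loop b p) s' s'' t' →
      Exec (.loop b p) s s'' (b.cost s + 1 + t + t')

end RealRam

/-! ## Input and output of the rounding algorithm -/

section InputOutput

/-- The number by which the machine addresses a variable; it is less than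
`n * T + n * T * T`. -/
def LPVar.index {n T : ℕ} : LPVar n T → ℕ
  | .slot j t => j.val * T + t.val
  | .span j I => n * T + (j.val * T + I.1.1.val) * T + I.1.2.val

/-- The base in which sets of variables are written as numbers. -/
def setBase (n T : ℕ) : ℕ := n * T + n * T * T + 1

/-- The set of variables denoted by the number `c`: its elements are the variables `v` for which
`v.index + 1` is a digit of `c` in base `setBase n T`. Thus every set of at most `s` variables is
denoted by some `c < setBase n T ^ s`. -/
def decodeSet (n T c : ℕ) : Finset (LPVar n T) :=
  Finset.univ.filter fun v => v.index + 1 ∈ Nat.digits (setBase n T) c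

open Classical in
/-- The memory at the start. Natural number array `0` holds `n, m, T`, array `1` holds the
incidence matrix of the precedence order, row by row; real array `0` holds `ε`, and real array `1`
holds the entries `y I` with `|I| ≤ 2 r + 1`, where cell `c` holds `y (decodeSet n T c)`. All
other cells are `0`. -/
noncomputable def inputState (S : SchedInstance) (T r : ℕ) (ε : ℝ)
    (y : Finset (LPVar S.n T) → ℝ) : RealRam.State where
  nat a i :=
    if a = 0 then (if i = 0 then S.n else if i = 1 then S.m else if i = 2 then T else 0)
    else if a = 1 then
      (if ∃ j k : Fin S.n, S.prec j k ∧ i = j.val * S.n + k.val then 1 else 0)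
    else 0
  real a c :=
    if a = 0 then (if c = 0 then ε else 0)
    else if a = 1 then
      (if c < setBase S.n T ^ (2 * r + 1) then y (decodeSet S.n T c) else 0)
    else 0

/-- The schedule that is found in natural number array `2` at the end. -/
def outputSchedule (S : SchedInstance) (s : RealRam.State) : Fin S.n → ℕ :=
  fun j => s.nat 2 j.val

end InputOutput

/-! ## A language of bounded loops and its compilation to `RealRam` -/

namespace BoundedLoops

open RealRam

/-! The diagonal entries of the slack matrices say that the linear program survives conditioning:
for a set `c` of at most `r` variables the numbers `mass y c j t` satisfy its inequalities scaled by
`y c` (`row_nonneg`). The rounding uses only the window of a job, from its first to its last slot of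
positive mass. Conditioning on one more variable shrinks windows (`Supp.of_insert`), comparable jobs
have windows ordered strictly at both ends (`IsWindow.lt_of_pr`), and windows satisfy Hall's
condition (`card_le_of_supp`). So only the signs of the entries of `y` are needed.

A forward pass goes down through levels `h`, from `2 ^ q ≥ T` to `0`. At level `h` the window of
every active job lies in a dyadic block of length `2 ^ h`, and the jobs of a block share one
conditioned set. A job is late for `j` if it is `j` or a predecessor of `j` and its window ends in a
later piece of length `2 ^ (h - K)` than the one in which the window of `j` begins. As long as some
`j` has at least `θ = 2 ^ (h - (K + k))` late jobs, its block is conditioned on `j` being in its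
first slot. All predecessors must then end before, so each late window loses a piece. A block starts
with at most `m * 2 ^ h * 2 ^ K` pieces of width, which bounds the conditionings of a stage by `m *
2 ^ (2 * K + k)` (`Conf.Valid.step`, `Conf.Budget.start`).

After that a lower level `h1` with `h ≤ h1 + K` is chosen. Active jobs whose windows meet two blocks
of length `2 ^ (h1 + k)` form the stage of height `h`, with windows rounded inward to blocks of
length `L = 2 ^ h1`. Jobs that only meet two blocks of length `L` are given up, and the others stay
active. The number of crossing jobs cannot grow geometrically through all candidate levels, so some
level gives up few jobs (`exists_level`).

The stages are placed greedily, low heights first and by right window end within a stage. While a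
job waits, a gap in a block inside its window must hold one of its predecessors of the same stage,
and this predecessor is late; so there are fewer than `θ` gaps per block. Together with Hall's
condition this leaves at most `3 * m * T / 2 ^ k` jobs of a stage unplaced
(`GreedyInput.Stage.card_unplaced`, `two_pow_mul_stage_le`). Every job without a place finally gets
a slot of its own (`Insertion`), so the makespan is at most `T` plus the number of these jobs.

With `X = m / ε`, `P` about `4 * X`, `2 ^ k` of order `(q + 1) * X` and `K = P * k * k`, the loss is
at most `ε * T`, and all stages together condition on at most `q * m * 2 ^ (2 * K + k)` variables,
which is below the assumed `r` (`budget_le_rpow`). If `n * n ≤ r` or `T = 1`, one takes `K = q`: the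
windows are conditioned down to points and no job is lost. The cases `T ≥ n`, `n = 2` and `ε ≥ 1`
are settled by list scheduling and Graham's bound.

The program never reads `ε`. It tries all parameters below `n` and keeps the best schedule. It is
written in a language of bounded loops whose closed statements compile to machine programs of
polynomial running time (`Stmt.exists_exec`). -/

/-- The natural number arrays of a machine. -/
abbrev Mem := ℕ → ℕ → ℕ

/-- The memory after assigning `v` to cell `i` of array `a`. -/
def put (M : Mem) (a i v : ℕ) : Mem := Function.update M a (Function.update (M a) i v)

/-- Multiplication is left out because the machine charges it by bit length. Each of these
operations costs a bounded number of steps, however long the codes of variable sets become. -/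
inductive BinOp : Type
  | add | sub | div | mod | le

def BinOp.eval : BinOp → ℕ → ℕ → ℕ
  | .add, u, v => u + v
  | .sub, u, v => u - v
  | .div, u, v => u / v
  | .mod, u, v => u % v
  | .le, u, v => if u ≤ v then 1 else 0

def BinOp.toNExp : BinOp → NExp → NExp → NExp
  | .add, u, v => .plus u v
  | .sub, u, v => .minus u v
  | .div, u, v => .quot u v
  | .mod, u, v => .rem u v
  | .le, u, v => .minus (.lit 1) (.minus u v)

/-- Expressions. `pos e` tests whether cell `e` of real array `1` is positive, and in
`sum x e` the variable `x` runs through the numbers below cell `0` of array `0`. -/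
inductive Ex : Type
  | lit (c : ℕ)
  | var (x : ℕ)
  | get (a : ℕ) (i : Ex)
  | bin (o : BinOp) (e f : Ex)
  | pos (e : Ex)
  | cond (b e f : Ex)
  | sum (x : ℕ) (e : Ex)

open Classical in
/-- The value of an expression. -/
noncomputable def Ex.eval (y : ℕ → ℝ) (M : Mem) : Ex → (ℕ → ℕ) → ℕ
  | .lit c, _ => c
  | .var x, ρ => ρ x
  | .get a i, ρ => M a (i.eval y M ρ)
  | .bin o e f, ρ => o.eval (e.eval y M ρ) (f.eval y M ρ)
  | .pos e, ρ => if 0 < y (e.eval y M ρ) then 1 else 0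
  | .cond b e f, ρ => if b.eval y M ρ ≠ 0 then e.eval y M ρ else f.eval y M ρ
  | .sum x e, ρ => ∑ i ∈ Finset.range (M 0 0), e.eval y M (Function.update ρ x i)

/-- The arrays of the machine that hold intermediate results and variables. -/
def Reserved (a : ℕ) : Prop := a = 50 ∨ a = 51

instance : DecidablePred Reserved := fun a => inferInstanceAs (Decidable (a = 50 ∨ a = 51))

/-- `e` has free variables in `Γ`, binds no variable twice and reads no reserved array. -/
def Ex.WF : List ℕ → Ex → Prop
  | _, .lit _ => True
  | Γ, .var x => x ∈ Γ
  | Γ, .get a i => ¬ Reserved a ∧ i.WF Γ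
  | Γ, .bin _ e f => e.WF Γ ∧ f.WF Γ
  | Γ, .pos e => e.WF Γ
  | Γ, .cond b e f => b.WF Γ ∧ e.WF Γ ∧ f.WF Γ
  | Γ, .sum x e => x ∉ Γ ∧ e.WF (x :: Γ)

/-- Array `50` is an evaluation stack indexed by depth; array `51` holds the loop variables. -/
def tmp (d : ℕ) : NExp := .get 50 (.lit d)

def setTmp (d : ℕ) (e : NExp) : Prog := .setNat 50 (.lit d) e

/-- The loop `for x < n do p`, where `n` is cell `0` of array `0`. -/
def loopTo (x : ℕ) (p : Prog) : Prog :=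
  .seq (.setNat 51 (.lit x) (.lit 0))
    (.loop (.natLe (.plus (.get 51 (.lit x)) (.lit 1)) (.get 0 (.lit 0)))
      (.seq p (.setNat 51 (.lit x) (.plus (.get 51 (.lit x)) (.lit 1)))))

/-- Code that leaves the value of an expression in cell `d` of array `50`. -/
def Ex.compile : Ex → ℕ → Prog
  | .lit c, d => setTmp d (.lit c)
  | .var x, d => setTmp d (.get 51 (.lit x))
  | .get a i, d => .seq (i.compile d) (setTmp d (.get a (tmp d)))
  | .bin o e f, d =>
      .seq (e.compile d) (.seq (f.compile (d + 1)) (setTmp d (o.toNExp (tmp d) (tmp (d + 1)))))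
  | .pos e, d =>
      .seq (e.compile d) (.branch (.neg (.realLe (.get 1 (tmp d)) .zero))
        (setTmp d (.lit 1)) (setTmp d (.lit 0)))
  | .cond b e f, d =>
      .seq (b.compile d) (.branch (.natLe (.lit 1) (tmp d)) (e.compile d) (f.compile d))
  | .sum x e, d =>
      .seq (setTmp d (.lit 0))
        (loopTo x (.seq (e.compile (d + 1)) (setTmp d (.plus (tmp d) (tmp (d + 1))))))

/-- A bound for the running time of the compiled expression. -/
def Ex.cost (n : ℕ) : Ex → ℕ
  | .lit _ => 20
  | .var _ => 20
  | .get _ i => i.cost n + 20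
  | .bin _ e f => e.cost n + f.cost n + 20
  | .pos e => e.cost n + 20
  | .cond b e f => b.cost n + e.cost n + f.cost n + 20
  | .sum _ e => n * (e.cost n + 40) + 40

/-- The state `s` represents the memory `M` and the values `ρ` of the variables in `Γ`. -/
structure Repr (Γ : List ℕ) (ρ : ℕ → ℕ) (M : Mem) (y : ℕ → ℝ) (s : State) : Prop where
  mem : ∀ a, ¬ Reserved a → s.nat a = M a
  var : ∀ x ∈ Γ, s.nat 51 x = ρ x
  real : s.real 1 = y

theorem Repr.putTmp {Γ : List ℕ} {ρ : ℕ → ℕ} {M : Mem} {y : ℕ → ℝ} {s : State}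
    (h : Repr Γ ρ M y s) (d v : ℕ) : Repr Γ ρ M y (s.putNat 50 d v) := by
  refine ⟨fun a ha => ?_, fun x hx => ?_, h.real⟩
  · have : a ≠ 50 := fun h => ha (Or.inl h)
    simp [State.putNat, Function.update_of_ne this, h.mem a ha]
  · simp [State.putNat, h.var x hx]

theorem Repr.putVar {Γ : List ℕ} {ρ : ℕ → ℕ} {M : Mem} {y : ℕ → ℝ} {s : State}
    (h : Repr Γ ρ M y s) {x : ℕ} (hx : x ∉ Γ) (v : ℕ) :
    Repr (x :: Γ) (Function.update ρ x v) M y (s.putNat 51 x v) := by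
  refine ⟨fun a ha => ?_, fun z hz => ?_, h.real⟩
  · have : a ≠ 51 := fun h => ha (Or.inr h)
    simp [State.putNat, Function.update_of_ne this, h.mem a ha]
  · by_cases hzx : z = x
    · subst hzx; simp [State.putNat]
    · have hz' : z ∈ Γ := by simpa [hzx] using hz
      simp [State.putNat, Function.update_of_ne hzx, h.var z hz']

theorem Repr.of_cons {Γ : List ℕ} {ρ : ℕ → ℕ} {M : Mem} {y : ℕ → ℝ} {s : State} {x v : ℕ}
    (hx : x ∉ Γ) (h : Repr (x :: Γ) (Function.update ρ x v) M y s) : Repr Γ ρ M y s := by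
  refine ⟨h.mem, fun z hz => ?_, h.real⟩
  have hzx : z ≠ x := fun e => hx (e ▸ hz)
  simpa [Function.update_of_ne hzx] using h.var z (List.mem_cons_of_mem _ hz)

@[simp] theorem putNat_nat_self (s : State) (a i v : ℕ) : (s.putNat a i v).nat a i = v := by
  simp [State.putNat]

theorem putNat_nat_of_ne (s : State) {a b : ℕ} (i v : ℕ) (h : b ≠ a) :
    (s.putNat a i v).nat b = s.nat b := by
  simp [State.putNat, h]

theorem putNat_nat_cell_of_ne (s : State) (a v : ℕ) {i j : ℕ} (h : j ≠ i) :
    (s.putNat a i v).nat a j = s.nat a j := by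
  simp [State.putNat, h]

/-- Execution of a counting loop with an invariant that may refer to the round. -/
theorem exec_loopTo {Γ : List ℕ} {ρ : ℕ → ℕ} {y : ℕ → ℝ} {x n c : ℕ} {p : Prog}
    (hx : x ∉ Γ) (Ms : ℕ → Mem) (I : ℕ → State → Prop) (hn : ∀ i, Ms i 0 0 = n)
    (hI : ∀ i s v, I i s → I i (s.putNat 51 x v))
    (hp : ∀ i s, i < n → Repr (x :: Γ) (Function.update ρ x i) (Ms i) y s → I i s →
      ∃ s' t, Exec p s s' t ∧ t ≤ c ∧ Repr (x :: Γ) (Function.update ρ x i) (Ms (i + 1)) y s' ∧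
        I (i + 1) s')
    (s : State) (hs : Repr Γ ρ (Ms 0) y s) (h0 : I 0 s) :
    ∃ s' t, Exec (loopTo x p) s s' t ∧ t ≤ n * (c + 20) + 20 ∧ Repr Γ ρ (Ms n) y s' ∧ I n s' := by
  -- Induction on the number `k` of rounds that are left, since the semantics of a loop peels off
  -- its first round.
  have key : ∀ k i s, i + k = n → Repr (x :: Γ) (Function.update ρ x i) (Ms i) y s → I i s →
      ∃ s' t, Exec (.loop (.natLe (.plus (.get 51 (.lit x)) (.lit 1)) (.get 0 (.lit 0)))
        (.seq p (.setNat 51 (.lit x) (.plus (.get 51 (.lit x)) (.lit 1))))) s s' t ∧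
        t ≤ k * (c + 20) + 10 ∧ Repr Γ ρ (Ms n) y s' ∧ I n s' := by
    intro k
    induction k with
    | zero =>
      intro i s hi hs hIs
      have hv : s.nat 51 x = i := by simpa using hs.var x (by simp)
      have h0 : s.nat 0 0 = n := by rw [hs.mem 0 (by decide), hn]
      obtain rfl : i = n := by omega
      refine ⟨s, _, Exec.loopFalse ?_, ?_, hs.of_cons hx, hIs⟩
      · simp [Test.Holds, NExp.val, hv, h0]
      · simp [Test.cost, NExp.cost]
    | succ k ih =>
      intro i s hi hs hIs
      have hv : s.nat 51 x = i := by simpa using hs.var x (by simp)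
      have h0 : s.nat 0 0 = n := by rw [hs.mem 0 (by decide), hn]
      obtain ⟨s1, t1, he, ht, hs1, hI1⟩ := hp i s (by omega) hs hIs
      have hv1 : s1.nat 51 x = i := by simpa using hs1.var x (by simp)
      have hs2 := (hs1.of_cons hx).putVar hx (i + 1)
      obtain ⟨s2, t2, he2, ht2, hs2, hI2⟩ := ih (i + 1) _ (by omega) hs2 (hI _ _ (i + 1) hI1)
      refine ⟨s2, _, Exec.loopTrue (t' := t2) ?_ (Exec.seq he (Exec.setNat _ _ _ _)) ?_, ?_, hs2,
        hI2⟩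
      · simp [Test.Holds, NExp.val, hv, h0]; omega
      · simpa [NExp.val, hv1] using he2
      · simp only [Test.cost, NExp.cost, Nat.succ_mul]; omega
  obtain ⟨s', t, he, ht, h1, h2⟩ := key n 0 _ (by omega) (hs.putVar hx 0) (hI _ _ 0 h0)
  refine ⟨s', _, Exec.seq (Exec.setNat _ _ _ _) he, ?_, h1, h2⟩
  simp only [NExp.cost]; omega

/-- The last clause makes the induction work: code at depth `d + 1` does not disturb cell `d`, where
the left operand or the partial sum is kept. -/
theorem Ex.exec_compile (y : ℕ → ℝ) (M : Mem) (e : Ex) :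
    ∀ (Γ : List ℕ) (ρ : ℕ → ℕ) (d : ℕ) (s : State), e.WF Γ → Repr Γ ρ M y s →
      ∃ s' t, Exec (e.compile d) s s' t ∧ t ≤ e.cost (M 0 0) ∧ Repr Γ ρ M y s' ∧
        s'.nat 50 d = e.eval y M ρ ∧ ∀ d' < d, s'.nat 50 d' = s.nat 50 d' := by
  induction e with
  | lit c =>
    intro Γ ρ d s _ hs
    refine ⟨_, _, Exec.setNat _ _ _ _, ?_, hs.putTmp _ _, ?_, fun d' hd' => ?_⟩
    · simp [NExp.cost, Ex.cost]
    · simp [NExp.val, Ex.eval]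
    · exact putNat_nat_cell_of_ne _ _ _ hd'.ne
  | var x =>
    intro Γ ρ d s hw hs
    refine ⟨_, _, Exec.setNat _ _ _ _, ?_, hs.putTmp _ _, ?_, fun d' hd' => ?_⟩
    · simp [NExp.cost, Ex.cost]
    · simp [NExp.val, Ex.eval, hs.var x hw]
    · exact putNat_nat_cell_of_ne _ _ _ hd'.ne
  | get a i ih =>
    intro Γ ρ d s hw hs
    obtain ⟨s1, t1, he, ht, hs1, hv, hf⟩ := ih Γ ρ d s hw.2 hs
    refine ⟨_, _, Exec.seq he (Exec.setNat _ _ _ _), ?_, hs1.putTmp _ _, ?_, fun d' hd' => ?_⟩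
    · simp only [tmp, NExp.cost, Ex.cost]; omega
    · simp [NExp.val, Ex.eval, tmp, hv, hs1.mem a hw.1]
    · rw [← hf d' hd']; exact putNat_nat_cell_of_ne _ _ _ hd'.ne
  | bin o e f ihe ihf =>
    intro Γ ρ d s hw hs
    obtain ⟨s1, t1, he1, ht1, hs1, hv1, hf1⟩ := ihe Γ ρ d s hw.1 hs
    obtain ⟨s2, t2, he2, ht2, hs2, hv2, hf2⟩ := ihf Γ ρ (d + 1) s1 hw.2 hs1
    refine ⟨_, _, Exec.seq he1 (Exec.seq he2 (Exec.setNat _ _ _ _)), ?_, hs2.putTmp _ _, ?_,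
      fun d' hd' => ?_⟩
    · cases o <;> simp only [tmp, BinOp.toNExp, NExp.cost, Ex.cost] <;> omega
    · have h3 : s2.nat 50 d = e.eval y M ρ := by rw [hf2 d (by omega), hv1]
      have h4 : ((o.toNExp (tmp d) (tmp (d + 1))).val s2)
          = o.eval (e.eval y M ρ) (f.eval y M ρ) := by
        cases o <;> simp only [tmp, BinOp.toNExp, NExp.val, BinOp.eval, h3, hv2]
        split_ifs <;> omega
      simp [NExp.val, Ex.eval, h4]
    · rw [← hf1 d' hd', ← hf2 d' (by omega)]; exact putNat_nat_cell_of_ne _ _ _ hd'.ne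
  | pos e ih =>
    intro Γ ρ d s hw hs
    obtain ⟨s1, t1, he, ht, hs1, hv, hf⟩ := ih Γ ρ d s hw hs
    by_cases hb : 0 < y (e.eval y M ρ)
    · refine ⟨_, _, Exec.seq he (Exec.branchTrue ?_ (Exec.setNat _ _ _ _)), ?_, hs1.putTmp _ _,
        ?_, fun d' hd' => ?_⟩
      · simpa [Test.Holds, RExp.val, NExp.val, tmp, hv, hs1.real] using hb
      · simp only [tmp, NExp.cost, RExp.cost, Test.cost, Ex.cost]; omega
      · simp [NExp.val, Ex.eval, hb]
      · rw [← hf d' hd']; exact putNat_nat_cell_of_ne _ _ _ hd'.ne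
    · refine ⟨_, _, Exec.seq he (Exec.branchFalse ?_ (Exec.setNat _ _ _ _)), ?_, hs1.putTmp _ _,
        ?_, fun d' hd' => ?_⟩
      · simpa [Test.Holds, RExp.val, NExp.val, tmp, hv, hs1.real] using hb
      · simp only [tmp, NExp.cost, RExp.cost, Test.cost, Ex.cost]; omega
      · simp [NExp.val, Ex.eval, hb]
      · rw [← hf d' hd']; exact putNat_nat_cell_of_ne _ _ _ hd'.ne
  | cond b e f ihb ihe ihf =>
    intro Γ ρ d s hw hs
    obtain ⟨s1, t1, he1, ht1, hs1, hv1, hf1⟩ := ihb Γ ρ d s hw.1 hs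
    by_cases hb : b.eval y M ρ = 0
    · obtain ⟨s2, t2, he2, ht2, hs2, hv2, hf2⟩ := ihf Γ ρ d s1 hw.2.2 hs1
      refine ⟨_, _, Exec.seq he1 (Exec.branchFalse ?_ he2), ?_, hs2, ?_, fun d' hd' => ?_⟩
      · simp [Test.Holds, NExp.val, tmp, hv1, hb]
      · simp only [tmp, NExp.cost, Test.cost, Ex.cost]; omega
      · simp [hv2, Ex.eval, hb]
      · rw [hf2 d' hd', hf1 d' hd']
    · obtain ⟨s2, t2, he2, ht2, hs2, hv2, hf2⟩ := ihe Γ ρ d s1 hw.2.1 hs1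
      refine ⟨_, _, Exec.seq he1 (Exec.branchTrue ?_ he2), ?_, hs2, ?_, fun d' hd' => ?_⟩
      · simp [Test.Holds, NExp.val, tmp, hv1]; omega
      · simp only [tmp, NExp.cost, Test.cost, Ex.cost]; omega
      · simp [hv2, Ex.eval, hb]
      · rw [hf2 d' hd', hf1 d' hd']
  | sum x e ih =>
    intro Γ ρ d s hw hs
    let I : ℕ → State → Prop := fun i s' =>
      s'.nat 50 d = ∑ j ∈ Finset.range i, e.eval y M (Function.update ρ x j) ∧
        ∀ d' < d, s'.nat 50 d' = s.nat 50 d'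
    obtain ⟨s1, t1, he, ht, hs1, hv, hf⟩ := exec_loopTo (Γ := Γ) (ρ := ρ) (y := y) (x := x)
      (n := M 0 0) (c := e.cost (M 0 0) + 20)
      (p := .seq (e.compile (d + 1)) (setTmp d (.plus (tmp d) (tmp (d + 1))))) hw.1
      (fun _ => M) I (fun _ => rfl)
      (fun i s' v h => by simpa [I, putNat_nat_of_ne] using h)
      (fun i s' hi hs' hI' => by
        obtain ⟨s2, t2, he2, ht2, hs2, hv2, hf2⟩ :=
          ih (x :: Γ) (Function.update ρ x i) (d + 1) s' hw.2 hs'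
        refine ⟨_, _, Exec.seq he2 (Exec.setNat _ _ _ _), ?_, hs2.putTmp _ _, ?_, ?_⟩
        · simp only [tmp, NExp.cost]; omega
        · simp [NExp.val, tmp, hv2, hf2 d (by omega), hI'.1, Finset.sum_range_succ]
        · intro d' hd'
          rw [← hI'.2 d' hd', ← hf2 d' (by omega)]
          exact putNat_nat_cell_of_ne _ _ _ hd'.ne)
      (s.putNat 50 d 0) (hs.putTmp d 0)
      ⟨by simp, fun d' hd' => putNat_nat_cell_of_ne _ _ _ hd'.ne⟩
    refine ⟨s1, _, Exec.seq (t' := t1) (Exec.setNat _ _ _ _) ?_, ?_, hs1, ?_, hf⟩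
    · simpa [NExp.val] using he
    · simp only [NExp.cost, Ex.cost]
      have : e.cost (M 0 0) + 20 + 20 = e.cost (M 0 0) + 40 := by ring
      rw [this] at ht; omega
    · simpa [Ex.eval] using hv

/-- Statements. In `for' x c` the variable `x` runs through the numbers below cell `0` of
array `0`. -/
inductive Stmt : Type
  | skip
  | set (a : ℕ) (i e : Ex)
  | seq (c d : Stmt)
  | ite (b : Ex) (c d : Stmt)
  | for' (x : ℕ) (c : Stmt)

/-- The effect of a statement. -/
noncomputable def Stmt.run (y : ℕ → ℝ) : Stmt → (ℕ → ℕ) → Mem → Mem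
  | .skip, _, M => M
  | .set a i e, ρ, M => put M a (i.eval y M ρ) (e.eval y M ρ)
  | .seq c d, ρ, M => d.run y ρ (c.run y ρ M)
  | .ite b c d, ρ, M => if b.eval y M ρ ≠ 0 then c.run y ρ M else d.run y ρ M
  | .for' x c, ρ, M =>
      Nat.rec M (fun i M' => c.run y (Function.update ρ x i) M') (M 0 0)

/-- The statement is closed over `Γ` and changes neither array `0` nor a reserved array. -/
def Stmt.WF : List ℕ → Stmt → Prop
  | _, .skip => True
  | Γ, .set a i e => (¬ Reserved a ∧ a ≠ 0) ∧ i.WF Γ ∧ e.WF Γ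
  | Γ, .seq c d => c.WF Γ ∧ d.WF Γ
  | Γ, .ite b c d => b.WF Γ ∧ c.WF Γ ∧ d.WF Γ
  | Γ, .for' x c => x ∉ Γ ∧ c.WF (x :: Γ)

/-- The arrays to which a statement writes. -/
def Stmt.writes : Stmt → List ℕ
  | .skip => []
  | .set a _ _ => [a]
  | .seq c d => c.writes ++ d.writes
  | .ite _ c d => c.writes ++ d.writes
  | .for' _ c => c.writes

/-- The frame rule. The list of written arrays is computable, so its side conditions are settled by
evaluation. -/
theorem Stmt.run_of_notMem_writes (y : ℕ → ℝ) (a : ℕ) (c : Stmt) :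
    ∀ (ρ : ℕ → ℕ) (M : Mem), a ∉ c.writes → c.run y ρ M a = M a := by
  induction c with
  | skip => intros; rfl
  | set b i e =>
    intro ρ M h
    have : a ≠ b := by simpa [Stmt.writes] using h
    simp [Stmt.run, put, this]
  | seq c d ihc ihd =>
    intro ρ M h
    simp only [Stmt.writes, List.mem_append, not_or] at h
    simp [Stmt.run, ihd _ _ h.2, ihc _ _ h.1]
  | ite b c d ihc ihd =>
    intro ρ M h
    simp only [Stmt.writes, List.mem_append, not_or] at h
    simp only [Stmt.run]
    split_ifs
    · exact ihc _ _ h.1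
    · exact ihd _ _ h.2
  | for' x c ih =>
    intro ρ M h
    simp only [Stmt.run]
    induction M 0 0 with
    | zero => rfl
    | succ k ihk => exact (ih _ _ h).trans ihk

/-- Cell `0` of array `0` bounds every loop. As it never changes, numbers of rounds and running
times depend on its initial value only. -/
theorem Stmt.WF.zero_notMem_writes (c : Stmt) : ∀ Γ, c.WF Γ → 0 ∉ c.writes := by
  induction c with
  | skip => intro _ _; simp [Stmt.writes]
  | set b i e => intro Γ h; simpa [Stmt.writes] using h.1.2.symm
  | seq c d ihc ihd =>
    intro Γ h; simpa [Stmt.writes] using ⟨ihc Γ h.1, ihd Γ h.2⟩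
  | ite b c d ihc ihd =>
    intro Γ h; simpa [Stmt.writes] using ⟨ihc Γ h.2.1, ihd Γ h.2.2⟩
  | for' x c ih => intro Γ h; exact ih _ h.2

def Stmt.compile : Stmt → Prog
  | .skip => .skip
  | .set a i e => .seq (i.compile 0) (.seq (e.compile 1) (.setNat a (tmp 0) (tmp 1)))
  | .seq c d => .seq c.compile d.compile
  | .ite b c d => .seq (b.compile 0) (.branch (.natLe (.lit 1) (tmp 0)) c.compile d.compile)
  | .for' x c => loopTo x c.compile

/-- A bound for the running time of the compiled statement. -/
def Stmt.cost (n : ℕ) : Stmt → ℕ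
  | .skip => 1
  | .set _ i e => i.cost n + e.cost n + 20
  | .seq c d => c.cost n + d.cost n
  | .ite b c d => b.cost n + c.cost n + d.cost n + 20
  | .for' _ c => n * (c.cost n + 20) + 20

theorem Stmt.exec_compile (y : ℕ → ℝ) (c : Stmt) :
    ∀ (Γ : List ℕ) (ρ : ℕ → ℕ) (M : Mem) (s : State), c.WF Γ → Repr Γ ρ M y s →
      ∃ s' t, Exec c.compile s s' t ∧ t ≤ c.cost (M 0 0) ∧ Repr Γ ρ (c.run y ρ M) y s' := by
  induction c with
  | skip =>
    intro Γ ρ M s _ hs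
    exact ⟨s, 1, Exec.skip s, le_rfl, hs⟩
  | set a i e =>
    intro Γ ρ M s hw hs
    obtain ⟨s1, t1, he1, ht1, hs1, hv1, -⟩ := i.exec_compile y M Γ ρ 0 s hw.2.1 hs
    obtain ⟨s2, t2, he2, ht2, hs2, hv2, hf2⟩ := e.exec_compile y M Γ ρ 1 s1 hw.2.2 hs1
    refine ⟨_, _, Exec.seq he1 (Exec.seq he2 (Exec.setNat _ _ _ _)), ?_, ?_⟩
    · simp only [tmp, NExp.cost, Stmt.cost]; omega
    · have h0 : s2.nat 50 0 = i.eval y M ρ := by rw [hf2 0 (by omega), hv1]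
      refine ⟨fun b hb => ?_, fun x hx => ?_, hs2.real⟩
      · by_cases hab : b = a
        · subst hab
          simp [State.putNat, Stmt.run, put, tmp, NExp.val, h0, hv2, hs2.mem b hb]
        · simp [State.putNat, Stmt.run, put, hab, hs2.mem b hb]
      · have : (51 : ℕ) ≠ a := fun h => hw.1.1 (Or.inr h.symm)
        simp [State.putNat, this, hs2.var x hx]
  | seq c d ihc ihd =>
    intro Γ ρ M s hw hs
    obtain ⟨s1, t1, he1, ht1, hs1⟩ := ihc Γ ρ M s hw.1 hs
    obtain ⟨s2, t2, he2, ht2, hs2⟩ := ihd Γ ρ _ s1 hw.2 hs1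
    rw [c.run_of_notMem_writes y 0 _ _ (Stmt.WF.zero_notMem_writes c Γ hw.1)] at ht2
    exact ⟨s2, _, Exec.seq he1 he2, Nat.add_le_add ht1 ht2, hs2⟩
  | ite b c d ihc ihd =>
    intro Γ ρ M s hw hs
    obtain ⟨s1, t1, he1, ht1, hs1, hv1, -⟩ := b.exec_compile y M Γ ρ 0 s hw.1 hs
    by_cases hb : b.eval y M ρ = 0
    · obtain ⟨s2, t2, he2, ht2, hs2⟩ := ihd Γ ρ M s1 hw.2.2 hs1
      refine ⟨_, _, Exec.seq he1 (Exec.branchFalse ?_ he2), ?_, ?_⟩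
      · simp [Test.Holds, NExp.val, tmp, hv1, hb]
      · simp only [tmp, NExp.cost, Test.cost, Stmt.cost]; omega
      · simpa [Stmt.run, hb] using hs2
    · obtain ⟨s2, t2, he2, ht2, hs2⟩ := ihc Γ ρ M s1 hw.2.1 hs1
      refine ⟨_, _, Exec.seq he1 (Exec.branchTrue ?_ he2), ?_, ?_⟩
      · simp [Test.Holds, NExp.val, tmp, hv1]; omega
      · simp only [tmp, NExp.cost, Test.cost, Stmt.cost]; omega
      · simpa [Stmt.run, hb] using hs2
  | for' x c ih =>
    intro Γ ρ M s hw hs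
    let Ms : ℕ → Mem := fun k =>
      Nat.rec M (fun i M' => c.run y (Function.update ρ x i) M') k
    have h0 : ∀ k, Ms k 0 0 = M 0 0 := by
      intro k
      induction k with
      | zero => rfl
      | succ k ihk =>
        rw [← ihk]
        exact congrFun (c.run_of_notMem_writes y 0 _ _ (Stmt.WF.zero_notMem_writes c _ hw.2)) 0
    obtain ⟨s1, t1, he, ht, hs1, -⟩ := exec_loopTo (Γ := Γ) (ρ := ρ) (y := y) (x := x)
      (n := M 0 0) (c := c.cost (M 0 0)) (p := c.compile) hw.1 Ms (fun _ _ => True) h0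
      (fun _ _ _ h => h)
      (fun i s' hi hs' _ => by
        obtain ⟨s2, t2, he2, ht2, hs2⟩ := ih (x :: Γ) (Function.update ρ x i) (Ms i) s' hw.2 hs'
        rw [h0] at ht2
        exact ⟨s2, t2, he2, ht2, hs2, trivial⟩) s hs trivial
    exact ⟨s1, t1, he, ht, hs1⟩

/-! ### Polynomial running time of compiled statements -/

/-- `f` is bounded by a power of its argument. -/
def PolyBounded (f : ℕ → ℕ) : Prop := ∃ K, ∀ n, 2 ≤ n → f n ≤ n ^ K

theorem PolyBounded.const (c : ℕ) : PolyBounded fun _ => c :=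
  ⟨c, fun _ hn => (Nat.lt_two_pow_self.le).trans (Nat.pow_le_pow_left hn c)⟩

theorem PolyBounded.add {f g : ℕ → ℕ} (hf : PolyBounded f) (hg : PolyBounded g) :
    PolyBounded fun n => f n + g n := by
  obtain ⟨K, hK⟩ := hf
  obtain ⟨L, hL⟩ := hg
  refine ⟨max K L + 1, fun n hn => ?_⟩
  have h1 := (hK n hn).trans (Nat.pow_le_pow_right (by omega) (le_max_left K L))
  have h2 := (hL n hn).trans (Nat.pow_le_pow_right (by omega) (le_max_right K L))
  calc f n + g n ≤ 2 * n ^ max K L := by omega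
    _ ≤ n * n ^ max K L := Nat.mul_le_mul_right _ hn
    _ = n ^ (max K L + 1) := by ring

theorem PolyBounded.id_mul {f : ℕ → ℕ} (hf : PolyBounded f) : PolyBounded fun n => n * f n := by
  obtain ⟨K, hK⟩ := hf
  exact ⟨K + 1, fun n hn => by rw [pow_succ']; exact Nat.mul_le_mul_left _ (hK n hn)⟩

theorem Ex.polyBounded_cost (e : Ex) : PolyBounded fun n => e.cost n := by
  induction e with
  | lit c => exact .const 20
  | var x => exact .const 20
  | get a i ih => exact ih.add (.const 20)
  | bin o e f ihe ihf => exact (ihe.add ihf).add (.const 20)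
  | pos e ih => exact ih.add (.const 20)
  | cond b e f ihb ihe ihf => exact ((ihb.add ihe).add ihf).add (.const 20)
  | sum x e ih => exact (ih.add (.const 40)).id_mul.add (.const 40)

theorem Stmt.polyBounded_cost (c : Stmt) : PolyBounded fun n => c.cost n := by
  induction c with
  | skip => exact .const 1
  | set a i e => exact (i.polyBounded_cost.add e.polyBounded_cost).add (.const 20)
  | seq c d ihc ihd => exact ihc.add ihd
  | ite b c d ihc ihd => exact ((b.polyBounded_cost.add ihc).add ihd).add (.const 20)
  | for' x c ih => exact (ih.add (.const 20)).id_mul.add (.const 20)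

/-- Closed statements are executed in polynomial time. -/
theorem Stmt.exists_exec (c : Stmt) (hc : c.WF []) :
    ∃ K, ∀ s : State, 2 ≤ s.nat 0 0 → ∃ s' t, Exec c.compile s s' t ∧ t ≤ s.nat 0 0 ^ K ∧
      ∀ a, ¬ Reserved a → s'.nat a = c.run (s.real 1) (fun _ => 0) s.nat a := by
  obtain ⟨K, hK⟩ := c.polyBounded_cost
  refine ⟨K, fun s hs => ?_⟩
  obtain ⟨s', t, he, ht, hs'⟩ := c.exec_compile (s.real 1) [] (fun _ => 0) s.nat s hc
    ⟨fun _ _ => rfl, by simp, rfl⟩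
  exact ⟨s', t, he, ht.trans (hK _ hs), hs'.mem⟩

end BoundedLoops

/-! ## Consequences of the Lasserre constraints -/

namespace SchedRounding

/-- The variables, split into the two kinds. -/
def lpVarEquiv (n T : ℕ) :
    (Fin n × Fin T) ⊕ (Fin n × {p : Fin T × Fin T // p.1 ≤ p.2}) ≃ LPVar n T where
  toFun
    | .inl p => .slot p.1 p.2
    | .inr p => .span p.1 p.2
  invFun
    | .slot j t => .inl (j, t)
    | .span j I => .inr (j, I)
  left_inv := by rintro (p | p) <;> rfl
  right_inv := by rintro (⟨j, t⟩ | ⟨j, I⟩) <;> rfl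

theorem sum_lpVar {n T : ℕ} (f : LPVar n T → ℝ) (hf : ∀ j I, f (.span j I) = 0) :
    ∑ v, f v = ∑ j, ∑ t, f (.slot j t) := by
  rw [← (lpVarEquiv n T).sum_comp, Fintype.sum_sum_type, Fintype.sum_prod_type]
  simp [lpVarEquiv, hf]

section
variable {S : SchedInstance} {T r : ℕ} {y : Finset (LPVar S.n T) → ℝ}

/-- The linear inequalities hold after conditioning on a set of at most `r` variables. -/
theorem row_nonneg (hy : y ∈ schedLasserre S T r) {c : Finset (LPVar S.n T)} (hc : c.card ≤ r)
    (l : LPRow S T) :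
    lpRhs S T l * y c ≤ ∑ v, lpMatrix S T l v * y (insert v c) := by
  have h := (hy.2.1 l).diag_nonneg (i := ⟨c, hc⟩)
  simp only [slackMatrix, Matrix.of_apply, Finset.union_idempotent] at h
  have : ∀ v, c ∪ {v} = insert v c := fun v => by rw [Finset.union_comm]; rfl
  simp only [this] at h
  linarith

variable (y) in
/-- The probability of the slot `t` for the job `j`, after conditioning on `c`, times `y c`. -/
noncomputable def mass (c : Finset (LPVar S.n T)) (j : Fin S.n) (t : Fin T) : ℝ :=
  y (insert (.slot j t) c)

theorem mass_nonneg (hy : y ∈ schedLasserre S T r) {c : Finset (LPVar S.n T)} (hc : c.card ≤ r)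
    (j : Fin S.n) (t : Fin T) : 0 ≤ mass y c j t := by
  have h := row_nonneg hy hc (.lower j t)
  rw [sum_lpVar _ (by simp [lpMatrix])] at h
  simp only [lpMatrix, lpRhs, ite_and, ite_mul, one_mul, zero_mul] at h
  simpa [mass] using h

theorem mass_le (hy : y ∈ schedLasserre S T r) {c : Finset (LPVar S.n T)} (hc : c.card ≤ r)
    (j : Fin S.n) (t : Fin T) : mass y c j t ≤ y c := by
  have h := row_nonneg hy hc (.upper j t)
  rw [sum_lpVar _ (by simp [lpMatrix])] at h
  simp only [lpMatrix, lpRhs, ite_and, ite_mul, zero_mul] at h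
  simp at h
  simpa [mass] using h

theorem sum_mass (hy : y ∈ schedLasserre S T r) {c : Finset (LPVar S.n T)} (hc : c.card ≤ r)
    (j : Fin S.n) : ∑ t, mass y c j t = y c := by
  have h := row_nonneg hy hc (.assignGe j)
  have h' := row_nonneg hy hc (.assignLe j)
  rw [sum_lpVar _ (by simp [lpMatrix]), Finset.sum_comm] at h h'
  simp only [lpMatrix, lpRhs, ite_mul, zero_mul, one_mul] at h h'
  simp at h h'
  exact le_antisymm h' h

theorem sum_mass_le (hy : y ∈ schedLasserre S T r) {c : Finset (LPVar S.n T)} (hc : c.card ≤ r)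
    (t : Fin T) : ∑ j, mass y c j t ≤ S.m * y c := by
  have h := row_nonneg hy hc (.load t)
  rw [sum_lpVar _ (by simp [lpMatrix])] at h
  simp only [lpMatrix, lpRhs, ite_mul, zero_mul] at h
  simp at h
  exact h

theorem sum_mass_order (hy : y ∈ schedLasserre S T r) {c : Finset (LPVar S.n T)}
    (hc : c.card ≤ r) {i j : Fin S.n} (hij : S.prec i j) (t : Fin (T + 1)) :
    ∑ t' : Fin T, (if t'.val ≤ t.val then mass y c j t' else 0) ≤
      ∑ t' : Fin T, (if t'.val < t.val then mass y c i t' else 0) := by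
  have h := row_nonneg hy hc (.order i j hij t)
  rw [sum_lpVar _ (by simp [lpMatrix])] at h
  simp only [lpMatrix, lpRhs, zero_mul, sub_mul, Finset.sum_sub_distrib, ite_and, ite_mul,
    one_mul] at h
  rw [Finset.sum_comm, Finset.sum_comm (s := Finset.univ) (t := Finset.univ)] at h
  simp only [Nat.succ_le_iff, Nat.lt_succ_iff] at h
  simpa [mass] using h

/-- The job `j` may be in slot `t` after conditioning on `c`. -/
def Supp (y : Finset (LPVar S.n T) → ℝ) (c : Finset (LPVar S.n T)) (j t : ℕ) : Prop :=
  ∃ (hj : j < S.n) (ht : t < T), 0 < mass y c ⟨j, hj⟩ ⟨t, ht⟩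

/-- The precedence order on the numbers of the jobs. -/
def Pr (S : SchedInstance) (i j : ℕ) : Prop :=
  ∃ (hi : i < S.n) (hj : j < S.n), S.prec ⟨i, hi⟩ ⟨j, hj⟩

theorem Pr.irrefl (i : ℕ) : ¬ Pr S i i := fun ⟨_, _, h⟩ => S.irrefl _ h

theorem Pr.trans {i j k : ℕ} : Pr S i j → Pr S j k → Pr S i k :=
  fun ⟨hi, _, h⟩ ⟨_, hk, h'⟩ => ⟨hi, hk, S.trans _ _ _ h h'⟩

/-- `a` and `b` are the ends of the support of the job `j`. -/
structure IsWindow (y : Finset (LPVar S.n T) → ℝ) (c : Finset (LPVar S.n T)) (j a b : ℕ) :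
    Prop where
  left : Supp y c j a
  right : Supp y c j b
  mem : ∀ t, Supp y c j t → a ≤ t ∧ t ≤ b

theorem exists_supp (hy : y ∈ schedLasserre S T r) {c : Finset (LPVar S.n T)} (hc : c.card ≤ r)
    (h0 : 0 < y c) {j : ℕ} (hj : j < S.n) : ∃ t, Supp y c j t := by
  by_contra! h
  have : ∑ t, mass y c ⟨j, hj⟩ t ≤ 0 := Finset.sum_nonpos fun t _ => by
    have := h t
    simp only [Supp, not_exists] at this
    exact not_lt.1 (this hj t.2)
  rw [sum_mass hy hc] at this
  linarith

theorem Supp.lt {c : Finset (LPVar S.n T)} {j t : ℕ} (h : Supp y c j t) : t < T := h.2.1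

theorem mass_eq_zero (hy : y ∈ schedLasserre S T r) {c : Finset (LPVar S.n T)}
    (hc : c.card ≤ r) {j : Fin S.n} {t : Fin T} (h : ¬ Supp y c j t) : mass y c j t = 0 := by
  refine le_antisymm (not_lt.1 fun h' => h ⟨j.2, t.2, h'⟩) (mass_nonneg hy hc j t)

/-- Read the precedence inequality at `t = a'`: the later job has mass up to `a'`, so the earlier
one has mass strictly before it. At `t = b'` the left side is all of `y c`, so the whole mass of the
earlier job lies strictly before `b'`. -/
theorem IsWindow.lt_of_pr (hy : y ∈ schedLasserre S T r) {c : Finset (LPVar S.n T)}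
    (hc : c.card ≤ r) {i j a b a' b' : ℕ} (hij : Pr S i j)
    (hi : IsWindow y c i a b) (hj : IsWindow y c j a' b') : a < a' ∧ b < b' := by
  obtain ⟨hin, hjn, hp⟩ := hij
  constructor
  · obtain ⟨_, ha', hpos⟩ := hj.left
    have h := sum_mass_order hy hc hp ⟨a', by omega⟩
    have h1 : 0 < ∑ t' : Fin T, (if t'.val ≤ a' then mass y c ⟨j, hjn⟩ t' else 0) := by
      refine Finset.sum_pos' (fun t _ => ?_) ⟨⟨a', ha'⟩, Finset.mem_univ _, by simpa using hpos⟩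
      split_ifs
      · exact mass_nonneg hy hc _ _
      · exact le_rfl
    have h2 := h1.trans_le h
    by_contra hlt
    refine absurd h2 (not_lt.2 (Finset.sum_nonpos fun t _ => ?_))
    split_ifs with ht
    · exact (mass_eq_zero hy hc fun hs => by have := (hi.mem _ hs).1; simp at ht; omega).le
    · exact le_rfl
  · have h := sum_mass_order hy hc hp ⟨b', by have := hj.right.lt; omega⟩
    have h1 : ∑ t' : Fin T, (if t'.val ≤ b' then mass y c ⟨j, hjn⟩ t' else 0) = y c := by
      rw [← sum_mass hy hc ⟨j, hjn⟩]
      refine Finset.sum_congr rfl fun t _ => ?_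
      split_ifs with ht
      · rfl
      · exact (mass_eq_zero hy hc fun hs => ht (hj.mem _ hs).2).symm
    simp only [] at h
    rw [h1, ← sum_mass hy hc ⟨i, hin⟩] at h
    by_contra hlt
    obtain ⟨_, hb, hpos⟩ := hi.right
    refine absurd h (not_le.2 (Finset.sum_lt_sum (fun t _ => ?_)
      ⟨⟨b, hb⟩, Finset.mem_univ _, ?_⟩))
    · split_ifs
      · exact le_rfl
      · exact mass_nonneg hy hc _ _
    · rw [if_neg (by simpa using hlt)]; exact hpos

/-- At most `m * (e - s)` jobs have their support in `{s, …, e - 1}`. -/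
theorem card_le_of_supp (hy : y ∈ schedLasserre S T r) {c : Finset (LPVar S.n T)}
    (hc : c.card ≤ r) (h0 : 0 < y c) (J : Finset ℕ) (s e : ℕ)
    (hJ : ∀ j ∈ J, j < S.n ∧ ∀ t, Supp y c j t → s ≤ t ∧ t < e) :
    J.card ≤ S.m * (e - s) := by
  classical
  let J' : Finset (Fin S.n) := Finset.univ.filter fun j => j.val ∈ J
  have hcard : J.card = J'.card := by
    refine (Finset.card_bij (fun (j : Fin S.n) _ => j.val) ?_ ?_ ?_).symm
    · intro j hj; simpa [J'] using hj
    · intro j _ j' _ h; exact Fin.ext h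
    · intro j hj; exact ⟨⟨j, (hJ j hj).1⟩, by simpa [J'] using hj, rfl⟩
  let R : Finset (Fin T) := Finset.univ.filter fun t => s ≤ t.val ∧ t.val < e
  have hR : R.card ≤ e - s := by
    rw [← Nat.card_Ico, ← Finset.card_map Fin.valEmbedding]
    refine Finset.card_le_card fun t ht => ?_
    simp only [R, Finset.mem_map, Finset.mem_filter, Finset.mem_univ, true_and] at ht
    obtain ⟨u, hu, rfl⟩ := ht
    simpa using hu
  have h1 : ∀ j ∈ J', ∑ t ∈ R, mass y c j t = y c := by
    intro j hj
    rw [← sum_mass hy hc j]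
    refine Finset.sum_subset (Finset.subset_univ _) fun t _ ht => mass_eq_zero hy hc fun hs => ht ?_
    simpa [R] using (hJ j.val (by simpa [J'] using hj)).2 _ hs
  -- Double counting of the mass of `J'` in the slots of `R`: every job contributes `y c`, every
  -- slot takes at most `S.m * y c`.
  have h2 : (J'.card : ℝ) * y c ≤ R.card * (S.m * y c) := by
    calc (J'.card : ℝ) * y c = ∑ j ∈ J', ∑ t ∈ R, mass y c j t := by
          rw [Finset.sum_congr rfl h1]; simp
      _ = ∑ t ∈ R, ∑ j ∈ J', mass y c j t := Finset.sum_comm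
      _ ≤ ∑ t ∈ R, S.m * y c := Finset.sum_le_sum fun t _ =>
          (Finset.sum_le_sum_of_subset_of_nonneg (Finset.subset_univ _)
            fun j _ _ => mass_nonneg hy hc j t).trans (sum_mass_le hy hc t)
      _ = _ := by simp
  have h3 : (J'.card : ℝ) ≤ R.card * S.m := by
    have : (J'.card : ℝ) * y c ≤ (R.card * S.m) * y c := by linarith
    exact le_of_mul_le_mul_right this h0
  rw [hcard]
  have h4 : J'.card ≤ R.card * S.m := by exact_mod_cast h3
  exact h4.trans (by rw [mul_comm]; exact Nat.mul_le_mul_left _ hR)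

/-- Adding a variable to a set does not increase `y`, by the upper bound row conditioned on the set
that already contains the slot of `i`. That set may have `c.card + 1` elements, hence the strict
inequality. -/
theorem Supp.of_insert (hy : y ∈ schedLasserre S T r) {c : Finset (LPVar S.n T)}
    (hc : c.card < r) {j : Fin S.n} {t : Fin T} {i t' : ℕ}
    (h : Supp y (insert (.slot j t) c) i t') : Supp y c i t' := by
  obtain ⟨hi, ht', hpos⟩ := h
  refine ⟨hi, ht', hpos.trans_le ?_⟩
  have := mass_le hy (c := insert (.slot ⟨i, hi⟩ ⟨t', ht'⟩) c)
    ((Finset.card_insert_le _ _).trans hc) j t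
  rwa [mass, Finset.insert_comm] at this

/-- Inserting the slot a second time changes nothing, so this slot alone carries the whole mass of
`j` and none is left for other slots. -/
theorem Supp.eq_of_insert (hy : y ∈ schedLasserre S T r) {c : Finset (LPVar S.n T)}
    (hc : c.card < r) {j : Fin S.n} {t : Fin T} {t' : ℕ}
    (h : Supp y (insert (.slot j t) c) j t') : t' = t := by
  have hc' : (insert (LPVar.slot j t) c).card ≤ r := (Finset.card_insert_le _ _).trans hc
  obtain ⟨hj, ht', hpos⟩ := h
  by_contra hne
  have h1 := sum_mass hy hc' j
  have h2 : ∑ u ∈ ({t, ⟨t', ht'⟩} : Finset (Fin T)), mass y (insert (.slot j t) c) j u ≤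
      ∑ u, mass y (insert (.slot j t) c) j u :=
    Finset.sum_le_sum_of_subset_of_nonneg (Finset.subset_univ _)
      fun u _ _ => mass_nonneg hy hc' j u
  rw [Finset.sum_pair (fun h => hne (by rw [h])), h1] at h2
  have h3 : mass y (insert (.slot j t) c) j t = y (insert (.slot j t) c) := by simp [mass]
  linarith

theorem y_empty (hy : y ∈ schedLasserre S T r) : y ∅ = 1 := hy.2.2

end

/-! ### The table of the entries of `y` -/

theorem LPVar.index_slot {n T : ℕ} (j : Fin n) (t : Fin T) :
    (LPVar.slot j t).index = j.val * T + t.val := rfl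

theorem LPVar.index_slot_lt {n T : ℕ} (j : Fin n) (t : Fin T) :
    (LPVar.slot j t).index < n * T := by
  rw [LPVar.index_slot]
  calc j.val * T + t.val < j.val * T + T := by omega
    _ = (j.val + 1) * T := by ring
    _ ≤ n * T := Nat.mul_le_mul_right _ j.2

theorem mul_add_inj {T a b c d : ℕ} (hb : b < T) (hd : d < T) (h : a * T + b = c * T + d) :
    a = c ∧ b = d := by
  have h1 : (a * T + b) / T = a := by
    rw [mul_comm, Nat.mul_add_div (by omega), Nat.div_eq_of_lt hb, add_zero]
  have h2 : (c * T + d) / T = c := by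
    rw [mul_comm, Nat.mul_add_div (by omega), Nat.div_eq_of_lt hd, add_zero]
  have : a = c := by rw [← h1, ← h2, h]
  subst this
  exact ⟨rfl, by omega⟩

theorem LPVar.eq_of_index_eq {n T : ℕ} {j : Fin n} {t : Fin T} {v : LPVar n T}
    (h : v.index = (LPVar.slot j t).index) : v = .slot j t := by
  cases v with
  | slot j' t' =>
    obtain ⟨h1, h2⟩ := mul_add_inj t'.2 t.2 h
    rw [Fin.ext h1, Fin.ext h2]
  | span j' I =>
    have h1 := LPVar.index_slot_lt j t
    have h2 : n * T ≤ (LPVar.span j' I).index := by simp only [LPVar.index]; omega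
    omega

theorem decodeSet_zero (n T : ℕ) : decodeSet n T 0 = ∅ := by
  simp [decodeSet]

/-- Conditioning on one more variable appends a lowest digit to the code. The digit `index + 1` is
never zero, so it is not lost even when `code` is zero. -/
theorem decodeSet_append {n T : ℕ} (code : ℕ) (j : Fin n) (t : Fin T) :
    decodeSet n T (code * setBase n T + (j.val * T + t.val + 1)) =
      insert (.slot j t) (decodeSet n T code) := by
  have hlt := LPVar.index_slot_lt j t
  rw [LPVar.index_slot] at hlt
  have hB : j.val * T + t.val + 1 < setBase n T := by
    unfold setBase; omega
  ext v
  simp only [decodeSet, Finset.mem_filter, Finset.mem_univ, true_and, Finset.mem_insert]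
  rw [add_comm, mul_comm code, Nat.digits_add _ (by omega) _ _ hB (Or.inl (by omega)),
    List.mem_cons]
  refine or_congr ⟨fun h => LPVar.eq_of_index_eq ?_, ?_⟩ Iff.rfl
  · rw [LPVar.index_slot]; omega
  · rintro rfl; rfl

/-- The table covers numbers of `2 * r + 1` digits and one digit is appended here, which leaves `2 *
r` for the code. -/
theorem inputState_real {S : SchedInstance} {T r : ℕ} {ε : ℝ} {y : Finset (LPVar S.n T) → ℝ}
    {code ℓ : ℕ} (hcode : code < setBase S.n T ^ ℓ) (hℓ : ℓ ≤ 2 * r) {j t : ℕ} (hj : j < S.n)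
    (ht : t < T) :
    0 < (inputState S T r ε y).real 1 (code * setBase S.n T + (j * T + t + 1)) ↔
      Supp y (decodeSet S.n T code) j t := by
  have hlt := LPVar.index_slot_lt (⟨j, hj⟩ : Fin S.n) (⟨t, ht⟩ : Fin T)
  rw [LPVar.index_slot] at hlt
  simp only at hlt
  have hB : j * T + t + 1 < setBase S.n T := by unfold setBase; omega
  have h1 : code * setBase S.n T + (j * T + t + 1) < setBase S.n T ^ (2 * r + 1) := by
    calc code * setBase S.n T + (j * T + t + 1) < (code + 1) * setBase S.n T := by
          rw [add_mul]; omega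
      _ ≤ setBase S.n T ^ ℓ * setBase S.n T := Nat.mul_le_mul_right _ hcode
      _ = setBase S.n T ^ (ℓ + 1) := by ring
      _ ≤ _ := Nat.pow_le_pow_right (by unfold setBase; omega) (by omega)
  have h2 := decodeSet_append code (⟨j, hj⟩ : Fin S.n) (⟨t, ht⟩ : Fin T)
  simp only at h2
  simp only [inputState]
  rw [if_neg one_ne_zero, if_pos trivial, if_pos h1, h2]
  exact ⟨fun h => ⟨hj, ht, h⟩, fun ⟨_, _, h⟩ => h⟩

end SchedRounding

/-! ## Greedy placement -/

namespace SchedRounding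

section Greedy
open scoped Classical

/-- The input of the greedy placement: jobs `0, …, n - 1` with a precedence relation, which are
treated in the order given by `H` and `key`; job `j` may use the slots `lo j, …, hi j - 1`. -/
structure GreedyInput where
  n : ℕ
  m : ℕ
  pr : ℕ → ℕ → Prop
  H : ℕ → ℕ
  key : ℕ → ℕ
  lo : ℕ → ℕ
  hi : ℕ → ℕ

variable (G : GreedyInput)

/-- Job `i` is treated before job `j`. -/
def GreedyInput.Before (i j : ℕ) : Prop :=
  G.H i < G.H j ∨ G.H i = G.H j ∧ (G.key i < G.key j ∨ G.key i = G.key j ∧ i < j)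

/-- The number of jobs in `Q` that are placed in slot `t`. -/
noncomputable def GreedyInput.load (Q : ℕ → Prop) (sg : ℕ → ℕ) (t : ℕ) : ℕ :=
  ((Finset.range G.n).filter fun i => Q i ∧ sg i = t).card

/-- Job `j` can be put into slot `t` if the jobs in `Q` are placed. -/
def GreedyInput.Ok (Q : ℕ → Prop) (sg : ℕ → ℕ) (j t : ℕ) : Prop :=
  G.lo j ≤ t ∧ t < G.hi j ∧ G.load Q sg t < G.m ∧
    ∀ i < G.n, Q i → (G.pr i j → sg i < t) ∧ (G.pr j i → t < sg i)

/-- The jobs in `D` have been treated, the jobs in `pl` have been placed. -/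
structure GreedyInput.Spec (D pl : ℕ → Prop) (sg : ℕ → ℕ) : Prop where
  placed : ∀ j < G.n, pl j → D j ∧ sg j < G.n ∧ G.lo j ≤ sg j ∧ sg j < G.hi j
  -- The premise `pl j → t < sg j` treats both outcomes together: a placed job had no earlier
  -- possible slot, an unplaced one had none at all. Possibility refers to the jobs that were placed
  -- before `j` was treated.
  first : ∀ j < G.n, D j → ∀ t < G.n, (pl j → t < sg j) →
    ¬ G.Ok (fun i => pl i ∧ G.Before i j) sg j t
  load_le : ∀ t, G.load pl sg t ≤ G.m
  lt_of_pr : ∀ i < G.n, ∀ j < G.n, pl i → pl j → G.pr i j → sg i < sg j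

variable {G}

theorem GreedyInput.Before.trans {i j k : ℕ} (h : G.Before i j) (h' : G.Before j k) :
    G.Before i k := by
  unfold GreedyInput.Before at *; omega

theorem GreedyInput.Before.irrefl (i : ℕ) : ¬ G.Before i i := by
  unfold GreedyInput.Before; omega

theorem GreedyInput.load_mono {Q Q' : ℕ → Prop} (h : ∀ i, Q i → Q' i) (sg : ℕ → ℕ) (t : ℕ) :
    G.load Q sg t ≤ G.load Q' sg t :=
  Finset.card_le_card fun i hi => by
    simp only [Finset.mem_filter] at hi ⊢
    exact ⟨hi.1, h i hi.2.1, hi.2.2⟩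

variable {D pl : ℕ → Prop} {sg : ℕ → ℕ}

/-- A slot that is not full and that `j` could not use holds a predecessor of `j`. -/
theorem GreedyInput.Spec.exists_pred (hG : G.Spec D pl sg) {Q : ℕ → Prop}
    (hlo : ∀ i j, Q i → Q j → G.pr i j → G.lo i ≤ G.lo j)
    (hpred : ∀ i j t, Q j → G.lo j ≤ t → i < G.n → pl i → G.Before i j → G.pr i j → t ≤ sg i →
      Q i)
    (hsucc : ∀ i j t, Q j → t < G.hi j → i < G.n → pl i → G.Before i j → G.pr j i → t < sg i)
    (htrans : ∀ i j k, G.pr i j → G.pr j k → G.pr i k)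
    {j t : ℕ} (hj : j < G.n) (hQ : Q j) (hD : D j) (h1 : G.lo j ≤ t) (h2 : t < G.hi j)
    (ht : t < G.n) (hlt : pl j → t < sg j)
    (hload : G.load (fun i => pl i ∧ G.Before i j) sg t < G.m) :
    ∃ i < G.n, Q i ∧ pl i ∧ G.Before i j ∧ G.pr i j ∧ sg i = t := by
  -- If the slot is in range and not full, the obstacle is a placed job on the wrong side of `t`;
  -- `hsucc` excludes successors, so it is a predecessor at `t` or later.
  have blocked : ∀ j < G.n, Q j → D j → G.lo j ≤ t → t < G.hi j → (pl j → t < sg j) →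
      G.load (fun i => pl i ∧ G.Before i j) sg t < G.m →
      ∃ i < G.n, Q i ∧ pl i ∧ G.Before i j ∧ G.pr i j ∧ t ≤ sg i := by
    intro j hj hQ hD h1 h2 hlt hload
    have := hG.first j hj hD t ht hlt
    simp only [GreedyInput.Ok, not_and, not_forall] at this
    obtain ⟨i, hi, ⟨hpi, hb⟩, hor⟩ := this h1 h2 hload
    by_cases hc : G.pr i j → sg i < t
    · obtain ⟨hji, hle⟩ := hor hc
      exact absurd (hsucc i j t hQ h2 hi hpi hb hji) hle
    · obtain ⟨hij, hle⟩ := Classical.not_imp.1 hc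
      exact ⟨i, hi, hpred i j t hQ h1 hi hpi hb hij (not_lt.1 hle), hpi, hb, hij, not_lt.1 hle⟩
  let A := (Finset.range G.n).filter fun i =>
    Q i ∧ pl i ∧ G.Before i j ∧ G.pr i j ∧ t ≤ sg i
  have hA : A.Nonempty := by
    obtain ⟨i, hi, h⟩ := blocked j hj hQ hD h1 h2 hlt hload
    exact ⟨i, by simpa [A] using ⟨hi, h⟩⟩
  -- Take the earliest of these predecessors. If it sat after `t`, then `t` was in its range and not
  -- full when it was treated, so it was itself blocked by a predecessor at `t` or later, which
  -- would be earlier still.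
  obtain ⟨i, hiA, hmin⟩ := Finset.exists_min_image A sg hA
  simp only [A, Finset.mem_filter, Finset.mem_range] at hiA hmin
  obtain ⟨hi, hQi, hpi, hb, hij, hti⟩ := hiA
  refine ⟨i, hi, hQi, hpi, hb, hij, ?_⟩
  by_contra hne
  have hlt : t < sg i := lt_of_le_of_ne hti (Ne.symm hne)
  obtain ⟨hDi, -, -, hhi⟩ := hG.placed i hi hpi
  obtain ⟨i', hi', hQ', hp', hb', hpr', ht'⟩ := blocked i hi hQi hDi
    ((hlo i j hQi hQ hij).trans h1) (hlt.trans hhi) (fun _ => hlt)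
    (lt_of_le_of_lt (G.load_mono (fun k hk => ⟨hk.1, hk.2.trans hb⟩) sg t) hload)
  have := hmin i' ⟨hi', hQ', hp', hb'.trans hb, htrans _ _ _ hpr' hij, ht'⟩
  have := hG.lt_of_pr i' hi' i hi hp' hpi hpr'
  omega

/-- The jobs `j` with `H j = h` are the ones that cross the boundary of a coarse interval, which
consists of `kk` blocks of length `L`; the window of `j` is `a j, …, b j`. The jobs `i` in `bot`
will be placed within the block `blk i`. -/
structure GreedyInput.Stage (G : GreedyInput) (h L kk θ : ℕ) (a b : ℕ → ℕ) (bot : ℕ → Prop)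
    (blk : ℕ → ℕ) : Prop where
  key_eq : ∀ j < G.n, G.H j = h → G.key j = b j
  lo_eq : ∀ j < G.n, G.H j = h → G.lo j = (a j / L + 1) * L
  hi_eq : ∀ j < G.n, G.H j = h → G.hi j = (b j / L) * L
  cross : ∀ j < G.n, G.H j = h → a j / L / kk < b j / L / kk
  right_lt : ∀ j < G.n, G.H j = h → b j < G.n
  low : ∀ i < G.n, G.H i < h → G.lo i < G.hi i →
    bot i ∧ blk i * L ≤ G.lo i ∧ G.hi i ≤ (blk i + 1) * L
  -- Windows are rounded outward to whole blocks here, and the jobs placed on lower levels are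
  -- charged to the same capacity.
  hall : ∀ u v, u ≤ v →
    ((Finset.range G.n).filter fun j => G.H j = h ∧ u ≤ a j / L ∧ b j / L ≤ v).card +
      ((Finset.range G.n).filter fun i => bot i ∧ u ≤ blk i ∧ blk i ≤ v).card ≤
        G.m * ((v - u + 1) * L)
  top_top : ∀ i < G.n, ∀ j < G.n, G.H i = h → G.H j = h → G.pr i j → a i < a j ∧ b i < b j
  bot_top : ∀ i < G.n, ∀ j < G.n, bot i → G.H j = h → G.pr i j → blk i ≤ a j / L
  top_bot : ∀ i < G.n, ∀ j < G.n, bot i → G.H j = h → G.pr j i → b j / L ≤ blk i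
  -- This is what the conditioning buys: few predecessors in the stage may reach a block after the
  -- one in which the window of `j` begins.
  count : ∀ j < G.n, G.H j = h →
    ((Finset.range G.n).filter fun i => G.H i = h ∧ G.pr i j ∧ a j / L < b i / L).card ≤ θ

/-- The number of slots in `x, …, z - 1` that are not full when job `j` is treated. -/
noncomputable def GreedyInput.gaps (G : GreedyInput) (pl : ℕ → Prop) (sg : ℕ → ℕ)
    (j x z : ℕ) : ℕ :=
  ((Finset.Ico x z).filter fun t => G.load (fun i => pl i ∧ G.Before i j) sg t < G.m).card

/-- Slots only fill up as more jobs are treated. -/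
theorem GreedyInput.gaps_anti {i j : ℕ} (h : G.Before i j) (x z : ℕ) :
    G.gaps pl sg j x z ≤ G.gaps pl sg i x z :=
  Finset.card_le_card fun t ht => by
    simp only [Finset.mem_filter] at ht ⊢
    exact ⟨ht.1, lt_of_le_of_lt (G.load_mono (fun k hk => ⟨hk.1, hk.2.trans h⟩) sg t) ht.2⟩

theorem GreedyInput.gaps_blocks {j L θ u v : ℕ} (huv : u ≤ v)
    (h : ∀ s, u ≤ s → s < v → G.gaps pl sg j (s * L) ((s + 1) * L) ≤ θ) :
    G.gaps pl sg j (u * L) (v * L) ≤ (v - u) * θ := by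
  induction v, huv using Nat.le_induction with
  | base => simp [GreedyInput.gaps]
  | succ v huv ih =>
    have h1 := ih fun s hs hv => h s hs (by omega)
    have h2 := h v huv (by omega)
    have h3 : G.gaps pl sg j (u * L) ((v + 1) * L) ≤
        G.gaps pl sg j (u * L) (v * L) + G.gaps pl sg j (v * L) ((v + 1) * L) := by
      unfold GreedyInput.gaps
      rw [← Finset.Ico_union_Ico_eq_Ico (Nat.mul_le_mul_right L huv)
        (Nat.mul_le_mul_right L (Nat.le_succ v)), Finset.filter_union]
      exact Finset.card_union_le _ _
    have h4 : (v + 1 - u) * θ = (v - u) * θ + θ := by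
      rw [Nat.succ_sub huv, Nat.succ_mul]
    omega

/-- The jobs placed in an interval fill it up to the gaps. -/
theorem GreedyInput.mul_le_card_add_gaps (j x z : ℕ) :
    G.m * (z - x) ≤
      ((Finset.range G.n).filter fun i =>
        (pl i ∧ G.Before i j) ∧ x ≤ sg i ∧ sg i < z).card + G.m * G.gaps pl sg j x z := by
  have h1 : ((Finset.range G.n).filter fun i =>
      (pl i ∧ G.Before i j) ∧ x ≤ sg i ∧ sg i < z).card =
      ∑ t ∈ Finset.Ico x z, G.load (fun i => pl i ∧ G.Before i j) sg t := by
    rw [Finset.card_eq_sum_card_fiberwise (f := sg) (t := Finset.Ico x z)]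
    · refine Finset.sum_congr rfl fun t ht => ?_
      rw [Finset.filter_filter]
      unfold GreedyInput.load
      congr 1
      ext i
      simp only [Finset.mem_filter, Finset.mem_Ico] at ht ⊢
      constructor
      · rintro ⟨hi, ⟨hq, -⟩, rfl⟩; exact ⟨hi, hq, rfl⟩
      · rintro ⟨hi, hq, rfl⟩; exact ⟨hi, ⟨hq, ht⟩, rfl⟩
    · intro i hi
      simp only [Finset.coe_filter, Set.mem_ofPred_eq] at hi
      simpa using hi.2.2
  rw [h1, GreedyInput.gaps, Finset.card_filter, Finset.mul_sum, ← Finset.sum_add_distrib]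
  calc G.m * (z - x) = ∑ t ∈ Finset.Ico x z, G.m := by simp [mul_comm]
    _ ≤ _ := Finset.sum_le_sum fun t _ => by split_ifs <;> omega

/-! ### Counting the unplaced jobs of one stage -/

section Stage

variable {h L kk θ : ℕ} {a b : ℕ → ℕ} {bot : ℕ → Prop} {blk : ℕ → ℕ}

/-- While `j` waits, a block inside its window has few gaps. -/
theorem GreedyInput.Stage.gaps_le (hS : G.Stage h L kk θ a b bot blk) (hG : G.Spec D pl sg)
    (hD : ∀ j < G.n, G.H j = h → D j) (htrans : ∀ i j k, G.pr i j → G.pr j k → G.pr i k)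
    {j s : ℕ} (hj : j < G.n) (hjh : G.H j = h) (h1 : a j / L < s) (h2 : s < b j / L)
    (hlt : pl j → (s + 1) * L ≤ sg j) :
    G.gaps pl sg j (s * L) ((s + 1) * L) ≤ θ := by
  have hslot : ∀ t, s * L ≤ t → t < (s + 1) * L → G.lo j ≤ t ∧ t < G.hi j ∧ t < G.n := by
    intro t ht1 ht2
    rw [hS.lo_eq j hj hjh, hS.hi_eq j hj hjh]
    have e1 : (a j / L + 1) * L ≤ s * L := Nat.mul_le_mul_right _ h1
    have e2 : (s + 1) * L ≤ b j / L * L := Nat.mul_le_mul_right _ h2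
    have e3 := Nat.div_mul_le_self (b j) L
    have e4 := hS.right_lt j hj hjh
    omega
  -- Every gap holds a predecessor from the same stage. Predecessors on lower levels stay in blocks
  -- up to that of `a j`, hence before `lo j`; successors on lower levels start at `hi j` or later;
  -- and a successor in the same stage has a larger key, so it comes after `j`.
  have hpred : ∀ t, s * L ≤ t → t < (s + 1) * L →
      G.load (fun i => pl i ∧ G.Before i j) sg t < G.m →
      ∃ i, i < G.n ∧ G.H i = h ∧ G.pr i j ∧ sg i = t ∧ pl i := by
    intro t ht1 ht2 hload
    obtain ⟨e1, e2, e3⟩ := hslot t ht1 ht2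
    obtain ⟨i, hi, hQ, hp, -, hpr, rfl⟩ := hG.exists_pred (Q := fun i => i < G.n ∧ G.H i = h)
      (fun i j hi hj hij => by
        rw [hS.lo_eq i hi.1 hi.2, hS.lo_eq j hj.1 hj.2]
        exact Nat.mul_le_mul_right _ (Nat.succ_le_succ (Nat.div_le_div_right
          (hS.top_top i hi.1 j hj.1 hi.2 hj.2 hij).1.le)))
      (fun i j t hj hlo hi hp hb hij hti => by
        refine ⟨hi, ?_⟩
        rcases hb with hb | hb
        · exfalso
          rw [hj.2] at hb
          obtain ⟨-, -, hl, hh⟩ := hG.placed i hi hp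
          obtain ⟨hbot, -, hle⟩ := hS.low i hi hb (by omega)
          have := hS.bot_top i hi j hj.1 hbot hj.2 hij
          rw [hS.lo_eq j hj.1 hj.2] at hlo
          have : (blk i + 1) * L ≤ (a j / L + 1) * L := Nat.mul_le_mul_right _ (by omega)
          omega
        · rw [hb.1, hj.2])
      (fun i j t hj hhi hi hp hb hji => by
        obtain ⟨-, -, hl, hh⟩ := hG.placed i hi hp
        rcases hb with hb | hb
        · rw [hj.2] at hb
          obtain ⟨hbot, hle, -⟩ := hS.low i hi hb (by omega)
          have := hS.top_bot i hi j hj.1 hbot hj.2 hji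
          rw [hS.hi_eq j hj.1 hj.2] at hhi
          have : b j / L * L ≤ blk i * L := Nat.mul_le_mul_right _ this
          omega
        · exfalso
          have hih : G.H i = h := hb.1.trans hj.2
          have := (hS.top_top j hj.1 i hi hj.2 hih hji).2
          have := hb.2
          rw [hS.key_eq i hi hih, hS.key_eq j hj.1 hj.2] at this
          omega)
      htrans hj ⟨hj, hjh⟩ (hD j hj hjh) e1 e2 e3
      (fun hp => ht2.trans_le (hlt hp)) hload
    exact ⟨i, hi, hQ.2, hpr, rfl, hp⟩
  choose! f hf using hpred
  -- Different gaps hold different predecessors. Each is placed in block `s`, beyond the block of `a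
  -- j`, so its window also ends beyond that block and `count` applies.
  refine le_trans (Finset.card_le_card_of_injOn f (t := (Finset.range G.n).filter fun i =>
    G.H i = h ∧ G.pr i j ∧ a j / L < b i / L) ?_ ?_) (hS.count j hj hjh)
  · intro t ht
    simp only [Finset.coe_filter, Finset.mem_Ico, Set.mem_ofPred_eq] at ht
    obtain ⟨f1, f2, f3, f4, f5⟩ := hf t ht.1.1 ht.1.2 ht.2
    obtain ⟨-, -, -, hh⟩ := hG.placed _ f1 f5
    rw [f4, hS.hi_eq _ f1 f2] at hh
    simp only [Finset.coe_filter, Finset.mem_range, Set.mem_ofPred_eq]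
    refine ⟨f1, f2, f3, h1.trans ?_⟩
    exact lt_of_mul_lt_mul_right (ht.1.1.trans_lt hh) (Nat.zero_le L)
  · intro t ht t' ht' e
    simp only [Finset.coe_filter, Finset.mem_Ico, Set.mem_ofPred_eq] at ht ht'
    rw [← (hf t ht.1.1 ht.1.2 ht.2).2.2.2.1, e, (hf t' ht'.1.1 ht'.1.2 ht'.2).2.2.2.1]

/-- If the blocks `u, …, v - 1` have few gaps, then few of the jobs with window in the blocks
`w, …, v`, where `u ≤ w + 1`, cannot be placed. -/
theorem GreedyInput.Stage.card_unplaced_le (hS : G.Stage h L kk θ a b bot blk)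
    (hG : G.Spec D pl sg) {j u v w : ℕ} (hj : j < G.n) (hjh : G.H j = h)
    (hv : v = b j / L) (huv : u ≤ v) (hwu : w ≤ u) (huw : u ≤ w + 1)
    (hgaps : ∀ s, u ≤ s → s < v → G.gaps pl sg j (s * L) ((s + 1) * L) ≤ θ)
    (hleft : ∀ i < G.n, G.H i = h → pl i → G.Before i j → u * L ≤ sg i → w ≤ a i / L) :
    ((Finset.range G.n).filter fun f =>
      (G.H f = h ∧ ¬ pl f) ∧ w ≤ a f / L ∧ b f / L ≤ v).card ≤
      2 * G.m * L + G.m * ((v - u) * θ) := by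
  have e1 := G.mul_le_card_add_gaps (pl := pl) (sg := sg) j (u * L) (v * L)
  have e2 := GreedyInput.gaps_blocks huv hgaps
  have e3 := hS.hall w v (by omega)
  -- Jobs placed before `j` in these blocks are either bottom jobs of the blocks `w, …, v` or jobs
  -- of the stage; the latter have keys up to `b j`, and `hleft` controls their left ends.
  have e4 : ((Finset.range G.n).filter fun i =>
      (pl i ∧ G.Before i j) ∧ u * L ≤ sg i ∧ sg i < v * L).card ≤
      ((Finset.range G.n).filter fun i =>
        (G.H i = h ∧ pl i) ∧ w ≤ a i / L ∧ b i / L ≤ v).card +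
      ((Finset.range G.n).filter fun i => bot i ∧ w ≤ blk i ∧ blk i ≤ v).card := by
    refine le_trans (Finset.card_le_card fun i hi => ?_) (Finset.card_union_le _ _)
    simp only [Finset.mem_filter, Finset.mem_range, Finset.mem_union] at hi ⊢
    obtain ⟨hi, ⟨hp, hb⟩, h1, h2⟩ := hi
    obtain ⟨-, -, hl, hh⟩ := hG.placed i hi hp
    rcases hb with hb | hb
    · right
      rw [hjh] at hb
      obtain ⟨hbot, h3, h4⟩ := hS.low i hi hb (by omega)
      have h5 : u * L < (blk i + 1) * L := by omega
      have h6 : blk i * L < v * L := by omega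
      have h5 := lt_of_mul_lt_mul_right h5 (Nat.zero_le L)
      have h6 := lt_of_mul_lt_mul_right h6 (Nat.zero_le L)
      exact ⟨hi, hbot, by omega, by omega⟩
    · left
      have hih : G.H i = h := hb.1.trans hjh
      refine ⟨hi, ⟨hih, hp⟩, hleft i hi hih hp (Or.inr hb) h1, ?_⟩
      have := hb.2
      rw [hS.key_eq i hi hih, hS.key_eq j hj hjh] at this
      rw [hv]
      exact Nat.div_le_div_right (by omega)
  have e5 : ((Finset.range G.n).filter fun i =>
        (G.H i = h ∧ pl i) ∧ w ≤ a i / L ∧ b i / L ≤ v).card +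
      ((Finset.range G.n).filter fun f =>
        (G.H f = h ∧ ¬ pl f) ∧ w ≤ a f / L ∧ b f / L ≤ v).card ≤
      ((Finset.range G.n).filter fun j => G.H j = h ∧ w ≤ a j / L ∧ b j / L ≤ v).card := by
    rw [← Finset.card_union_of_disjoint]
    · refine Finset.card_le_card fun i hi => ?_
      simp only [Finset.mem_filter, Finset.mem_range, Finset.mem_union] at hi ⊢
      tauto
    · refine Finset.disjoint_left.2 fun i hi hi' => ?_
      simp only [Finset.mem_filter] at hi hi'
      exact hi'.2.1.2 hi.2.1.2
  -- Hall's condition counts `v - w + 1` blocks, the placed jobs fill `v - u`. Because `u ≤ w + 1`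
  -- the difference is at most two blocks, the source of `2 * G.m * L`.
  have e6 : G.m * ((v - w + 1) * L) ≤ G.m * (v * L - u * L) + 2 * G.m * L := by
    rw [← Nat.sub_mul]
    calc G.m * ((v - w + 1) * L) ≤ G.m * ((v - u + 2) * L) :=
          Nat.mul_le_mul_left _ (Nat.mul_le_mul_right _ (by omega))
      _ = _ := by ring
  have e7 := Nat.mul_le_mul_left G.m e2
  linarith

/-- The number of jobs of the stage that cannot be placed. -/
theorem GreedyInput.Stage.card_unplaced (hS : G.Stage h L kk θ a b bot blk)
    (hG : G.Spec D pl sg) (hD : ∀ j < G.n, G.H j = h → D j)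
    (htrans : ∀ i j k, G.pr i j → G.pr j k → G.pr i k) (x : ℕ) :
    ((Finset.range G.n).filter fun f => (G.H f = h ∧ ¬ pl f) ∧ b f / L ≤ x).card ≤
      2 * G.m * L * (x / kk) + G.m * θ * x := by
  induction x using Nat.strong_induction_on with
  | _ x ih =>
  set F := (Finset.range G.n).filter fun f => (G.H f = h ∧ ¬ pl f) ∧ b f / L ≤ x with hF
  rcases F.eq_empty_or_nonempty with h0 | hne
  · simp [h0]
  -- The unplaced job that is treated last: it sees the fewest gaps, and all other members of `F`
  -- end no later.
  obtain ⟨j, hjF, hmax⟩ := Finset.exists_max_image F (fun f => toLex (b f, f)) hne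
  have hjF' := hjF
  simp only [hF, Finset.mem_filter, Finset.mem_range] at hjF'
  obtain ⟨hj, ⟨hjh, hjp⟩, hjx⟩ := hjF'
  have hbef : ∀ f ∈ F, f = j ∨ G.Before f j := by
    intro f hf
    have h1 := hmax f hf
    simp only [hF, Finset.mem_filter, Finset.mem_range] at hf
    rw [Prod.Lex.toLex_le_toLex] at h1
    simp only at h1
    have h2 := hf.2.1.1
    have h3 := hS.key_eq f hf.1 h2
    have h4 := hS.key_eq j hj hjh
    unfold GreedyInput.Before
    omega
  have hble : ∀ f ∈ F, b f / L ≤ b j / L := by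
    intro f hf
    have h1 := hmax f hf
    rw [Prod.Lex.toLex_le_toLex] at h1
    exact Nat.div_le_div_right (by simp only at h1; omega)
  set v := b j / L with hv
  have hcross : a j / L / kk < v / kk := hS.cross j hj hjh
  have hvpos : 0 < v / kk := Nat.zero_lt_of_lt hcross
  have hxv : v / kk ≤ x / kk := Nat.div_le_div_right hjx
  -- A block with more than `θ` gaps separates the schedule: jobs whose windows cross it would have
  -- been placed in it. The last such block `u` cuts off the part that is left to the induction.
  by_cases hex : ∃ u ≤ a j / L, θ < G.gaps pl sg j (u * L) ((u + 1) * L)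
  · obtain ⟨u, ⟨hu, hgu⟩, hgreat⟩ : ∃ u, (u ≤ a j / L ∧
        θ < G.gaps pl sg j (u * L) ((u + 1) * L)) ∧
        ∀ s, u < s → s ≤ a j / L → G.gaps pl sg j (s * L) ((s + 1) * L) ≤ θ := by
      obtain ⟨u0, hu0, hg0⟩ := hex
      refine ⟨Nat.findGreatest (fun u => θ < G.gaps pl sg j (u * L) ((u + 1) * L)) (a j / L),
        ⟨Nat.findGreatest_le _, Nat.findGreatest_spec (P := fun u =>
          θ < G.gaps pl sg j (u * L) ((u + 1) * L)) hu0 hg0⟩, fun s hs hsa => ?_⟩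
      exact not_lt.1 (Nat.findGreatest_is_greatest (P := fun u =>
        θ < G.gaps pl sg j (u * L) ((u + 1) * L)) hs hsa)
    have hav : a j / L < v := by
      by_contra hle
      have := Nat.div_le_div_right (c := kk) (not_lt.1 hle)
      omega
    have huk : u / kk + 1 ≤ v / kk := by
      have := Nat.div_le_div_right (c := kk) hu
      omega
    have c1 := hS.card_unplaced_le hG hj hjh hv (u := u + 1) (w := u) (by omega) (by omega)
      le_rfl
      (fun s hs hsv => by
        by_cases hsa : s ≤ a j / L
        · exact hgreat s hs hsa
        · exact hS.gaps_le hG hD htrans hj hjh (not_le.1 hsa) hsv (fun hp => absurd hp hjp))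
      -- A job placed after block `u` whose window begins before `u` waited through block `u`, so it
      -- saw at most `θ` gaps there, and so does `j`.
      (fun i hi hih hp hb hsg => by
        by_contra hlt
        obtain ⟨-, -, -, hh⟩ := hG.placed i hi hp
        rw [hS.hi_eq i hi hih] at hh
        have h1 := lt_of_mul_lt_mul_right (hsg.trans_lt hh) (Nat.zero_le L)
        have h2 := hS.gaps_le hG hD htrans hi hih (not_le.1 hlt) (by omega : u < b i / L)
          (fun _ => hsg)
        have h3 := G.gaps_anti (pl := pl) (sg := sg) hb (u * L) ((u + 1) * L)
        omega)
    have c2 := ih u (by omega)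
    -- For the same reason an unplaced window that begins before block `u` cannot end after it, so
    -- it belongs to the jobs counted by the induction hypothesis.
    have c3 : F.card ≤ ((Finset.range G.n).filter fun f =>
        (G.H f = h ∧ ¬ pl f) ∧ u ≤ a f / L ∧ b f / L ≤ v).card +
        ((Finset.range G.n).filter fun f => (G.H f = h ∧ ¬ pl f) ∧ b f / L ≤ u).card := by
      refine le_trans (Finset.card_le_card fun f hf => ?_) (Finset.card_union_le _ _)
      have h1 := hble f hf
      have h2 := hbef f hf
      simp only [hF, Finset.mem_filter, Finset.mem_range, Finset.mem_union] at hf ⊢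
      obtain ⟨hfn, hfh, hfx⟩ := hf
      by_cases hfa : u ≤ a f / L
      · exact Or.inl ⟨hfn, hfh, hfa, h1⟩
      · refine Or.inr ⟨hfn, hfh, not_lt.1 fun hlt => ?_⟩
        have h3 := hS.gaps_le hG hD htrans hfn hfh.1 (not_le.1 hfa) hlt
          (fun hp => absurd hp hfh.2)
        rcases h2 with rfl | h2
        · exact hfa hu
        · have h4 := G.gaps_anti (pl := pl) (sg := sg) h2 (u * L) ((u + 1) * L)
          omega
    -- As `u ≤ a j / L` and the window of `j` crosses a coarse boundary, `u / kk` is less than `x /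
    -- kk`. This pays for the two extra blocks.
    have c4 : 2 * G.m * L * (u / kk) + 2 * G.m * L ≤ 2 * G.m * L * (x / kk) := by
      calc _ = 2 * G.m * L * (u / kk + 1) := by ring
        _ ≤ _ := Nat.mul_le_mul_left _ (by omega)
    have c5 : G.m * ((v - (u + 1)) * θ) + G.m * θ * u ≤ G.m * θ * x := by
      calc _ = G.m * θ * (v - (u + 1) + u) := by ring
        _ ≤ _ := Nat.mul_le_mul_left _ (by omega)
    omega
  -- Without such a block all blocks before `v` have few gaps and one application with `u = w = 0`
  -- suffices; crossing makes `x / kk` positive.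
  · have hall : ∀ s ≤ a j / L, G.gaps pl sg j (s * L) ((s + 1) * L) ≤ θ := by
      intro s hs
      by_contra hlt
      exact hex ⟨s, hs, not_le.1 hlt⟩
    have c1 := hS.card_unplaced_le hG hj hjh hv (u := 0) (w := 0) (Nat.zero_le _) (Nat.zero_le _)
      (Nat.zero_le _)
      (fun s hs hsv => by
        by_cases hsa : s ≤ a j / L
        · exact hall s hsa
        · exact hS.gaps_le hG hD htrans hj hjh (not_le.1 hsa) hsv (fun hp => absurd hp hjp))
      (fun i hi hih hp hb hsg => Nat.zero_le _)
    have c3 : F.card ≤ ((Finset.range G.n).filter fun f =>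
        (G.H f = h ∧ ¬ pl f) ∧ 0 ≤ a f / L ∧ b f / L ≤ v).card := by
      refine Finset.card_le_card fun f hf => ?_
      have h1 := hble f hf
      simp only [hF, Finset.mem_filter, Finset.mem_range] at hf ⊢
      exact ⟨hf.1, hf.2.1, Nat.zero_le _, h1⟩
    have c4 : 2 * G.m * L ≤ 2 * G.m * L * (x / kk) := Nat.le_mul_of_pos_right _ (by omega)
    have c5 : G.m * ((v - 0) * θ) ≤ G.m * θ * x := by
      calc _ = G.m * θ * v := by rw [Nat.sub_zero]; ring
        _ ≤ _ := Nat.mul_le_mul_left _ hjx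
    omega

end Stage

/-! ### List scheduling -/

/-- The input in which every job may use every slot. -/
structure GreedyInput.IsList (G : GreedyInput) : Prop where
  H_eq : ∀ j < G.n, G.H j = 0
  lo_eq : ∀ j < G.n, G.lo j = 0
  hi_eq : ∀ j < G.n, G.hi j = G.n
  key_lt : ∀ i < G.n, ∀ j < G.n, G.pr i j → G.key i < G.key j

theorem GreedyInput.IsList.exists_pred (hl : G.IsList) (hG : G.Spec D pl sg)
    (hD : ∀ j < G.n, D j) (htrans : ∀ i j k, G.pr i j → G.pr j k → G.pr i k) {j t : ℕ}
    (hj : j < G.n) (ht : t < G.n) (hlt : pl j → t < sg j)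
    (hload : G.load (fun i => pl i ∧ G.Before i j) sg t < G.m) :
    ∃ i < G.n, pl i ∧ G.Before i j ∧ G.pr i j ∧ sg i = t := by
  obtain ⟨i, hi, -, h⟩ := hG.exists_pred (Q := fun i => i < G.n)
    (fun i j hi hj _ => by rw [hl.lo_eq i hi, hl.lo_eq j hj])
    (fun i _ _ _ _ hi _ _ _ _ => hi)
    (fun i j t hj _ hi _ hb hji => by
      exfalso
      have := hl.key_lt j hj i hi hji
      simp only [GreedyInput.Before, hl.H_eq i hi, hl.H_eq j hj] at hb
      omega)
    htrans hj hj (hD j hj) (by rw [hl.lo_eq j hj]; omega) (by rw [hl.hi_eq j hj]; omega) ht hlt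
    hload
  exact ⟨i, hi, h⟩

/-- If `j` stayed unplaced, every one of the `G.n` slots would hold a job treated before `j`: a full
slot because `0 < G.m`, any other one by `exists_pred`. But there are at most `G.n - 1` such jobs.
-/
theorem GreedyInput.IsList.placed (hl : G.IsList) (hG : G.Spec D pl sg)
    (hD : ∀ j < G.n, D j) (htrans : ∀ i j k, G.pr i j → G.pr j k → G.pr i k) (hm : 0 < G.m)
    {j : ℕ} (hj : j < G.n) : pl j := by
  by_contra hp
  have h1 : ∀ t, t < G.n → ∃ i, i < G.n ∧ G.Before i j ∧ sg i = t := by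
    intro t ht
    by_cases hload : G.load (fun i => pl i ∧ G.Before i j) sg t < G.m
    · obtain ⟨i, hi, -, hb, -, hs⟩ :=
        hl.exists_pred hG hD htrans hj ht (fun h => absurd h hp) hload
      exact ⟨i, hi, hb, hs⟩
    · have : 0 < G.load (fun i => pl i ∧ G.Before i j) sg t := by omega
      obtain ⟨i, hi⟩ := Finset.card_pos.1 this
      simp only [Finset.mem_filter, Finset.mem_range] at hi
      exact ⟨i, hi.1, hi.2.1.2, hi.2.2⟩
  choose! f hf using h1
  have h2 : (Finset.range G.n).card ≤ ((Finset.range G.n).erase j).card := by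
    refine Finset.card_le_card_of_injOn f (fun t ht => ?_) (fun t ht t' ht' e => ?_)
    · obtain ⟨f1, f2, -⟩ := hf t (by simpa using ht)
      simp only [Finset.coe_erase, Finset.coe_range, Set.mem_sdiff, Set.mem_Iio,
        Set.mem_singleton_iff]
      exact ⟨f1, fun e => GreedyInput.Before.irrefl j (e ▸ f2)⟩
    · rw [← (hf t (by simpa using ht)).2.2, e, (hf t' (by simpa using ht')).2.2]
  rw [Finset.card_erase_of_mem (by simpa using hj)] at h2
  simp only [Finset.card_range] at h2
  omega

/-- In a list schedule, the gaps before a job are bounded by its height in any grading. -/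
theorem GreedyInput.IsList.gaps_le (hl : G.IsList) (hG : G.Spec D pl sg)
    (hD : ∀ j < G.n, D j) (htrans : ∀ i j k, G.pr i j → G.pr j k → G.pr i k) {a : ℕ → ℕ}
    (ha : ∀ i < G.n, ∀ j < G.n, G.pr i j → a i < a j) :
    ∀ x j, j < G.n → pl j → x ≤ sg j → G.gaps pl sg j 0 x ≤ a j := by
  intro x
  induction x with
  | zero => intro j _ _ _; simp [GreedyInput.gaps]
  | succ x ih =>
    intro j hj hp hx
    -- A gap at `x` holds a predecessor `i`, which saw at least as many gaps before `x`. The step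
    -- from `a i` to `a j` pays for the gap at `x`.
    by_cases hload : G.load (fun i => pl i ∧ G.Before i j) sg x < G.m
    · obtain ⟨i, hi, hpi, hb, hij, hs⟩ := hl.exists_pred hG hD htrans hj
        (by have := (hG.placed j hj hp).2.1; omega) (fun _ => hx) hload
      have h1 := ih i hi hpi hs.ge
      have h2 := ha i hi j hj hij
      have h3 : G.gaps pl sg j 0 (x + 1) ≤ G.gaps pl sg j 0 x + 1 := by
        unfold GreedyInput.gaps
        rw [← Finset.insert_Ico_right_eq_Ico_add_one (Nat.zero_le x), Finset.filter_insert,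
          if_pos hload]
        exact Finset.card_insert_le _ _
      have h4 := G.gaps_anti (pl := pl) (sg := sg) hb 0 x
      omega
    · have h3 : G.gaps pl sg j 0 (x + 1) = G.gaps pl sg j 0 x := by
        unfold GreedyInput.gaps
        rw [← Finset.insert_Ico_right_eq_Ico_add_one (Nat.zero_le x), Finset.filter_insert,
          if_neg hload]
      rw [h3]
      exact ih j hj hp (by omega)

/-- Graham's argument: before `j` there are at most `a j ≤ T - 1` gaps, and the fewer than `G.m * T`
other jobs fill at most `T - 1` slots. -/
theorem GreedyInput.IsList.lt_two_mul (hl : G.IsList) (hG : G.Spec D pl sg)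
    (hD : ∀ j < G.n, D j) (htrans : ∀ i j k, G.pr i j → G.pr j k → G.pr i k) (hm : 0 < G.m)
    {a : ℕ → ℕ} {T : ℕ} (ha : ∀ i < G.n, ∀ j < G.n, G.pr i j → a i < a j)
    (haT : ∀ j < G.n, a j < T) (hn : G.n ≤ G.m * T) {j : ℕ} (hj : j < G.n) :
    sg j + 2 ≤ 2 * T := by
  have hp := hl.placed hG hD htrans hm hj
  have h1 := hl.gaps_le hG hD htrans ha (sg j) j hj hp le_rfl
  have h2 := G.mul_le_card_add_gaps (pl := pl) (sg := sg) j 0 (sg j)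
  have h3 : ((Finset.range G.n).filter fun i =>
      (pl i ∧ G.Before i j) ∧ 0 ≤ sg i ∧ sg i < sg j).card ≤ G.n - 1 := by
    rw [← Finset.card_range G.n, ← Finset.card_erase_of_mem (Finset.mem_range.2 hj),
      Finset.card_range]
    refine Finset.card_le_card fun i hi => ?_
    simp only [Finset.mem_filter, Finset.mem_range, Finset.mem_erase] at hi ⊢
    exact ⟨fun e => by subst e; omega, hi.1⟩
  have h4 := haT j hj
  by_contra hlt
  have h5 : G.m * T ≤ G.m * (sg j - 0 - G.gaps pl sg j 0 (sg j)) :=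
    Nat.mul_le_mul_left _ (by omega)
  rw [Nat.mul_sub] at h5
  omega

end Greedy

end SchedRounding

/-! ## Derived expressions and rules for loops -/

namespace BoundedLoops

/-- The expression is different from zero. -/
def Ex.Holds (y : ℕ → ℝ) (M : Mem) (e : Ex) (ρ : ℕ → ℕ) : Prop := e.eval y M ρ ≠ 0

def Ex.add (e f : Ex) : Ex := .bin .add e f
def Ex.sub (e f : Ex) : Ex := .bin .sub e f
def Ex.div (e f : Ex) : Ex := .bin .div e f
def Ex.le (e f : Ex) : Ex := .bin .le e f
def Ex.lt (e f : Ex) : Ex := .le (.add e (.lit 1)) f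
def Ex.and (e f : Ex) : Ex := .cond e f (.lit 0)
def Ex.or (e f : Ex) : Ex := .cond e (.lit 1) f
def Ex.imp (e f : Ex) : Ex := .cond e f (.lit 1)
def Ex.not (e : Ex) : Ex := .cond e (.lit 0) (.lit 1)
def Ex.eq (e f : Ex) : Ex := .and (.le e f) (.le f e)
def Ex.count (x : ℕ) (e : Ex) : Ex := .sum x (.cond e (.lit 1) (.lit 0))
def Ex.ex (x : ℕ) (e : Ex) : Ex := .sum x e
def Ex.all (x : ℕ) (e : Ex) : Ex := .not (.sum x (.not e))

/-- The product with `f`, if `f` is at most the number of rounds of a loop. -/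
def Ex.mul (x : ℕ) (e f : Ex) : Ex := .sum x (.cond (.lt (.var x) f) e (.lit 0))

/-- The least number `t` with `φ t`, or the number of rounds of a loop if there is none. -/
def Ex.first (x x' : ℕ) (φ : Ex → Ex) : Ex :=
  .sum x (.cond (.ex x' (.and (.le (.var x') (.var x)) (φ (.var x')))) (.lit 0) (.lit 1))

/-- The greatest number `t` with `φ t`, or `0` if there is none. -/
def Ex.last (x x' : ℕ) (φ : Ex → Ex) : Ex :=
  .sum x (.cond (.ex x' (.and (.lt (.var x) (.var x')) (φ (.var x')))) (.lit 1) (.lit 0))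

section
variable (y : ℕ → ℝ) (M : Mem) (e f : Ex) (ρ : ℕ → ℕ) (x : ℕ)

@[simp] theorem eval_lit (c : ℕ) : (Ex.lit c).eval y M ρ = c := rfl
@[simp] theorem eval_var : (Ex.var x).eval y M ρ = ρ x := rfl
@[simp] theorem eval_get (a : ℕ) : (Ex.get a e).eval y M ρ = M a (e.eval y M ρ) := rfl
@[simp] theorem eval_add : (Ex.add e f).eval y M ρ = e.eval y M ρ + f.eval y M ρ := rfl
@[simp] theorem eval_sub : (Ex.sub e f).eval y M ρ = e.eval y M ρ - f.eval y M ρ := rfl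
@[simp] theorem eval_div : (Ex.div e f).eval y M ρ = e.eval y M ρ / f.eval y M ρ := rfl

open Classical in
@[simp] theorem eval_cond (b : Ex) : (Ex.cond b e f).eval y M ρ =
    if b.Holds y M ρ then e.eval y M ρ else f.eval y M ρ := by
  by_cases h : b.eval y M ρ = 0 <;> simp [Ex.eval, Ex.Holds, h]

theorem eval_sum : (Ex.sum x e).eval y M ρ =
    ∑ i ∈ Finset.range (M 0 0), e.eval y M (Function.update ρ x i) := rfl

@[simp] theorem holds_get (a : ℕ) : (Ex.get a e).Holds y M ρ ↔ M a (e.eval y M ρ) ≠ 0 := Iff.rfl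

@[simp] theorem holds_pos : (Ex.pos e).Holds y M ρ ↔ 0 < y (e.eval y M ρ) := by
  rw [Ex.Holds, Ex.eval]
  split_ifs with h
  · exact iff_of_true one_ne_zero h
  · exact iff_of_false (not_not.2 rfl) h

@[simp] theorem holds_le : (Ex.le e f).Holds y M ρ ↔ e.eval y M ρ ≤ f.eval y M ρ := by
  change (if e.eval y M ρ ≤ f.eval y M ρ then 1 else 0) ≠ 0 ↔ _
  split_ifs with h <;> simp [h]

@[simp] theorem holds_lt : (Ex.lt e f).Holds y M ρ ↔ e.eval y M ρ < f.eval y M ρ := by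
  rw [Ex.lt, holds_le, eval_add, eval_lit, Nat.add_one_le_iff]

@[simp] theorem holds_and : (Ex.and e f).Holds y M ρ ↔ e.Holds y M ρ ∧ f.Holds y M ρ := by
  by_cases h : e.eval y M ρ = 0 <;> simp [Ex.Holds, Ex.and, Ex.eval, h]

@[simp] theorem holds_or : (Ex.or e f).Holds y M ρ ↔ e.Holds y M ρ ∨ f.Holds y M ρ := by
  by_cases h : e.eval y M ρ = 0 <;> simp [Ex.Holds, Ex.or, Ex.eval, h]

@[simp] theorem holds_imp : (Ex.imp e f).Holds y M ρ ↔ (e.Holds y M ρ → f.Holds y M ρ) := by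
  by_cases h : e.eval y M ρ = 0 <;> simp [Ex.Holds, Ex.imp, Ex.eval, h]

@[simp] theorem holds_not : (Ex.not e).Holds y M ρ ↔ ¬ e.Holds y M ρ := by
  by_cases h : e.eval y M ρ = 0 <;> simp [Ex.Holds, Ex.not, Ex.eval, h]

@[simp] theorem holds_eq : (Ex.eq e f).Holds y M ρ ↔ e.eval y M ρ = f.eval y M ρ := by
  simp [Ex.eq, le_antisymm_iff]

open Classical in
@[simp] theorem eval_count : (Ex.count x e).eval y M ρ =
    ((Finset.range (M 0 0)).filter fun i => e.Holds y M (Function.update ρ x i)).card := by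
  simp only [Ex.count, eval_sum, eval_cond, eval_lit, Finset.card_filter]

@[simp] theorem holds_ex : (Ex.ex x e).Holds y M ρ ↔
    ∃ i < M 0 0, e.Holds y M (Function.update ρ x i) := by
  simp [Ex.Holds, Ex.ex, eval_sum, Finset.sum_eq_zero_iff]

@[simp] theorem holds_all : (Ex.all x e).Holds y M ρ ↔
    ∀ i < M 0 0, e.Holds y M (Function.update ρ x i) := by
  have h : (Ex.all x e).Holds y M ρ ↔ ¬ (Ex.ex x (.not e)).Holds y M ρ := by
    rw [Ex.all, holds_not, Ex.ex]
  rw [h, holds_ex]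
  push Not
  simp

theorem eval_mul {k v : ℕ} (he : ∀ i, e.eval y M (Function.update ρ x i) = v)
    (hf : ∀ i, f.eval y M (Function.update ρ x i) = k) (hk : k ≤ M 0 0) :
    (Ex.mul x e f).eval y M ρ = v * k := by
  simp only [Ex.mul, eval_sum, eval_cond, holds_lt, eval_var, Function.update_self, eval_lit, he,
    hf]
  rw [← Finset.sum_filter]
  have : (Finset.range (M 0 0)).filter (fun i => i < k) = Finset.range k := by
    ext i; simp; omega
  simp [this, mul_comm]

/-- The expression counts the numbers `i` for which no `t ≤ i` satisfies `P`. These form the initial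
segment below the least solution. -/
theorem eval_first {x x' : ℕ} {φ : Ex → Ex} {P : ℕ → Prop}
    (hφ : ∀ i < M 0 0, ∀ t < M 0 0,
      (φ (.var x')).Holds y M (Function.update (Function.update ρ x i) x' t) ↔ P t)
    (hx : x ≠ x') :
    (Ex.first x x' φ).eval y M ρ ≤ M 0 0 ∧
      ((Ex.first x x' φ).eval y M ρ < M 0 0 → P ((Ex.first x x' φ).eval y M ρ)) ∧
      ∀ t < M 0 0, t < (Ex.first x x' φ).eval y M ρ → ¬ P t := by
  classical
  have h : (Ex.first x x' φ).eval y M ρ =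
      ((Finset.range (M 0 0)).filter fun i => ¬ ∃ t < M 0 0, t ≤ i ∧ P t).card := by
    simp only [Ex.first, eval_sum, eval_cond, holds_ex, holds_and, holds_le, eval_var, eval_lit,
      Function.update_self, Function.update_of_ne hx]
    rw [Finset.card_filter]
    refine Finset.sum_congr rfl fun i hi => ?_
    have : (∃ t < M 0 0, t ≤ i ∧
        (φ (.var x')).Holds y M (Function.update (Function.update ρ x i) x' t)) ↔
        ∃ t < M 0 0, t ≤ i ∧ P t :=
      exists_congr fun t => and_congr_right fun ht => by
        rw [hφ i (Finset.mem_range.1 hi) t ht]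
    simp only [this]
    split_ifs <;> rfl
  rw [h]
  by_cases hex : ∃ t, t < M 0 0 ∧ P t
  · have h1 := Nat.find_spec hex
    have h2 : (Finset.range (M 0 0)).filter (fun i => ¬ ∃ t < M 0 0, t ≤ i ∧ P t) =
        Finset.range (Nat.find hex) := by
      ext i
      simp only [Finset.mem_filter, Finset.mem_range, not_exists, not_and]
      constructor
      · rintro ⟨_, hi⟩
        exact not_le.1 fun hle => hi _ h1.1 hle h1.2
      · intro hi
        exact ⟨hi.trans h1.1, fun t ht hti hP => Nat.find_min hex (hti.trans_lt hi) ⟨ht, hP⟩⟩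
    rw [h2, Finset.card_range]
    exact ⟨h1.1.le, fun _ => h1.2, fun t ht hlt hP => Nat.find_min hex hlt ⟨ht, hP⟩⟩
  · push Not at hex
    have h2 : (Finset.range (M 0 0)).filter (fun i => ¬ ∃ t < M 0 0, t ≤ i ∧ P t) =
        Finset.range (M 0 0) :=
      Finset.filter_true_of_mem fun i _ ⟨t, ht, _, hP⟩ => hex t ht hP
    rw [h2, Finset.card_range]
    exact ⟨le_rfl, fun h => absurd h (lt_irrefl _), fun t ht _ => hex t ht⟩

/-- The expression counts the numbers that lie strictly below some solution, which is the greatest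
solution itself. -/
theorem eval_last {x x' : ℕ} {φ : Ex → Ex} {P : ℕ → Prop}
    (hφ : ∀ i < M 0 0, ∀ t < M 0 0,
      (φ (.var x')).Holds y M (Function.update (Function.update ρ x i) x' t) ↔ P t)
    (hx : x ≠ x') (hex : ∃ t < M 0 0, P t) :
    (Ex.last x x' φ).eval y M ρ < M 0 0 ∧ P ((Ex.last x x' φ).eval y M ρ) ∧
      ∀ t < M 0 0, P t → t ≤ (Ex.last x x' φ).eval y M ρ := by
  classical
  have h : (Ex.last x x' φ).eval y M ρ =
      ((Finset.range (M 0 0)).filter fun i => ∃ t < M 0 0, i < t ∧ P t).card := by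
    simp only [Ex.last, eval_sum, eval_cond, holds_ex, holds_and, holds_lt, eval_var, eval_lit,
      Function.update_self, Function.update_of_ne hx]
    rw [Finset.card_filter]
    refine Finset.sum_congr rfl fun i hi => ?_
    have : (∃ t < M 0 0, i < t ∧
        (φ (.var x')).Holds y M (Function.update (Function.update ρ x i) x' t)) ↔
        ∃ t < M 0 0, i < t ∧ P t :=
      exists_congr fun t => and_congr_right fun ht => by
        rw [hφ i (Finset.mem_range.1 hi) t ht]
    simp only [this]
  let A := (Finset.range (M 0 0)).filter P
  have hA : A.Nonempty := by
    obtain ⟨t, ht, hP⟩ := hex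
    exact ⟨t, by simp [A, ht, hP]⟩
  obtain ⟨u, hu, hmax⟩ := Finset.exists_max_image A id hA
  simp only [A, Finset.mem_filter, Finset.mem_range, id] at hu hmax
  have h2 : (Finset.range (M 0 0)).filter (fun i => ∃ t < M 0 0, i < t ∧ P t) =
      Finset.range u := by
    ext i
    simp only [Finset.mem_filter, Finset.mem_range]
    constructor
    · rintro ⟨_, t, ht, hit, hP⟩
      exact hit.trans_le (hmax t ⟨ht, hP⟩)
    · intro hi
      exact ⟨hi.trans hu.1, u, hu.1, hi, hu.2⟩
  rw [h, h2, Finset.card_range]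
  exact ⟨hu.1, hu.2, fun t ht hP => hmax t ⟨ht, hP⟩⟩

end

open Classical in
theorem run_ite (y : ℕ → ℝ) (b : Ex) (c d : Stmt) (ρ : ℕ → ℕ) (M : Mem) :
    (Stmt.ite b c d).run y ρ M = if b.Holds y M ρ then c.run y ρ M else d.run y ρ M := by
  by_cases h : b.eval y M ρ = 0 <;> simp [Stmt.run, Ex.Holds, h]

theorem put_self (M : Mem) (a i v : ℕ) : put M a i v a i = v := by simp [put]

theorem put_of_ne (M : Mem) {a b : ℕ} (i v : ℕ) (h : b ≠ a) : put M a i v b = M b := by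
  simp [put, h]

theorem put_cell_of_ne (M : Mem) (a : ℕ) {i j : ℕ} (v : ℕ) (h : j ≠ i) :
    put M a i v a j = M a j := by
  simp [put, h]

/-- The rule of invariants for loops. -/
theorem run_for_inv {y : ℕ → ℝ} {x : ℕ} {c : Stmt} {ρ : ℕ → ℕ} {M : Mem} (I : ℕ → Mem → Prop)
    (h0 : I 0 M)
    (hs : ∀ i < M 0 0, ∀ M' : Mem, (∀ a, a ∉ c.writes → M' a = M a) → I i M' →
      I (i + 1) (c.run y (Function.update ρ x i) M')) :
    I (M 0 0) ((Stmt.for' x c).run y ρ M) := by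
  have key : ∀ k ≤ M 0 0,
      I k (Nat.rec M (fun i M' => c.run y (Function.update ρ x i) M') k) ∧
      ∀ a, a ∉ c.writes →
        (Nat.rec M (fun i M' => c.run y (Function.update ρ x i) M') k : Mem) a = M a := by
    intro k hk
    induction k with
    | zero => exact ⟨h0, fun _ _ => rfl⟩
    | succ k ih =>
      obtain ⟨h1, h2⟩ := ih (by omega)
      exact ⟨hs k (by omega) _ h2 h1, fun a ha =>
        (c.run_of_notMem_writes y a _ _ ha).trans (h2 a ha)⟩
  exact (key _ le_rfl).1

/-- When cell `i` is computed, only earlier cells of array `a` differ from the initial memory, so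
`e` may read everything else, including the old cell `i`. -/
theorem run_fill {y : ℕ → ℝ} {x a : ℕ} {e : Ex} {ρ : ℕ → ℕ} {M : Mem} (g : ℕ → ℕ)
    (he : ∀ i < M 0 0, ∀ M' : Mem, (∀ b, b ≠ a → M' b = M b) → (∀ j, i ≤ j → M' a j = M a j) →
      e.eval y M' (Function.update ρ x i) = g i) :
    ∀ i < M 0 0, (Stmt.for' x (.set a (.var x) e)).run y ρ M a i = g i := by
  have := run_for_inv (y := y) (x := x) (c := .set a (.var x) e) (ρ := ρ) (M := M)
    (fun i M' => (∀ j < i, M' a j = g j) ∧ ∀ j, i ≤ j → M' a j = M a j)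
    ⟨fun j hj => by omega, fun _ _ => rfl⟩
    (fun i hi M' hM' hI => by
      have h1 := he i hi M' (fun b hb => hM' b (by simpa [Stmt.writes] using hb)) hI.2
      simp only [Stmt.run, eval_var, Function.update_self, h1]
      refine ⟨fun j hj => ?_, fun j hj => ?_⟩
      · by_cases hji : j = i
        · subst hji; exact put_self _ _ _ _
        · rw [put_cell_of_ne _ _ _ hji]; exact hI.1 j (by omega)
      · rw [put_cell_of_ne _ _ _ (by omega)]; exact hI.2 j (by omega))
  exact this.1

end BoundedLoops

namespace SchedRounding

open BoundedLoops

/-! ### The program for the greedy placement -/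

section GreedyProgram
open scoped Classical

variable {G : GreedyInput} {D pl : ℕ → Prop} {sg : ℕ → ℕ}

theorem GreedyInput.Spec.congr {D' : ℕ → Prop} (hG : G.Spec D pl sg)
    (h : ∀ j < G.n, D j ↔ D' j) : G.Spec D' pl sg :=
  ⟨fun j hj hp => ⟨(h j hj).1 (hG.placed j hj hp).1, (hG.placed j hj hp).2⟩,
    fun j hj hD => hG.first j hj ((h j hj).2 hD), hG.load_le, hG.lt_of_pr⟩

theorem GreedyInput.load_eq_zero {Q : ℕ → Prop} (h : ∀ i < G.n, ¬ Q i) (sg : ℕ → ℕ) (t : ℕ) :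
    G.load Q sg t = 0 := by
  rw [GreedyInput.load, Finset.card_eq_zero, Finset.filter_eq_empty_iff]
  exact fun i hi hq => h i (Finset.mem_range.1 hi) hq.1

theorem GreedyInput.Ok.congr {Q Q' : ℕ → Prop} {sg' : ℕ → ℕ} {j t : ℕ}
    (h : ∀ i < G.n, (Q i ↔ Q' i) ∧ (Q i → sg i = sg' i)) (hok : G.Ok Q sg j t) :
    G.Ok Q' sg' j t := by
  obtain ⟨h1, h2, h3, h4⟩ := hok
  refine ⟨h1, h2, ?_, fun i hi hq => ?_⟩
  · have : G.load Q' sg' t = G.load Q sg t := by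
      unfold GreedyInput.load
      congr 1
      refine Finset.filter_congr fun i hi => ?_
      obtain ⟨e1, e2⟩ := h i (Finset.mem_range.1 hi)
      rw [← e1]
      exact and_congr_right fun hq => by rw [e2 hq]
    rwa [this]
  · obtain ⟨e1, e2⟩ := h i hi
    rw [← e2 (e1.2 hq)]
    exact h4 i hi (e1.2 hq)

theorem GreedyInput.Spec.skip (hG : G.Spec D pl sg) {j : ℕ}
    (hnD : ¬ D j) (hbef : ∀ i < G.n, D i → G.Before i j)
    (hno : ∀ t < G.n, ¬ G.Ok pl sg j t) : G.Spec (fun i => D i ∨ i = j) pl sg := by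
  refine ⟨fun i hi hp => ⟨Or.inl (hG.placed i hi hp).1, (hG.placed i hi hp).2⟩, ?_,
    hG.load_le, hG.lt_of_pr⟩
  rintro i hi (hDi | rfl) t ht hlt hok
  · exact hG.first i hi hDi t ht hlt hok
  · exact hno t ht (hok.congr fun k hk =>
      ⟨⟨fun h => h.1, fun h => ⟨h, hbef k hk (hG.placed k hk h).1⟩⟩, fun _ => rfl⟩)

/-- What was recorded about earlier jobs is not disturbed: it refers to placed jobs before them in
the order, and `j` comes after all of them. -/
theorem GreedyInput.Spec.place (hG : G.Spec D pl sg) {j v : ℕ} (hj : j < G.n)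
    (hnD : ¬ D j) (hbef : ∀ i < G.n, D i → G.Before i j) (hirr : ∀ i, ¬ G.pr i i) (hv : v < G.n)
    (hok : G.Ok pl sg j v) (hno : ∀ t < G.n, t < v → ¬ G.Ok pl sg j t) :
    G.Spec (fun i => D i ∨ i = j) (fun i => pl i ∨ i = j) (Function.update sg j v) := by
  have hnp : ¬ pl j := fun h => hnD (hG.placed j hj h).1
  have hne : ∀ i, pl i → i ≠ j := fun i hi e => hnp (e ▸ hi)
  refine ⟨?_, ?_, fun t => ?_, ?_⟩
  · rintro i hi (hp | rfl)
    · rw [Function.update_of_ne (hne i hp)]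
      exact ⟨Or.inl (hG.placed i hi hp).1, (hG.placed i hi hp).2⟩
    · rw [Function.update_self]
      exact ⟨Or.inr rfl, hv, hok.1, hok.2.1⟩
  · rintro i hi (hDi | rfl) t ht hlt hok'
    · have hij : i ≠ j := fun e => hnD (e ▸ hDi)
      have hb := hbef i hi hDi
      refine hG.first i hi hDi t ht (fun hp => ?_) (hok'.congr fun k hk => ⟨?_, ?_⟩)
      · have := hlt (Or.inl hp)
        rwa [Function.update_of_ne hij] at this
      · constructor
        · rintro ⟨hp | rfl, hb'⟩
          · exact ⟨hp, hb'⟩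
          · exact absurd (hb.trans hb') (GreedyInput.Before.irrefl i)
        · exact fun h => ⟨Or.inl h.1, h.2⟩
      · rintro ⟨hp | rfl, hb'⟩
        · exact Function.update_of_ne (hne k hp) _ _
        · exact absurd (hb.trans hb') (GreedyInput.Before.irrefl i)
    · have := hlt (Or.inr rfl)
      rw [Function.update_self] at this
      refine hno t ht this (hok'.congr fun k hk => ⟨?_, ?_⟩)
      · constructor
        · rintro ⟨hp | rfl, hb'⟩
          · exact hp
          · exact absurd hb' (GreedyInput.Before.irrefl k)
        · exact fun h => ⟨Or.inl h, hbef k hk (hG.placed k hk h).1⟩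
      · rintro ⟨hp | rfl, hb'⟩
        · exact Function.update_of_ne (hne k hp) _ _
        · exact absurd hb' (GreedyInput.Before.irrefl k)
  · by_cases htv : t = v
    · subst htv
      have h2 : G.load pl sg t < G.m := hok.2.2.1
      refine (Finset.card_le_card (t := insert j ((Finset.range G.n).filter fun i =>
        pl i ∧ sg i = t)) fun i hi => ?_).trans ((Finset.card_insert_le _ _).trans h2)
      simp only [Finset.mem_filter, Finset.mem_insert] at hi ⊢
      by_cases hij : i = j
      · exact Or.inl hij
      · rw [Function.update_of_ne hij] at hi
        exact Or.inr ⟨hi.1, hi.2.1.resolve_right hij, hi.2.2⟩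
    · refine le_trans (Finset.card_le_card fun i hi => ?_) (hG.load_le t)
      simp only [Finset.mem_filter] at hi ⊢
      have hij : i ≠ j := by
        rintro rfl
        rw [Function.update_self] at hi
        exact htv hi.2.2.symm
      rw [Function.update_of_ne hij] at hi
      exact ⟨hi.1, hi.2.1.resolve_right hij, hi.2.2⟩
  · rintro i hi k hk (hp | rfl) (hp' | rfl) hik
    · rw [Function.update_of_ne (hne i hp), Function.update_of_ne (hne k hp')]
      exact hG.lt_of_pr i hi k hk hp hp' hik
    · rw [Function.update_of_ne (hne i hp), Function.update_self]
      exact (hok.2.2.2 i hi hp).1 hik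
    · rw [Function.update_of_ne (hne k hp'), Function.update_self]
      exact (hok.2.2.2 k hk hp').2 hik
    · exact absurd hik (hirr _)

/-- Job `i` precedes job `j`; array `26` holds the beginnings of the rows of the matrix. -/
def prEx (i j : Ex) : Ex := .get 1 (.add (.get 26 i) j)

def nEx : Ex := .get 0 (.lit 0)
def mEx : Ex := .get 0 (.lit 1)
def tEx : Ex := .get 0 (.lit 2)

/-- Slot `t` is possible for job `j`. -/
def okEx (j t : Ex) : Ex :=
  .and (.le (.get 8 j) t) (.and (.lt t (.get 9 j))
    (.and (.lt (.count 22 (.and (.get 11 (.var 22)) (.eq (.get 12 (.var 22)) t))) mEx)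
      (.all 22 (.imp (.get 11 (.var 22))
        (.and (.imp (prEx (.var 22) j) (.lt (.get 12 (.var 22)) t))
          (.imp (prEx j (.var 22)) (.lt t (.get 12 (.var 22)))))))))

/-- Treat job number `12` if it has class `10` and key `11`. -/
def placeStmt : Stmt :=
  .ite (.and (.eq (.get 7 (.var 12)) (.var 10)) (.eq (.get 10 (.var 12)) (.var 11)))
    (.seq (.set 21 (.lit 0) (.first 20 21 fun t => okEx (.var 12) t))
      (.ite (.lt (.get 21 (.lit 0)) nEx)
        (.seq (.set 12 (.var 12) (.get 21 (.lit 0))) (.set 11 (.var 12) (.lit 1))) .skip))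
    .skip

/-- The greedy placement with input in the arrays `7, 8, 9, 10` and output in the arrays
`11, 12`. -/
def greedyStmt : Stmt :=
  .seq (.for' 10 (.set 11 (.var 10) (.lit 0))) (.for' 10 (.for' 11 (.for' 12 placeStmt)))

/-- The input of the greedy placement in the memory. -/
def greedyInput (pr : ℕ → ℕ → Prop) (M : Mem) : GreedyInput :=
  ⟨M 0 0, M 0 1, pr, M 7, M 10, M 8, M 9⟩

/-- The matrix of the precedence relation in the memory. -/
def PrecMem (pr : ℕ → ℕ → Prop) (M : Mem) : Prop :=
  ∀ i < M 0 0, ∀ j < M 0 0, (M 1 (M 26 i + j) ≠ 0 ↔ pr i j)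

theorem holds_okEx {y : ℕ → ℝ} {M : Mem} {pr : ℕ → ℕ → Prop} (hpr : PrecMem pr M) {ρ : ℕ → ℕ}
    {j t : ℕ} (hj : j < M 0 0) (hρ : ρ 12 = j) (i : ℕ) :
    (okEx (.var 12) (.var 21)).Holds y M
      (Function.update (Function.update ρ 20 i) 21 t) ↔
      (greedyInput pr M).Ok (fun i => M 11 i ≠ 0) (M 12) j t := by
  have h : ∀ i < M 0 0, (M 11 i ≠ 0 → (M 1 (M 26 i + j) ≠ 0 → M 12 i < t) ∧
      (M 1 (M 26 j + i) ≠ 0 → t < M 12 i)) ↔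
      (M 11 i ≠ 0 → (pr i j → M 12 i < t) ∧ (pr j i → t < M 12 i)) := by
    intro i hi
    rw [hpr i hi j hj, hpr j hj i hi]
  simp only [okEx, prEx, mEx, GreedyInput.Ok, GreedyInput.load, greedyInput, holds_and, holds_le,
    holds_lt, eval_get, eval_var, eval_count, holds_get, holds_eq, holds_all, holds_imp, eval_lit,
    eval_add, Function.update_apply]
  simp only [Nat.reduceEqDiff, if_true, if_false, hρ]
  exact and_congr_right fun _ => and_congr_right fun _ => and_congr_right fun _ =>
    forall₂_congr h

theorem run_placeStmt {y : ℕ → ℝ} {pr : ℕ → ℕ → Prop} {ρ : ℕ → ℕ} {M M0 : Mem} {D : ℕ → Prop}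
    (hpr : PrecMem pr M) (hirr : ∀ i, ¬ pr i i)
    (hM : ∀ a, a ∉ placeStmt.writes → M a = M0 a)
    {j : ℕ} (hj : j < M0 0 0) (hρ : ρ 12 = j) (hH : M0 7 j = ρ 10) (hkey : M0 10 j = ρ 11)
    (hG : (greedyInput pr M0).Spec D (fun i => M 11 i ≠ 0) (M 12)) (hnD : ¬ D j)
    (hbef : ∀ i < M0 0 0, D i → (greedyInput pr M0).Before i j) :
    (greedyInput pr M0).Spec (fun i => D i ∨ i = j)
      (fun i => placeStmt.run y ρ M 11 i ≠ 0) (placeStmt.run y ρ M 12) := by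
  have e0 : M 0 = M0 0 := hM 0 (by decide)
  have e7 : M 7 = M0 7 := hM 7 (by decide)
  have e10 : M 10 = M0 10 := hM 10 (by decide)
  have hin : greedyInput pr M = greedyInput pr M0 := by
    simp only [greedyInput, e0, e7, e10, hM 8 (by decide), hM 9 (by decide)]
  have hj' : j < M 0 0 := by rw [e0]; exact hj
  obtain ⟨f1, f2, f3⟩ := eval_first y M ρ (x := 20) (x' := 21) (φ := fun t => okEx (.var 12) t)
    (P := fun t => (greedyInput pr M).Ok (fun i => M 11 i ≠ 0) (M 12) j t)
    (fun i _ t _ => holds_okEx hpr hj' hρ i) (by decide)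
  set v := (Ex.first 20 21 fun t => okEx (.var 12) t).eval y M ρ with hv
  rw [hin, e0] at f2 f3
  have hcond : (Ex.and (.eq (.get 7 (.var 12)) (.var 10))
      (.eq (.get 10 (.var 12)) (.var 11))).Holds y M ρ := by
    simp [hρ, e7, e10, hH, hkey]
  by_cases hvn : v < M0 0 0
  · have hvn' : (Ex.lt (.get 21 (.lit 0)) nEx).Holds y (put M 21 0 v) ρ := by
      simp [nEx, put_self, put_of_ne, e0, hvn]
    have hrun : placeStmt.run y ρ M = put (put (put M 21 0 v) 12 j v) 11 j 1 := by
      rw [placeStmt, run_ite, if_pos hcond, Stmt.run, Stmt.run, ← hv, eval_lit, run_ite,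
        if_pos hvn']
      simp [Stmt.run, put_self, hρ]
    have h12 : placeStmt.run y ρ M 12 = Function.update (M 12) j v := by
      rw [hrun, put_of_ne _ _ _ (by decide), put, Function.update_self,
        put_of_ne _ _ _ (by decide)]
    have h11 : (fun i => placeStmt.run y ρ M 11 i ≠ 0) = fun i => M 11 i ≠ 0 ∨ i = j := by
      funext i
      rw [hrun]
      by_cases hij : i = j
      · subst hij; simp [put_self]
      · simp [put_cell_of_ne _ _ _ hij, put_of_ne, hij]
    rw [h11, h12]
    exact hG.place hj hnD hbef hirr hvn (f2 hvn) fun t ht htv => f3 t ht htv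
  · have hvn' : ¬ (Ex.lt (.get 21 (.lit 0)) nEx).Holds y (put M 21 0 v) ρ := by
      simp [nEx, put_self, put_of_ne, e0]; omega
    have hrun : placeStmt.run y ρ M = put M 21 0 v := by
      rw [placeStmt, run_ite, if_pos hcond, Stmt.run, Stmt.run, ← hv, eval_lit, run_ite,
        if_neg hvn']
      rfl
    rw [hrun, put_of_ne _ _ _ (by decide), put_of_ne _ _ _ (by decide)]
    exact hG.skip hnD hbef fun t ht => f3 t ht (ht.trans_le (not_lt.1 hvn))

/-- The three nested loops run through height, key and number, which is the order `Before`; the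
treated jobs are those below the triple of counters. Jobs whose height or key is not below `n` are
never reached, and this is how jobs of height `n` are discarded. -/
theorem run_greedyStmt {y : ℕ → ℝ} {pr : ℕ → ℕ → Prop} {ρ : ℕ → ℕ} {M : Mem}
    (hpr : PrecMem pr M) (hirr : ∀ i, ¬ pr i i) :
    (greedyInput pr M).Spec (fun j => M 10 j < M 0 0 ∧ M 7 j < M 0 0)
      (fun i => greedyStmt.run y ρ M 11 i ≠ 0) (greedyStmt.run y ρ M 12) := by
  set M1 := (Stmt.for' 10 (.set 11 (.var 10) (.lit 0))).run y ρ M with hM1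
  have e1 : ∀ a, a ≠ 11 → M1 a = M a := fun a ha =>
    Stmt.run_of_notMem_writes y a _ _ _ (by simpa [Stmt.writes] using ha)
  have e11 : ∀ i < M 0 0, M1 11 i = 0 := run_fill (fun _ => 0) fun _ _ _ _ _ => rfl
  have hin : greedyInput pr M = greedyInput pr M1 := by
    simp only [greedyInput, e1 0 (by decide), e1 7 (by decide), e1 8 (by decide),
      e1 9 (by decide), e1 10 (by decide)]
  have hpr1 : PrecMem pr M1 := by
    unfold PrecMem
    rw [e1 0 (by decide), e1 1 (by decide), e1 26 (by decide)]
    exact hpr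
  have hw : ∀ a, a ∉ [21, 12, 11] ↔ a ∉ placeStmt.writes := fun a => by
    simp [placeStmt, Stmt.writes]
  rw [hin, ← e1 0 (by decide), ← e1 7 (by decide), ← e1 10 (by decide)]
  have hrun : greedyStmt.run y ρ M = (Stmt.for' 10 (.for' 11 (.for' 12 placeStmt))).run y ρ M1 :=
    rfl
  rw [hrun]
  let I : (ℕ → Prop) → Mem → Prop := fun D M' =>
    (greedyInput pr M1).Spec D (fun i => M' 11 i ≠ 0) (M' 12)
  have hfin := run_for_inv (y := y) (x := 10) (c := .for' 11 (.for' 12 placeStmt)) (ρ := ρ)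
    (M := M1) (fun h M' => I (fun i => M1 10 i < M1 0 0 ∧ M1 7 i < h) M')
    (by
      have hno : ∀ i < M1 0 0, ¬ M1 11 i ≠ 0 := fun i hi => by
        rw [not_not]; exact e11 i (by rwa [e1 0 (by decide)] at hi)
      refine ⟨fun j hj hp => absurd hp (hno j hj), fun j hj hD => by omega, fun t => ?_,
        fun i hi j hj hp => absurd hp (hno i hi)⟩
      rw [GreedyInput.load_eq_zero hno]
      exact Nat.zero_le _)
    (fun h hh M2 hM2 hI2 => by
      have k0 : M2 0 = M1 0 := hM2 0 (by decide)
      rw [← k0] at hh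
      have := run_for_inv (y := y) (x := 11) (c := .for' 12 placeStmt)
        (ρ := Function.update ρ 10 h) (M := M2)
        (fun β M' => I (fun i => M1 10 i < M1 0 0 ∧
          (M1 7 i < h ∨ M1 7 i = h ∧ M1 10 i < β)) M')
        (hI2.congr fun j hj => by omega)
        (fun β hβ M3 hM3 hI3 => by
          have k3 : M3 0 = M1 0 := (hM3 0 (by decide)).trans k0
          have := run_for_inv (y := y) (x := 12) (c := placeStmt)
            (ρ := Function.update (Function.update ρ 10 h) 11 β) (M := M3)
            (fun jj M' => I (fun i => M1 10 i < M1 0 0 ∧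
              (M1 7 i < h ∨ M1 7 i = h ∧ (M1 10 i < β ∨ M1 10 i = β ∧ i < jj))) M')
            (hI3.congr fun j hj => by omega)
            (fun jj hjj M4 hM4 hI4 => by
              have k : ∀ a, a ∉ placeStmt.writes → M4 a = M1 a := fun a ha =>
                (hM4 a ha).trans ((hM3 a ha).trans (hM2 a ha))
              have hpr4 : PrecMem pr M4 := by
                unfold PrecMem
                rw [k 0 (by decide), k 1 (by decide), k 26 (by decide)]
                exact hpr1
              rw [k3] at hjj
              rw [k0] at hβ
              by_cases hc : M1 7 jj = h ∧ M1 10 jj = β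
              · have := run_placeStmt (y := y)
                  (ρ := Function.update (Function.update (Function.update ρ 10 h) 11 β) 12 jj)
                  hpr4 hirr k hjj (by simp) (by simp [hc.1])
                  (by simp [hc.2]) hI4 (by omega)
                  (fun i hi hD => by
                    simp only [GreedyInput.Before, greedyInput]; omega)
                exact this.congr fun i hi => by
                  change i < M1 0 0 at hi
                  by_cases hij : i = jj
                  · subst hij; omega
                  · omega
              · have hcond : ¬ (Ex.and (.eq (.get 7 (.var 12)) (.var 10))
                    (.eq (.get 10 (.var 12)) (.var 11))).Holds y M4
                    (Function.update (Function.update (Function.update ρ 10 h) 11 β) 12 jj) := by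
                  simpa [Function.update_apply, k 7 (by decide), k 10 (by decide)] using hc
                rw [placeStmt, run_ite, if_neg hcond]
                exact hI4.congr fun i hi => by
                  by_cases hij : i = jj
                  · subst hij; omega
                  · omega)
          exact this.congr fun i hi => by
            change i < M1 0 0 at hi
            rw [k3]; omega)
      exact this.congr fun i hi => by rw [k0]; omega)
  exact hfin

end GreedyProgram

end SchedRounding

namespace SchedRounding

open BoundedLoops

/-! ### Inserting the jobs that have not been placed -/

section Insertion
open scoped Classical

/-- Each job that is not in `pl` gets a slot of its own, right after the slot `base` of the last of
its predecessors. -/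
structure Insertion (n : ℕ) (pr : ℕ → ℕ → Prop) (pl : ℕ → Prop) (sg np base kap fin : ℕ → ℕ) :
    Prop where
  np_eq : ∀ j < n, np j = ((Finset.range n).filter fun i => pr i j).card
  base_placed : ∀ j < n, pl j → base j = sg j + 1
  le_base : ∀ j < n, ¬ pl j → ∀ i < n, pl i → pr i j → sg i + 1 ≤ base j
  base_cases : ∀ j < n, ¬ pl j → base j = 0 ∨ ∃ i < n, pl i ∧ pr i j ∧ base j = sg i + 1
  -- `kap` encodes a lexicographic order: first `base`, then placed before unplaced, then number of
  -- predecessors, then number of the job. The factor `n * n + 1` exceeds every second component.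
  kap_placed : ∀ j < n, pl j → kap j = base j * (n * n + 1)
  kap_unplaced : ∀ j < n, ¬ pl j → kap j = base j * (n * n + 1) + (np j * n + j + 1)
  fin_eq : ∀ j < n, fin j = base j + ((Finset.range n).filter fun d => ¬ pl d ∧ kap d ≤ kap j).card

variable {n m : ℕ} {pr : ℕ → ℕ → Prop} {pl : ℕ → Prop} {sg np base kap fin : ℕ → ℕ}

theorem Insertion.np_lt (hI : Insertion n pr pl sg np base kap fin) (hirr : ∀ i, ¬ pr i i)
    {j : ℕ} (hj : j < n) : np j < n := by
  rw [hI.np_eq j hj]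
  calc _ < (Finset.range n).card := Finset.card_lt_card <| by
        refine Finset.filter_ssubset.2 ⟨j, Finset.mem_range.2 hj, hirr j⟩
    _ = n := Finset.card_range n

theorem Insertion.np_lt_np (hI : Insertion n pr pl sg np base kap fin) (hirr : ∀ i, ¬ pr i i)
    (htrans : ∀ i j k, pr i j → pr j k → pr i k) {i j : ℕ} (hi : i < n) (hj : j < n)
    (hij : pr i j) : np i < np j := by
  rw [hI.np_eq i hi, hI.np_eq j hj]
  refine Finset.card_lt_card ⟨fun k hk => ?_, fun h => ?_⟩
  · simp only [Finset.mem_filter] at hk ⊢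
    exact ⟨hk.1, htrans _ _ _ hk.2 hij⟩
  · have : i ∈ (Finset.range n).filter fun k => pr k j := by simp [hi, hij]
    exact hirr i (Finset.mem_filter.1 (h this)).2

theorem Insertion.offset_lt (hI : Insertion n pr pl sg np base kap fin) (hirr : ∀ i, ¬ pr i i)
    {j : ℕ} (hj : j < n) : np j * n + j + 1 < n * n + 1 := by
  have h : (np j + 1) * n ≤ n * n := Nat.mul_le_mul_right _ (hI.np_lt hirr hj)
  rw [Nat.add_mul] at h
  omega

theorem Insertion.exists_offset (hI : Insertion n pr pl sg np base kap fin)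
    (hirr : ∀ i, ¬ pr i i) {j : ℕ} (hj : j < n) :
    ∃ o < n * n + 1, kap j = base j * (n * n + 1) + o ∧ (pl j → o = 0) ∧
      (¬ pl j → o = np j * n + j + 1) := by
  by_cases hp : pl j
  · exact ⟨0, by omega, by rw [hI.kap_placed j hj hp, add_zero], fun _ => rfl, fun h => absurd hp h⟩
  · exact ⟨_, hI.offset_lt hirr hj, hI.kap_unplaced j hj hp, fun h => absurd h hp, fun _ => rfl⟩

theorem Insertion.base_le (hI : Insertion n pr pl sg np base kap fin) (hirr : ∀ i, ¬ pr i i)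
    {i j : ℕ} (hi : i < n) (hj : j < n) (h : kap i ≤ kap j) : base i ≤ base j := by
  obtain ⟨o, ho, e, -⟩ := hI.exists_offset hirr hi
  obtain ⟨o', ho', e', -⟩ := hI.exists_offset hirr hj
  by_contra hlt
  have : (base j + 1) * (n * n + 1) ≤ base i * (n * n + 1) := Nat.mul_le_mul_right _ (by omega)
  rw [Nat.add_mul] at this
  omega

/-- If the bases agree, `j` has a positive second component and is therefore unplaced; it is counted
in `fin j` but not in `fin i`. Otherwise the base already decides. -/
theorem Insertion.fin_lt_fin (hI : Insertion n pr pl sg np base kap fin) (hirr : ∀ i, ¬ pr i i)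
    {i j : ℕ} (hi : i < n) (hj : j < n) (h : kap i < kap j) : fin i < fin j := by
  have hb := hI.base_le hirr hi hj h.le
  have hsub : ((Finset.range n).filter fun d => ¬ pl d ∧ kap d ≤ kap i) ⊆
      ((Finset.range n).filter fun d => ¬ pl d ∧ kap d ≤ kap j) := fun d hd => by
    simp only [Finset.mem_filter] at hd ⊢
    exact ⟨hd.1, hd.2.1, hd.2.2.trans h.le⟩
  rw [hI.fin_eq i hi, hI.fin_eq j hj]
  rcases hb.lt_or_eq with hlt | heq
  · have := Finset.card_le_card hsub
    omega
  · obtain ⟨o, ho, e, -⟩ := hI.exists_offset hirr hi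
    obtain ⟨o', ho', e', hp, -⟩ := hI.exists_offset hirr hj
    have hpj : ¬ pl j := fun hpj => by
      have := hp hpj
      rw [heq] at e
      omega
    have := Finset.card_lt_card (Finset.ssubset_iff_subset_ne.2 ⟨hsub, fun heq => by
      have hmem : j ∈ (Finset.range n).filter fun d => ¬ pl d ∧ kap d ≤ kap j := by
        simp [hj, hpj]
      rw [← heq] at hmem
      have := (Finset.mem_filter.1 hmem).2.2
      omega⟩)
    omega

/-- If `i` is unplaced and `j` placed, the base of `i` comes from a placed predecessor of `i`, which
by transitivity precedes `j` and has a smaller slot. If both are unplaced, the bases are weakly and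
the numbers of predecessors strictly ordered. -/
theorem Insertion.kap_lt_kap (hI : Insertion n pr pl sg np base kap fin) (hirr : ∀ i, ¬ pr i i)
    (htrans : ∀ i j k, pr i j → pr j k → pr i k)
    (hsg : ∀ i < n, ∀ j < n, pl i → pl j → pr i j → sg i < sg j) {i j : ℕ} (hi : i < n)
    (hj : j < n) (hij : pr i j) : kap i < kap j := by
  obtain ⟨o, ho, e, ho1, ho2⟩ := hI.exists_offset hirr hi
  obtain ⟨o', ho', e', ho1', ho2'⟩ := hI.exists_offset hirr hj
  have hlt : base i < base j → kap i < kap j := fun hlt => by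
    have : (base i + 1) * (n * n + 1) ≤ base j * (n * n + 1) := Nat.mul_le_mul_right _ hlt
    rw [Nat.add_mul] at this
    omega
  have hle : base i ≤ base j → o < o' → kap i < kap j := fun hle hoo => by
    have : base i * (n * n + 1) ≤ base j * (n * n + 1) := Nat.mul_le_mul_right _ hle
    omega
  by_cases hpi : pl i <;> by_cases hpj : pl j
  · refine hlt ?_
    rw [hI.base_placed i hi hpi, hI.base_placed j hj hpj]
    have := hsg i hi j hj hpi hpj hij
    omega
  · refine hle ?_ (by rw [ho1 hpi, ho2' hpj]; omega)
    rw [hI.base_placed i hi hpi]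
    exact hI.le_base j hj hpj i hi hpi hij
  · refine hlt ?_
    rw [hI.base_placed j hj hpj]
    rcases hI.base_cases i hi hpi with h | ⟨k, hk, hpk, hki, h⟩
    · omega
    · have := hsg k hk j hj hpk hpj (htrans _ _ _ hki hij)
      omega
  · refine hle ?_ ?_
    · rcases hI.base_cases i hi hpi with h | ⟨k, hk, hpk, hki, h⟩
      · omega
      · rw [h]
        exact hI.le_base j hj hpj k hk hpk (htrans _ _ _ hki hij)
    · rw [ho2 hpi, ho2' hpj]
      have h1 := hI.np_lt_np hirr htrans hi hj hij
      have h2 : (np i + 1) * n ≤ np j * n := Nat.mul_le_mul_right _ h1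
      rw [Nat.add_mul] at h2
      omega

theorem Insertion.one_le (hI : Insertion n pr pl sg np base kap fin) {j : ℕ} (hj : j < n) :
    1 ≤ fin j := by
  rw [hI.fin_eq j hj]
  by_cases hp : pl j
  · rw [hI.base_placed j hj hp]; omega
  · have : 0 < ((Finset.range n).filter fun d => ¬ pl d ∧ kap d ≤ kap j).card :=
      Finset.card_pos.2 ⟨j, by simp [hj, hp]⟩
    omega

/-- By monotonicity jobs with equal `fin` have equal `kap`. So a slot contains either placed jobs
that shared a slot before, or a single unplaced job, for which `0 < m` leaves room. -/
theorem Insertion.load_le (hI : Insertion n pr pl sg np base kap fin) (hirr : ∀ i, ¬ pr i i)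
    (hm : 0 < m) (hload : ∀ t, ((Finset.range n).filter fun i => pl i ∧ sg i = t).card ≤ m)
    (t : ℕ) : ((Finset.range n).filter fun i => fin i = t).card ≤ m := by
  rcases ((Finset.range n).filter fun i => fin i = t).eq_empty_or_nonempty with h0 | ⟨j, hjF⟩
  · simp [h0]
  simp only [Finset.mem_filter, Finset.mem_range] at hjF
  obtain ⟨hj, hjt⟩ := hjF
  have hkap : ∀ i < n, fin i = t → kap i = kap j := by
    intro i hi hit
    rcases lt_trichotomy (kap i) (kap j) with h | h | h
    · have := hI.fin_lt_fin hirr hi hj h; omega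
    · exact h
    · have := hI.fin_lt_fin hirr hj hi h; omega
  have hbo : ∀ i < n, fin i = t → base i = base j ∧ ∃ o, (pl i → o = 0) ∧
      (¬ pl i → o = np i * n + i + 1) ∧ (pl j → o = 0) ∧ (¬ pl j → o = np j * n + j + 1) := by
    intro i hi hit
    have hk := hkap i hi hit
    have hb := le_antisymm (hI.base_le hirr hi hj hk.le) (hI.base_le hirr hj hi hk.ge)
    obtain ⟨o, ho, e, ho1, ho2⟩ := hI.exists_offset hirr hi
    obtain ⟨o', ho', e', ho1', ho2'⟩ := hI.exists_offset hirr hj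
    rw [hb] at e
    have : o = o' := by omega
    subst this
    exact ⟨hb, o, ho1, ho2, ho1', ho2'⟩
  by_cases hp : pl j
  · refine le_trans (Finset.card_le_card fun i hi => ?_) (hload (sg j))
    simp only [Finset.mem_filter, Finset.mem_range] at hi ⊢
    obtain ⟨hb, o, h1, h2, h3, -⟩ := hbo i hi.1 hi.2
    have hpi : pl i := by
      by_contra hpi
      have := h2 hpi
      have := h3 hp
      omega
    rw [hI.base_placed i hi.1 hpi, hI.base_placed j hj hp] at hb
    exact ⟨hi.1, hpi, by omega⟩
  · refine le_trans (Finset.card_le_card (t := {j}) fun i hi => ?_) (by rw [Finset.card_singleton]; exact hm)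
    simp only [Finset.mem_filter, Finset.mem_range, Finset.mem_singleton] at hi ⊢
    obtain ⟨hb, o, h1, h2, -, h4⟩ := hbo i hi.1 hi.2
    have h4 := h4 hp
    have hpi : ¬ pl i := fun hpi => by
      have := h1 hpi
      omega
    have h5 : np i * n + i = np j * n + j := by have := h2 hpi; omega
    exact (mul_add_inj hi.1 hj h5).2

theorem Insertion.le_add (hI : Insertion n pr pl sg np base kap fin) {U : ℕ}
    (hU : ∀ i < n, pl i → sg i + 1 ≤ U) {j : ℕ} (hj : j < n) :
    fin j ≤ U + ((Finset.range n).filter fun d => ¬ pl d).card := by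
  rw [hI.fin_eq j hj]
  refine Nat.add_le_add ?_ (Finset.card_le_card fun d hd => ?_)
  · by_cases hp : pl j
    · rw [hI.base_placed j hj hp]; exact hU j hj hp
    · rcases hI.base_cases j hj hp with h | ⟨k, hk, hpk, -, h⟩
      · omega
      · rw [h]; exact hU k hk hpk
  · simp only [Finset.mem_filter] at hd ⊢
    exact ⟨hd.1, hd.2.1⟩

/-- The program for the insertion; the result is in array `13`. -/
def finishStmt : Stmt :=
  .seq (.for' 10 (.set 19 (.var 10) (.count 20 (prEx (.var 20) (.var 10)))))
  (.seq (.for' 10 (.set 20 (.var 10) (.cond (.get 11 (.var 10)) (.add (.get 12 (.var 10)) (.lit 1))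
    (.count 20 (.ex 21 (.and (.get 11 (.var 21)) (.and (prEx (.var 21) (.var 10))
      (.lt (.var 20) (.add (.get 12 (.var 21)) (.lit 1)))))))))) 
  (.seq (.for' 10 (.set 18 (.var 10)
    (.add (.add (.sum 20 (.sum 21 (.get 20 (.var 10)))) (.get 20 (.var 10)))
      (.cond (.get 11 (.var 10)) (.lit 0)
        (.add (.add (.sum 20 (.get 19 (.var 10))) (.var 10)) (.lit 1))))))
  (.for' 10 (.set 13 (.var 10) (.add (.get 20 (.var 10))
    (.count 20 (.and (.not (.get 11 (.var 20))) (.le (.get 18 (.var 20)) (.get 18 (.var 10))))))))))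

/-- A maximum computed by counting: the number of `t` below some `f i` is the maximum of `f` on `A`,
or `0` if `A` is empty. -/
theorem card_filter_exists_lt {n : ℕ} {A : ℕ → Prop} {f : ℕ → ℕ} (hf : ∀ i < n, A i → f i ≤ n) :
    (∀ i < n, A i →
      f i ≤ ((Finset.range n).filter fun t => ∃ i < n, A i ∧ t < f i).card) ∧
    (((Finset.range n).filter fun t => ∃ i < n, A i ∧ t < f i).card = 0 ∨ ∃ i < n, A i ∧
      ((Finset.range n).filter fun t => ∃ i < n, A i ∧ t < f i).card = f i) := by
  rcases ((Finset.range n).filter A).eq_empty_or_nonempty with h0 | hne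
  · have hno : ∀ i < n, ¬ A i := fun i hi hA => by
      have : i ∈ (Finset.range n).filter A := by simp [hi, hA]
      simp [h0] at this
    refine ⟨fun i hi hA => absurd hA (hno i hi), Or.inl ?_⟩
    rw [Finset.card_eq_zero, Finset.filter_eq_empty_iff]
    rintro t - ⟨i, hi, hA, -⟩
    exact hno i hi hA
  · obtain ⟨u, hu, hmax⟩ := Finset.exists_max_image _ f hne
    simp only [Finset.mem_filter, Finset.mem_range] at hu hmax
    have h : ((Finset.range n).filter fun t => ∃ i < n, A i ∧ t < f i) = Finset.range (f u) := by
      ext t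
      simp only [Finset.mem_filter, Finset.mem_range]
      constructor
      · rintro ⟨-, i, hi, hA, ht⟩
        exact ht.trans_le (hmax i ⟨hi, hA⟩)
      · intro ht
        exact ⟨ht.trans_le (hf u hu.1 hu.2), u, hu.1, hu.2, ht⟩
    rw [h, Finset.card_range]
    exact ⟨fun i hi hA => hmax i ⟨hi, hA⟩, Or.inr ⟨u, hu.1, hu.2, rfl⟩⟩

theorem run_finishStmt {y : ℕ → ℝ} {ρ : ℕ → ℕ} {M : Mem} (hpr : PrecMem pr M)
    (hsg : ∀ i < M 0 0, M 11 i ≠ 0 → M 12 i < M 0 0) :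
    ∃ np base kap, Insertion (M 0 0) pr (fun i => M 11 i ≠ 0) (M 12) np base kap
      (finishStmt.run y ρ M 13) := by
  set n := M 0 0 with hn
  set M1 := (Stmt.for' 10 (.set 19 (.var 10) (.count 20 (prEx (.var 20) (.var 10))))).run y ρ M
    with hM1
  have e1 : ∀ a, a ≠ 19 → M1 a = M a := fun a ha =>
    Stmt.run_of_notMem_writes y a _ _ _ (by simpa [Stmt.writes] using ha)
  have v1 : ∀ j < n, M1 19 j = ((Finset.range n).filter fun i => pr i j).card :=
    run_fill (fun j => ((Finset.range n).filter fun i => pr i j).card) fun j hj M' hM' _ => by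
      rw [eval_count, hM' 0 (by decide)]
      congr 1
      refine Finset.filter_congr fun i hi => ?_
      simpa [prEx, Function.update_apply, hM'] using hpr i (Finset.mem_range.1 hi) j hj
  obtain ⟨c, hc⟩ : ∃ c, c = (Stmt.for' 10 (.set 20 (.var 10)
    (.cond (.get 11 (.var 10)) (.add (.get 12 (.var 10)) (.lit 1))
    (.count 20 (.ex 21 (.and (.get 11 (.var 21)) (.and (prEx (.var 21) (.var 10))
      (.lt (.var 20) (.add (.get 12 (.var 21)) (.lit 1)))))))))) := ⟨_, rfl⟩
  set M2 := c.run y ρ M1 with hM2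
  have e2 : ∀ a, a ≠ 20 → M2 a = M1 a := fun a ha =>
    Stmt.run_of_notMem_writes y a _ _ _ (by subst hc; simpa [Stmt.writes] using ha)
  have v2 : ∀ j < n, M2 20 j = if M 11 j ≠ 0 then M 12 j + 1 else
      ((Finset.range n).filter fun t => ∃ i < n, (M 11 i ≠ 0 ∧ pr i j) ∧ t < M 12 i + 1).card := by
    rw [hM2, hc, hn, ← e1 0 (by decide)]
    refine run_fill (fun j => if M 11 j ≠ 0 then M 12 j + 1 else
      ((Finset.range (M1 0 0)).filter fun t => ∃ i < M1 0 0, (M 11 i ≠ 0 ∧ pr i j) ∧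
        t < M 12 i + 1).card) fun j hj M' hM' _ => ?_
    have k : ∀ a, a ≠ 20 → a ≠ 19 → M' a = M a := fun a h h' => (hM' a h).trans (e1 a h')
    rw [eval_cond]
    simp only [holds_get, eval_var, Function.update_self, k 11 (by decide) (by decide), eval_add,
      eval_get, k 12 (by decide) (by decide), eval_lit, eval_count, holds_ex, holds_and, holds_lt,
      k 0 (by decide) (by decide), prEx, k 1 (by decide) (by decide), k 26 (by decide) (by decide),
      e1 0 (by decide)]
    rw [e1 0 (by decide)] at hj
    congr 2
    refine Finset.filter_congr fun t _ => exists_congr fun i => and_congr_right fun hi => ?_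
    simp only [Function.update_apply]
    simp only [Nat.reduceEqDiff, if_true, if_false, ← hpr i hi j hj]
    tauto
  obtain ⟨d, hd⟩ : ∃ d, d = (Stmt.for' 10 (.set 18 (.var 10)
    (.add (.add (.sum 20 (.sum 21 (.get 20 (.var 10)))) (.get 20 (.var 10)))
      (.cond (.get 11 (.var 10)) (.lit 0)
        (.add (.add (.sum 20 (.get 19 (.var 10))) (.var 10)) (.lit 1)))))) := ⟨_, rfl⟩
  set M3 := d.run y ρ M2 with hM3
  have e3 : ∀ a, a ≠ 18 → M3 a = M2 a := fun a ha =>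
    Stmt.run_of_notMem_writes y a _ _ _ (by subst hd; simpa [Stmt.writes] using ha)
  have v3 : ∀ j < n, M3 18 j = M2 20 j * (n * n + 1) +
      if M 11 j ≠ 0 then 0 else M1 19 j * n + j + 1 := by
    have h0 : M2 0 = M 0 := (e2 0 (by decide)).trans (e1 0 (by decide))
    rw [hM3, hd, hn, ← h0]
    refine run_fill (fun j => M2 20 j * (M2 0 0 * M2 0 0 + 1) +
      if M 11 j ≠ 0 then 0 else M1 19 j * M2 0 0 + j + 1) fun j hj M' hM' _ => ?_
    simp only [eval_add, eval_sum, eval_get, eval_var, eval_cond, holds_get, eval_lit,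
      Function.update_apply, hM' 0 (by decide), hM' 20 (by decide), hM' 11 (by decide),
      hM' 19 (by decide), e2 11 (by decide), e1 11 (by decide), e2 19 (by decide)]
    simp
    ring_nf
  have h1 : finishStmt.run y ρ M = (Stmt.for' 10 (.set 13 (.var 10) (.add (.get 20 (.var 10))
    (.count 20 (.and (.not (.get 11 (.var 20))) (.le (.get 18 (.var 20))
      (.get 18 (.var 10)))))))).run y ρ M3 := by
    rw [hM3, hM2, hd, hc, hM1]; rfl
  have v4 : ∀ j < n, finishStmt.run y ρ M 13 j = M2 20 j +
      ((Finset.range n).filter fun d => ¬ M 11 d ≠ 0 ∧ M3 18 d ≤ M3 18 j).card := by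
    have h0 : M3 0 = M 0 := (e3 0 (by decide)).trans ((e2 0 (by decide)).trans (e1 0 (by decide)))
    rw [h1, hn, ← h0]
    refine run_fill (fun j => M2 20 j +
      ((Finset.range (M3 0 0)).filter fun d => ¬ M 11 d ≠ 0 ∧ M3 18 d ≤ M3 18 j).card)
      fun j hj M' hM' _ => ?_
    have k11 : M' 11 = M 11 := (hM' 11 (by decide)).trans
      ((e3 11 (by decide)).trans ((e2 11 (by decide)).trans (e1 11 (by decide))))
    simp only [eval_add, eval_get, eval_var, eval_count, holds_and, holds_not, holds_get, holds_le,
      Function.update_apply, k11, hM' 0 (by decide), hM' 18 (by decide), hM' 20 (by decide),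
      e3 20 (by decide)]
    simp
  refine ⟨M1 19, M2 20, M3 18, v1, fun j hj hp => ?_, fun j hj hp => ?_, fun j hj hp => ?_,
    fun j hj hp => ?_, fun j hj hp => ?_, fun j hj => by convert v4 j hj⟩
  · rw [v2 j hj, if_pos hp]
  · rw [v2 j hj, if_neg hp]
    intro i hi hpi hij
    convert (card_filter_exists_lt (A := fun i => M 11 i ≠ 0 ∧ pr i j) (f := fun i => M 12 i + 1)
      fun i hi hA => hsg i hi hA.1).1 i hi ⟨hpi, hij⟩
  · rw [v2 j hj, if_neg hp]
    rcases (card_filter_exists_lt (A := fun i => M 11 i ≠ 0 ∧ pr i j) (f := fun i => M 12 i + 1)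
      fun i hi hA => hsg i hi hA.1).2 with h | ⟨i, hi, hA, h⟩
    · exact Or.inl (by convert h)
    · exact Or.inr ⟨i, hi, hA.1, hA.2, by convert h⟩
  · rw [v3 j hj, if_pos hp, add_zero]
  · rw [v3 j hj, if_neg hp]

end Insertion

end SchedRounding

namespace SchedRounding

open BoundedLoops

/-! ### The frame of the program -/

section Frame
open scoped Classical

variable {S : SchedInstance} {T : ℕ} {y : ℕ → ℝ} {ρ : ℕ → ℕ} {M : Mem}

/-- The instance, the powers of two, and the beginnings of the rows of matrices. -/
structure Static (S : SchedInstance) (T : ℕ) (M : Mem) : Prop where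
  n_eq : M 0 0 = S.n
  m_eq : M 0 1 = S.m
  T_eq : M 0 2 = T
  prec : PrecMem (Pr S) M
  pow : ∀ i ≤ S.n, M 17 i = 2 ^ i
  -- Products are loops of `S.n` rounds, hence correct only for a factor `T ≤ S.n`.
  row : T ≤ S.n → ∀ j < S.n, M 27 j = j * T

theorem Static.congr (h : Static S T M) {M' : Mem} (he : ∀ a ∈ [0, 1, 17, 26, 27], M' a = M a) :
    Static S T M' := by
  have h0 := he 0 (by simp)
  have h1 := he 1 (by simp)
  have h17 := he 17 (by simp)
  have h26 := he 26 (by simp)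
  have h27 := he 27 (by simp)
  refine ⟨by rw [h0, h.n_eq], by rw [h0, h.m_eq], by rw [h0, h.T_eq], ?_, by rw [h17]; exact h.pow,
    by rw [h27]; exact h.row⟩
  unfold PrecMem
  rw [h0, h1, h26]
  exact h.prec

/-- Statements that leave the static part of the memory unchanged. -/
def KeepsStatic (c : Stmt) : Prop := ∀ a ∈ [0, 1, 17, 26, 27], a ∉ c.writes

instance (c : Stmt) : Decidable (KeepsStatic c) :=
  inferInstanceAs (Decidable (∀ a ∈ [0, 1, 17, 26, 27], a ∉ c.writes))

theorem Static.run (h : Static S T M) {c : Stmt} (hc : KeepsStatic c) :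
    Static S T (c.run y ρ M) :=
  h.congr fun a ha => c.run_of_notMem_writes y a ρ M (hc a ha)

/-- The preparation of the static part. -/
def initStmt : Stmt :=
  .seq (.for' 10 (.set 26 (.var 10) (.sum 20 (.var 10))))
  (.seq (.for' 10 (.set 27 (.var 10) (.mul 20 (.var 10) tEx)))
  (.seq (.set 17 (.lit 0) (.lit 1))
  (.for' 10 (.set 17 (.add (.var 10) (.lit 1)) (.add (.get 17 (.var 10)) (.get 17 (.var 10)))))))

theorem run_initStmt (hn : M 0 0 = S.n) (hm : M 0 1 = S.m) (hT : M 0 2 = T)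
    (hp : ∀ i < S.n, ∀ j < S.n, (M 1 (i * S.n + j) ≠ 0 ↔ Pr S i j)) :
    Static S T (initStmt.run y ρ M) := by
  set M1 := (Stmt.for' 10 (.set 26 (.var 10) (.sum 20 (.var 10)))).run y ρ M with hM1
  have e1 : ∀ a, a ≠ 26 → M1 a = M a := fun a ha =>
    Stmt.run_of_notMem_writes y a _ _ _ (by simpa [Stmt.writes] using ha)
  have v1 : ∀ j < M 0 0, M1 26 j = j * S.n :=
    run_fill (fun j => j * S.n) fun j hj M' hM' _ => by
      simp [eval_sum, hM', hn, mul_comm]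
  set M2 := (Stmt.for' 10 (.set 27 (.var 10) (.mul 20 (.var 10) tEx))).run y ρ M1 with hM2
  have e2 : ∀ a, a ≠ 27 → M2 a = M1 a := fun a ha =>
    Stmt.run_of_notMem_writes y a _ _ _ (by simpa [Stmt.writes] using ha)
  have v2 : T ≤ S.n → ∀ j < M1 0 0, M2 27 j = j * T := fun hTn =>
    run_fill (fun j => j * T) fun j hj M' hM' _ => by
      refine eval_mul _ _ _ _ _ _ (fun i => ?_) (fun i => ?_) ?_
      · simp
      · simp [tEx, hM', e1, hT]
      · rw [hM' 0 (by decide), e1 0 (by decide), hn]; exact hTn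
  set M3 := put M2 17 0 1 with hM3
  have e3 : ∀ a, a ≠ 17 → M3 a = M2 a := fun a ha => put_of_ne _ _ _ ha
  have hrun : initStmt.run y ρ M = (Stmt.for' 10 (.set 17 (.add (.var 10) (.lit 1))
      (.add (.get 17 (.var 10)) (.get 17 (.var 10))))).run y ρ M3 := rfl
  have e4 : ∀ a, a ≠ 17 → initStmt.run y ρ M a = M3 a := fun a ha => by
    rw [hrun]
    exact Stmt.run_of_notMem_writes y a _ _ _ (by simpa [Stmt.writes] using ha)
  have h0 : M3 0 0 = S.n := by
    rw [e3 0 (by decide), e2 0 (by decide), e1 0 (by decide), hn]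
  have v4 := run_for_inv (y := y) (x := 10) (c := .set 17 (.add (.var 10) (.lit 1))
      (.add (.get 17 (.var 10)) (.get 17 (.var 10)))) (ρ := ρ) (M := M3)
      (fun i M' => ∀ j ≤ i, M' 17 j = 2 ^ j)
      (fun j hj => by
        obtain rfl : j = 0 := by omega
        simp [hM3, put_self])
      (fun i hi M' _ hI j hj => by
        simp only [Stmt.run, eval_add, eval_var, Function.update_self, eval_lit, eval_get]
        by_cases hji : j = i + 1
        · subst hji
          rw [put_self, hI i le_rfl]
          ring
        · rw [put_cell_of_ne _ _ _ hji]
          exact hI j (by omega))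
  rw [h0] at v4
  refine ⟨?_, ?_, ?_, ?_, by rw [hrun]; exact v4, fun hTn j hj => ?_⟩
  · rw [e4 0 (by decide), h0]
  · rw [e4 0 (by decide), e3 0 (by decide), e2 0 (by decide), e1 0 (by decide), hm]
  · rw [e4 0 (by decide), e3 0 (by decide), e2 0 (by decide), e1 0 (by decide), hT]
  · intro i hi j hj
    rw [e4 0 (by decide), h0] at hi hj
    rw [e4 1 (by decide), e3 1 (by decide), e2 1 (by decide), e1 1 (by decide), e4 26 (by decide),
      e3 26 (by decide), e2 26 (by decide), v1 i (by omega)]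
    exact hp i hi j hj
  · rw [e4 27 (by decide), e3 27 (by decide)]
    exact v2 hTn j (by rw [e1 0 (by decide), hn]; exact hj)

/-- Greedy placement followed by insertion. -/
def evalStmt : Stmt := .seq greedyStmt finishStmt

/-- The numbers `out j` are a feasible schedule. -/
structure Feasible (S : SchedInstance) (out : ℕ → ℕ) : Prop where
  one_le : ∀ j < S.n, 1 ≤ out j
  load_le : ∀ t, ((Finset.range S.n).filter fun i => out i = t).card ≤ S.m
  lt_of_pr : ∀ i < S.n, ∀ j < S.n, Pr S i j → out i < out j

theorem run_evalStmt (hM : Static S T M) :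
    ∃ (pl : ℕ → Prop) (sg np base kap : ℕ → ℕ),
      (greedyInput (Pr S) M).Spec (fun j => M 10 j < S.n ∧ M 7 j < S.n) pl sg ∧
      Insertion S.n (Pr S) pl sg np base kap (evalStmt.run y ρ M 13) := by
  have h1 := run_greedyStmt (y := y) (ρ := ρ) hM.prec fun i => Pr.irrefl i
  have hS1 : Static S T (greedyStmt.run y ρ M) := hM.run (by decide)
  obtain ⟨np, base, kap, h2⟩ := run_finishStmt (y := y) (ρ := ρ) hS1.prec fun i hi hp => by
    rw [hS1.n_eq] at hi ⊢
    rw [← hM.n_eq] at hi ⊢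
    exact (h1.placed i hi hp).2.1
  rw [hM.n_eq] at h1
  rw [hS1.n_eq] at h2
  exact ⟨_, _, np, base, kap, h1, h2⟩

theorem Insertion.feasible {pl : ℕ → Prop} {sg np base kap fin : ℕ → ℕ} {D : ℕ → Prop}
    (hI : Insertion S.n (Pr S) pl sg np base kap fin)
    (hM : Static S T M) (hG : (greedyInput (Pr S) M).Spec D pl sg) (hm : 0 < S.m) :
    Feasible S fin := by
  have hn : (greedyInput (Pr S) M).n = S.n := hM.n_eq
  have hmm : (greedyInput (Pr S) M).m = S.m := hM.m_eq
  refine ⟨fun j hj => hI.one_le hj, fun t => hI.load_le (fun i => Pr.irrefl i) hm (fun t => ?_) t,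
    fun i hi j hj hij => hI.fin_lt_fin (fun i => Pr.irrefl i) hi hj
      (hI.kap_lt_kap (fun i => Pr.irrefl i) (fun i j k => Pr.trans) (fun i hi j hj => ?_) hi hj
        hij)⟩
  · have := hG.load_le t
    rwa [GreedyInput.load, hn, hmm] at this
  · exact hG.lt_of_pr i (by rw [hn]; exact hi) j (by rw [hn]; exact hj)

def copyStmt : Stmt := .for' 10 (.set 2 (.var 10) (.get 13 (.var 10)))

theorem run_copyStmt : ∀ j < M 0 0, copyStmt.run y ρ M 2 j = M 13 j :=
  run_fill (M 13) fun j hj M' hM' _ => by simp [hM' 13]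

/-- The makespan of the schedule in array `13` is at most that of the schedule in array `2`. -/
def betterEx : Ex := .all 20 (.ex 21 (.le (.get 13 (.var 20)) (.get 2 (.var 21))))

/-- Keep the better one of the schedules in the arrays `13` and `2`. -/
def keepStmt : Stmt := .ite betterEx copyStmt .skip

/-- Quantifying over all common bounds `U` expresses that the result is as good as both schedules,
without speaking of maxima. -/
theorem run_keepStmt (hM : Static S T M) (h2 : Feasible S (M 2)) (h13 : Feasible S (M 13)) :
    Feasible S (keepStmt.run y ρ M 2) ∧
      ∀ U, ((∀ j < S.n, M 2 j ≤ U) ∨ ∀ j < S.n, M 13 j ≤ U) →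
        ∀ j < S.n, keepStmt.run y ρ M 2 j ≤ U := by
  have hb : betterEx.Holds y M ρ ↔ ∀ i < S.n, ∃ j < S.n, M 13 i ≤ M 2 j := by
    simp [betterEx, hM.n_eq]
  by_cases h : ∀ i < S.n, ∃ j < S.n, M 13 i ≤ M 2 j
  · have hc : ∀ j < S.n, keepStmt.run y ρ M 2 j = M 13 j := by
      rw [keepStmt, run_ite, if_pos (hb.2 h), ← hM.n_eq]
      exact run_copyStmt
    refine ⟨⟨fun j hj => ?_, fun t => ?_, fun i hi j hj hij => ?_⟩, fun U hU j hj => ?_⟩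
    · rw [hc j hj]; exact h13.one_le j hj
    · refine le_trans (le_of_eq (congrArg _ (Finset.filter_congr fun i hi => ?_))) (h13.load_le t)
      rw [hc i (Finset.mem_range.1 hi)]
    · rw [hc i hi, hc j hj]; exact h13.lt_of_pr i hi j hj hij
    · rw [hc j hj]
      rcases hU with hU | hU
      · obtain ⟨k, hk, hle⟩ := h j hj
        exact hle.trans (hU k hk)
      · exact hU j hj
  · rw [keepStmt, run_ite, if_neg fun h' => h (hb.1 h'), Stmt.run]
    refine ⟨h2, fun U hU j hj => ?_⟩
    rcases hU with hU | hU
    · exact hU j hj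
    · push Not at h
      obtain ⟨i, hi, hlt⟩ := h
      exact (hlt j hj).le.trans (hU i hi)

/-- The input for list scheduling. -/
def listStmt : Stmt :=
  .seq (.for' 10 (.set 7 (.var 10) (.lit 0)))
  (.seq (.for' 10 (.set 8 (.var 10) (.lit 0)))
  (.seq (.for' 10 (.set 9 (.var 10) nEx))
  (.for' 10 (.set 10 (.var 10) (.count 20 (prEx (.var 20) (.var 10)))))))

theorem run_listStmt (hM : Static S T M) :
    (greedyInput (Pr S) (listStmt.run y ρ M)).IsList ∧
      ∀ j < S.n, listStmt.run y ρ M 10 j < S.n ∧ listStmt.run y ρ M 7 j < S.n := by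
  set M1 := (Stmt.for' 10 (.set 7 (.var 10) (.lit 0))).run y ρ M with hM1
  have hS1 : Static S T M1 := hM.run (by decide)
  have v1 : ∀ j < M 0 0, M1 7 j = 0 := run_fill (fun _ => 0) fun _ _ _ _ _ => rfl
  set M2 := (Stmt.for' 10 (.set 8 (.var 10) (.lit 0))).run y ρ M1 with hM2
  have hS2 : Static S T M2 := hS1.run (by decide)
  have v2 : ∀ j < M1 0 0, M2 8 j = 0 := run_fill (fun _ => 0) fun _ _ _ _ _ => rfl
  set M3 := (Stmt.for' 10 (.set 9 (.var 10) nEx)).run y ρ M2 with hM3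
  have hS3 : Static S T M3 := hS2.run (by decide)
  have v3 : ∀ j < M2 0 0, M3 9 j = S.n :=
    run_fill (fun _ => S.n) fun j _ M' hM' _ => by simp [nEx, hM', hS2.n_eq]
  set M4 := (Stmt.for' 10 (.set 10 (.var 10)
    (.count 20 (prEx (.var 20) (.var 10))))).run y ρ M3 with hM4
  have hS4 : Static S T M4 := hS3.run (by decide)
  have v4 : ∀ j < M3 0 0, M4 10 j = ((Finset.range S.n).filter fun i => Pr S i j).card :=
    run_fill (fun j => ((Finset.range S.n).filter fun i => Pr S i j).card)
      fun j hj M' hM' _ => by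
        rw [eval_count, hM' 0 (by decide), hS3.n_eq]
        congr 1
        refine Finset.filter_congr fun i hi => ?_
        rw [← hS3.n_eq] at hi
        simpa [prEx, Function.update_apply, hM'] using hS3.prec i (Finset.mem_range.1 hi) j hj
  have e4 : ∀ a, a ≠ 10 → M4 a = M3 a := fun a ha =>
    Stmt.run_of_notMem_writes y a _ _ _ (by simpa [Stmt.writes] using ha)
  have e3 : ∀ a, a ≠ 9 → M3 a = M2 a := fun a ha =>
    Stmt.run_of_notMem_writes y a _ _ _ (by simpa [Stmt.writes] using ha)
  have e2 : ∀ a, a ≠ 8 → M2 a = M1 a := fun a ha =>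
    Stmt.run_of_notMem_writes y a _ _ _ (by simpa [Stmt.writes] using ha)
  have hrun : listStmt.run y ρ M = M4 := rfl
  rw [hM.n_eq] at v1
  rw [hS1.n_eq] at v2
  rw [hS2.n_eq] at v3
  rw [hS3.n_eq] at v4
  have w7 : ∀ j < S.n, M4 7 j = 0 := fun j hj => by
    rw [e4 7 (by decide), e3 7 (by decide), e2 7 (by decide), v1 j hj]
  have hkey : ∀ j < S.n, ((Finset.range S.n).filter fun i => Pr S i j).card < S.n := fun j hj => by
    have hs : ((Finset.range S.n).filter fun i => Pr S i j) ⊂ Finset.range S.n :=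
      Finset.filter_ssubset.2 ⟨j, Finset.mem_range.2 hj, Pr.irrefl j⟩
    simpa using Finset.card_lt_card hs
  rw [hrun]
  refine ⟨⟨?_, ?_, ?_, ?_⟩, fun j hj => ⟨by rw [v4 j hj]; exact hkey j hj, by
    rw [w7 j hj]; omega⟩⟩
  all_goals simp only [greedyInput, hS4.n_eq]
  · exact w7
  · intro j hj
    rw [e4 8 (by decide), e3 8 (by decide), v2 j hj]
  · intro j hj
    rw [e4 9 (by decide), v3 j hj]
  · intro i hi j hj hij
    rw [v4 i hi, v4 j hj]
    refine Finset.card_lt_card ⟨fun k hk => ?_, fun h => ?_⟩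
    · simp only [Finset.mem_filter] at hk ⊢
      exact ⟨hk.1, hk.2.trans hij⟩
    · have : i ∈ (Finset.range S.n).filter fun k => Pr S k j := by simp [hi, hij]
      exact Pr.irrefl i (Finset.mem_filter.1 (h this)).2

/-- The makespan of the list schedule. -/
theorem run_listStmt_le (hM : Static S T M) (hm : 0 < S.m) {j : ℕ} (hj : j < S.n) :
    evalStmt.run y ρ (listStmt.run y ρ M) 13 j ≤ S.n ∧
    ∀ a : ℕ → ℕ, (∀ i < S.n, ∀ j < S.n, Pr S i j → a i < a j) → (∀ j < S.n, a j < T) →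
      S.n ≤ S.m * T → evalStmt.run y ρ (listStmt.run y ρ M) 13 j ≤ 2 * T - 1 := by
  obtain ⟨hl, hD⟩ := run_listStmt (y := y) (ρ := ρ) hM
  have hM' : Static S T (listStmt.run y ρ M) := hM.run (by decide)
  obtain ⟨pl, sg, np, base, kap, hG, hI⟩ := run_evalStmt (y := y) (ρ := ρ) hM'
  have hn : (greedyInput (Pr S) (listStmt.run y ρ M)).n = S.n := hM'.n_eq
  have hmm : (greedyInput (Pr S) (listStmt.run y ρ M)).m = S.m := hM'.m_eq
  have htr : ∀ i j k, Pr S i j → Pr S j k → Pr S i k := fun i j k => Pr.trans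
  have hD' : ∀ j < (greedyInput (Pr S) (listStmt.run y ρ M)).n,
      listStmt.run y ρ M 10 j < S.n ∧ listStmt.run y ρ M 7 j < S.n := fun j hj =>
    hD j (by rwa [hn] at hj)
  have hpl : ∀ j < S.n, pl j := fun j hj =>
    hl.placed hG hD' htr (by rw [hmm]; exact hm) (by rw [hn]; exact hj)
  have h0 : ((Finset.range S.n).filter fun d => ¬ pl d).card = 0 := by
    rw [Finset.card_eq_zero, Finset.filter_eq_empty_iff]
    exact fun d hd => not_not.2 (hpl d (Finset.mem_range.1 hd))
  constructor
  · have := hI.le_add (U := S.n) (fun i hi hp => by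
      have := (hG.placed i (by rw [hn]; exact hi) hp).2.1
      rw [hn] at this
      exact this) hj
    omega
  · intro a ha haT hnT
    have := hI.le_add (U := 2 * T - 1) (fun i hi hp => by
      have := hl.lt_two_mul hG hD' htr (by rw [hmm]; exact hm) (a := a) (T := T)
        (by rw [hn]; exact ha) (by rw [hn]; exact haT) (by rw [hn, hmm]; exact hnT)
        (j := i) (by rw [hn]; exact hi)
      omega) hj
    omega

/-- Try the input produced by `fill`. -/
def tryStmt (fill : Stmt) : Stmt := .seq fill (.seq evalStmt keepStmt)

/-- List scheduling, followed by a search through the values of the four parameters of `fill`. -/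
def searchStmt (fill : Stmt) : Stmt :=
  .seq initStmt (.seq listStmt (.seq evalStmt (.seq copyStmt
    (.ite (.lt tEx nEx) (.for' 1 (.for' 2 (.for' 3 (.for' 4 (tryStmt fill))))) .skip))))

theorem KeepsStatic.tryStmt {fill : Stmt} (hf : KeepsStatic fill) :
    KeepsStatic (tryStmt fill) := by
  intro a ha h
  simp only [SchedRounding.tryStmt, Stmt.writes, List.mem_append] at h
  rcases h with h | h
  · exact hf a ha h
  · have : KeepsStatic (.seq evalStmt keepStmt) := by decide
    exact this a ha (by simpa [Stmt.writes] using h)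

theorem run_tryStmt {fill : Stmt} (hf : KeepsStatic fill) (hf2 : 2 ∉ fill.writes)
    (hM : Static S T M) (hm : 0 < S.m) (h2 : Feasible S (M 2)) :
    Static S T ((tryStmt fill).run y ρ M) ∧ Feasible S ((tryStmt fill).run y ρ M 2) ∧
      ∀ U, ((∀ j < S.n, M 2 j ≤ U) ∨ ∀ j < S.n, evalStmt.run y ρ (fill.run y ρ M) 13 j ≤ U) →
        ∀ j < S.n, (tryStmt fill).run y ρ M 2 j ≤ U := by
  have hS1 : Static S T (fill.run y ρ M) := hM.run hf
  have hS2 : Static S T (evalStmt.run y ρ (fill.run y ρ M)) := hS1.run (by decide)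
  obtain ⟨pl, sg, np, base, kap, hG, hI⟩ := run_evalStmt (y := y) (ρ := ρ) hS1
  have e2 : evalStmt.run y ρ (fill.run y ρ M) 2 = M 2 :=
    (evalStmt.run_of_notMem_writes y 2 _ _ (by decide)).trans
      (fill.run_of_notMem_writes y 2 _ _ hf2)
  obtain ⟨h3, h4⟩ := run_keepStmt (y := y) (ρ := ρ) hS2 (by rw [e2]; exact h2)
    (hI.feasible hS1 hG hm)
  exact ⟨hM.run hf.tryStmt, h3, fun U hU => h4 U (by rwa [e2])⟩

/-- The right parameters depend on `ε`, so they are searched for. A quadruple is useful if its bound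
holds for every memory with the correct static part, because the rest of the memory at the time of
the trial is left over from earlier ones. -/
theorem run_searchStmt {fill : Stmt} (hf : KeepsStatic fill) (hf2 : 2 ∉ fill.writes)
    (hm : 0 < S.m) (hn : M 0 0 = S.n) (hmM : M 0 1 = S.m) (hT : M 0 2 = T)
    (hp : ∀ i < S.n, ∀ j < S.n, (M 1 (i * S.n + j) ≠ 0 ↔ Pr S i j)) :
    Feasible S ((searchStmt fill).run y ρ M 2) ∧
    ∀ U, ((∀ M', Static S T M' → ∀ j < S.n, evalStmt.run y ρ (listStmt.run y ρ M') 13 j ≤ U) ∨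
      T < S.n ∧ ∃ q < S.n, ∃ P < S.n, ∃ k < S.n, ∃ K < S.n, ∀ M' ρ', Static S T M' →
        ρ' 1 = q → ρ' 2 = P → ρ' 3 = k → ρ' 4 = K →
        ∀ j < S.n, evalStmt.run y ρ' (fill.run y ρ' M') 13 j ≤ U) →
      ∀ j < S.n, (searchStmt fill).run y ρ M 2 j ≤ U := by
  have hS0 : Static S T (initStmt.run y ρ M) := run_initStmt hn hmM hT hp
  set M0 := initStmt.run y ρ M with hM0
  have hS1 : Static S T (listStmt.run y ρ M0) := hS0.run (by decide)
  have hS2 : Static S T (evalStmt.run y ρ (listStmt.run y ρ M0)) := hS1.run (by decide)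
  set M2 := evalStmt.run y ρ (listStmt.run y ρ M0) with hM2
  have hS3 : Static S T (copyStmt.run y ρ M2) := hS2.run (by decide)
  set M3 := copyStmt.run y ρ M2 with hM3
  obtain ⟨pl, sg, np, base, kap, hG, hI⟩ := run_evalStmt (y := y) (ρ := ρ) hS1
  have hfe := hI.feasible hS1 hG hm
  rw [← hM2] at hfe
  have hc : ∀ j < S.n, M3 2 j = M2 13 j := by
    rw [← hS2.n_eq]
    exact run_copyStmt
  have hfe3 : Feasible S (M3 2) := by
    refine ⟨fun j hj => ?_, fun t => ?_, fun i hi j hj hij => ?_⟩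
    · rw [hc j hj]; exact hfe.one_le j hj
    · refine le_trans (le_of_eq (congrArg _ (Finset.filter_congr fun i hi => ?_))) (hfe.load_le t)
      rw [hc i (Finset.mem_range.1 hi)]
    · rw [hc i hi, hc j hj]; exact hfe.lt_of_pr i hi j hj hij
  have hrun : (searchStmt fill).run y ρ M =
      (Stmt.ite (.lt tEx nEx) (.for' 1 (.for' 2 (.for' 3 (.for' 4 (tryStmt fill))))) .skip).run
        y ρ M3 := rfl
  have hcond : (Ex.lt tEx nEx).Holds y M3 ρ ↔ T < S.n := by
    simp [tEx, nEx, hS3.T_eq, hS3.n_eq]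
  rw [hrun, run_ite]
  by_cases hTn : T < S.n
  · rw [if_pos (hcond.2 hTn)]
    let good : ℕ → ℕ → ℕ → ℕ → ℕ → Prop := fun q P k K U =>
      ∀ M' ρ', Static S T M' → ρ' 1 = q → ρ' 2 = P → ρ' 3 = k → ρ' 4 = K →
        ∀ j < S.n, evalStmt.run y ρ' (fill.run y ρ' M') 13 j ≤ U
    -- `B` is the set of quadruples that have been tried.
    let Inv : (ℕ → ℕ → ℕ → ℕ → Prop) → Mem → Prop := fun B M' =>
      Static S T M' ∧ Feasible S (M' 2) ∧
        ∀ U, ((∀ j < S.n, M3 2 j ≤ U) ∨ ∃ q < S.n, ∃ P < S.n, ∃ k < S.n, ∃ K < S.n,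
          B q P k K ∧ good q P k K U) → ∀ j < S.n, M' 2 j ≤ U
    have Inv.congr : ∀ {B B' : ℕ → ℕ → ℕ → ℕ → Prop} {M' : Mem}, Inv B M' →
        (∀ q < S.n, ∀ P < S.n, ∀ k < S.n, ∀ K < S.n, B' q P k K → B q P k K) → Inv B' M' := by
      rintro B B' M' ⟨h1, h2, h3⟩ hBB
      refine ⟨h1, h2, fun U hU => h3 U (hU.imp_right ?_)⟩
      rintro ⟨q, hq, P, hP, k, hk, K, hK, hB, hg⟩
      exact ⟨q, hq, P, hP, k, hk, K, hK, hBB q hq P hP k hk K hK hB, hg⟩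
    have hfin := run_for_inv (y := y) (x := 1) (c := .for' 2 (.for' 3 (.for' 4 (tryStmt fill))))
      (ρ := ρ) (M := M3) (fun i M' => Inv (fun q _ _ _ => q < i) M')
      ⟨hS3, hfe3, fun U hU => hU.elim id (fun ⟨q, _, P, _, k, _, K, _, h, _⟩ => absurd h (by omega))⟩
      (fun q hq Ma _ hIa => by
        have hna := hIa.1.n_eq
        have := run_for_inv (y := y) (x := 2) (c := .for' 3 (.for' 4 (tryStmt fill)))
          (ρ := Function.update ρ 1 q) (M := Ma)
          (fun i M' => Inv (fun q' P _ _ => q' < q ∨ q' = q ∧ P < i) M')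
          (Inv.congr hIa (by omega))
          (fun P hP Mb _ hIb => by
            have hnb := hIb.1.n_eq
            have := run_for_inv (y := y) (x := 3) (c := .for' 4 (tryStmt fill))
              (ρ := Function.update (Function.update ρ 1 q) 2 P) (M := Mb)
              (fun i M' => Inv (fun q' P' k _ =>
                q' < q ∨ q' = q ∧ (P' < P ∨ P' = P ∧ k < i)) M')
              (Inv.congr hIb (by omega))
              (fun k hk Mc _ hIc => by
                have hnc := hIc.1.n_eq
                have := run_for_inv (y := y) (x := 4) (c := tryStmt fill)
                  (ρ := Function.update (Function.update (Function.update ρ 1 q) 2 P) 3 k) (M := Mc)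
                  (fun i M' => Inv (fun q' P' k' K =>
                    q' < q ∨ q' = q ∧ (P' < P ∨ P' = P ∧ (k' < k ∨ k' = k ∧ K < i))) M')
                  (Inv.congr hIc (by omega))
                  (fun K hK Md _ hId => by
                    obtain ⟨g1, g2, g3⟩ := hId
                    obtain ⟨r1, r2, r3⟩ := run_tryStmt (y := y)
                      (ρ := Function.update (Function.update (Function.update
                        (Function.update ρ 1 q) 2 P) 3 k) 4 K) hf hf2 g1 hm g2
                    refine ⟨r1, r2, fun U hU => r3 U ?_⟩
                    rcases hU with hU | ⟨q', hq', P', hP', k', hk', K', hK', hB, hg⟩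
                    · exact Or.inl (g3 U (Or.inl hU))
                    · by_cases he : q' = q ∧ P' = P ∧ k' = k ∧ K' = K
                      · obtain ⟨rfl, rfl, rfl, rfl⟩ := he
                        exact Or.inr (hg Md _ g1 (by simp)
                          (by simp) (by simp)
                          (by simp))
                      · exact Or.inl (g3 U (Or.inr ⟨q', hq', P', hP', k', hk', K', hK',
                          by omega, hg⟩)))
                exact Inv.congr this (by rw [hnc]; omega))
            exact Inv.congr this (by rw [hnb]; omega))
        exact Inv.congr this (by rw [hna]; omega))
    refine ⟨hfin.2.1, fun U hU => hfin.2.2 U ?_⟩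
    rcases hU with hU | ⟨-, q, hq, P, hP, k, hk, K, hK, hg⟩
    · exact Or.inl fun j hj => by rw [hc j hj]; exact hU M0 hS0 j hj
    · exact Or.inr ⟨q, hq, P, hP, k, hk, K, hK, by rw [hS3.n_eq]; exact hq, hg⟩
  · rw [if_neg fun h => hTn (hcond.1 h), Stmt.run]
    refine ⟨hfe3, fun U hU j hj => ?_⟩
    rcases hU with hU | ⟨h, -⟩
    · rw [hc j hj]; exact hU M0 hS0 j hj
    · exact absurd h hTn

end Frame

end SchedRounding

namespace SchedRounding

/-! ### Configurations of the forward pass -/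

section Pass
open scoped Classical

variable {S : SchedInstance} {T r : ℕ} {y : Finset (LPVar S.n T) → ℝ} {yR : ℕ → ℝ}

/-- The jobs that are still active, with their codes and windows, and for the other jobs the input
of the greedy placement. -/
structure Conf where
  act : ℕ → Prop
  cb : ℕ → ℕ
  a : ℕ → ℕ
  b : ℕ → ℕ
  H : ℕ → ℕ
  lo : ℕ → ℕ
  hi : ℕ → ℕ
  key : ℕ → ℕ

/-- The number `cb` denotes a set `c` of at most `ℓ` variables, of positive probability. -/
def IsCode (y : Finset (LPVar S.n T) → ℝ) (ℓ cb : ℕ) (c : Finset (LPVar S.n T)) : Prop :=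
  ∃ code, cb = code * setBase S.n T ∧ code < setBase S.n T ^ ℓ ∧ c = decodeSet S.n T code ∧
    c.card ≤ ℓ ∧ 0 < y c

/-- The table `yR` holds the signs of `y`. -/
def IsTable (y : Finset (LPVar S.n T) → ℝ) (yR : ℕ → ℝ) (r : ℕ) : Prop :=
  ∀ code ℓ, code < setBase S.n T ^ ℓ → ℓ ≤ r → ∀ j < S.n, ∀ t < T,
    (0 < yR (code * setBase S.n T + (j * T + t + 1)) ↔ Supp y (decodeSet S.n T code) j t)

/-- `a` and `b` are the first and the last positive entry of the row of the table that starts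
at `p`. -/
def Reads (yR : ℕ → ℝ) (T p a b : ℕ) : Prop :=
  (∃ t < T, 0 < yR (p + t + 1)) →
    (a < T ∧ 0 < yR (p + a + 1)) ∧ (b < T ∧ 0 < yR (p + b + 1)) ∧
      ∀ t < T, 0 < yR (p + t + 1) → a ≤ t ∧ t ≤ b

theorem setBase_pos (n T : ℕ) : 0 < setBase n T := by unfold setBase; omega

theorem IsCode.unique {ℓ ℓ' cb : ℕ} {c c' : Finset (LPVar S.n T)} (h : IsCode y ℓ cb c)
    (h' : IsCode y ℓ' cb c') : c = c' := by
  obtain ⟨code, h1, -, h2, -⟩ := h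
  obtain ⟨code', h1', -, h2', -⟩ := h'
  have : code = code' := Nat.eq_of_mul_eq_mul_right (setBase_pos S.n T) (h1.symm.trans h1')
  rw [h2, h2', this]

theorem isCode_zero (hy : y ∈ schedLasserre S T r) : IsCode y 0 0 ∅ :=
  ⟨0, by simp, by simp, (decodeSet_zero _ _).symm, by simp, by rw [y_empty hy]; exact one_pos⟩

/-- `cb` is stored already multiplied by the base, so cells of the table are reached by additions,
and conditioning costs one multiplication by `setBase`. -/
theorem IsCode.append {ℓ cb : ℕ} {c : Finset (LPVar S.n T)} (h : IsCode y ℓ cb c) {j t : ℕ}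
    (hs : Supp y c j t) : ∃ (hj : j < S.n) (ht : t < T),
      IsCode y (ℓ + 1) ((cb + (j * T + t + 1)) * setBase S.n T)
        (insert (.slot ⟨j, hj⟩ ⟨t, ht⟩) c) := by
  obtain ⟨code, h1, h2, h3, h4, h5⟩ := h
  obtain ⟨hj, ht, hp⟩ := hs
  refine ⟨hj, ht, _, rfl, ?_, ?_, (Finset.card_insert_le _ _).trans (by omega), hp⟩
  · have hlt := LPVar.index_slot_lt (⟨j, hj⟩ : Fin S.n) (⟨t, ht⟩ : Fin T)
    rw [LPVar.index_slot] at hlt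
    simp only at hlt
    have hB : j * T + t + 1 < setBase S.n T := by unfold setBase; omega
    calc cb + (j * T + t + 1) < (code + 1) * setBase S.n T := by rw [add_mul, h1]; omega
      _ ≤ setBase S.n T ^ ℓ * setBase S.n T := Nat.mul_le_mul_right _ h2
      _ = _ := by ring
  · rw [h1, h3, ← decodeSet_append]

theorem Reads.isWindow (hy : y ∈ schedLasserre S T r) (hT : IsTable y yR r) {ℓ cb j a b : ℕ}
    {c : Finset (LPVar S.n T)} (hc : IsCode y ℓ cb c) (hℓ : ℓ ≤ r) (hj : j < S.n)
    (h : Reads yR T (cb + j * T) a b) : IsWindow y c j a b := by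
  obtain ⟨code, rfl, h2, rfl, h4, h5⟩ := hc
  have key : ∀ t < T, (0 < yR (code * setBase S.n T + j * T + t + 1) ↔
      Supp y (decodeSet S.n T code) j t) := fun t ht => by
    rw [← hT code ℓ h2 hℓ j hj t ht]; simp only [add_assoc]
  obtain ⟨t, ht⟩ := exists_supp hy (h4.trans hℓ) h5 hj
  obtain ⟨⟨g1, g2⟩, ⟨g3, g4⟩, g5⟩ := h ⟨t, ht.lt, (key t ht.lt).2 ht⟩
  exact ⟨(key a g1).1 g2, (key b g3).1 g4, fun t ht => g5 t ht.lt ((key t ht.lt).2 ht)⟩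

/-- The facts about the active jobs while the windows are inside blocks of length `2 ^ h`. -/
structure Conf.Valid (y : Finset (LPVar S.n T) → ℝ) (C : Conf) (h : ℕ) (Q : ℕ → ℕ → Prop) :
    Prop where
  job : ∀ j < S.n, C.act j →
    ∃ ℓ c, Q j ℓ ∧ IsCode y ℓ (C.cb j) c ∧ IsWindow y c j (C.a j) (C.b j)
  code : ∀ i < S.n, ∀ j < S.n, C.act i → C.act j → C.a i / 2 ^ h = C.a j / 2 ^ h →
    C.cb i = C.cb j
  block : ∀ j < S.n, C.act j → C.a j / 2 ^ h = C.b j / 2 ^ h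
  lt : ∀ i < S.n, ∀ j < S.n, C.act i → C.act j → Pr S i j → C.a i < C.a j ∧ C.b i < C.b j

variable {C C' : Conf} {h : ℕ} {Q : ℕ → ℕ → Prop}

theorem IsWindow.le {c : Finset (LPVar S.n T)} {j a b : ℕ} (h : IsWindow y c j a b) : a ≤ b :=
  (h.mem _ h.left).2

theorem Conf.Valid.le (hC : C.Valid y h Q) {j : ℕ} (hj : j < S.n) (ha : C.act j) :
    C.a j ≤ C.b j ∧ C.b j < T := by
  obtain ⟨ℓ, c, -, -, hw⟩ := hC.job j hj ha
  exact ⟨hw.le, hw.right.lt⟩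

/-- The active jobs satisfy Hall's condition. -/
theorem Conf.Valid.card_le (hy : y ∈ schedLasserre S T r) (hC : C.Valid y h Q)
    (hQ : ∀ j ℓ, Q j ℓ → ℓ ≤ r) (s e : ℕ) :
    ((Finset.range S.n).filter fun j => C.act j ∧ s ≤ C.a j ∧ C.b j < e).card ≤
      S.m * (e - s) := by
  induction hd : e - s using Nat.strong_induction_on generalizing s e with
  | _ d ih =>
    rcases Finset.eq_empty_or_nonempty
      ((Finset.range S.n).filter fun j => C.act j ∧ s ≤ C.a j ∧ C.b j < e) with h0 | ⟨j0, hj0⟩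
    · rw [h0]; simp
    simp only [Finset.mem_filter, Finset.mem_range] at hj0
    obtain ⟨hj0n, hj0a, hj0s, hj0e⟩ := hj0
    have hle := (hC.le hj0n hj0a).1
    have hpos : 0 < 2 ^ h := Nat.two_pow_pos h
    -- Inside one block all active jobs carry the same code, so a single conditioned solution gives
    -- the bound. A longer interval is cut at the end of the first block, which no active window
    -- crosses.
    by_cases hmid : e ≤ (s / 2 ^ h + 1) * 2 ^ h
    · have hblk : ∀ j < S.n, C.act j → s ≤ C.a j → C.b j < e → C.a j / 2 ^ h = s / 2 ^ h := by
        intro j hj hja hs he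
        have h1 := (hC.le hj hja).1
        refine le_antisymm (Nat.lt_succ_iff.1 ((Nat.div_lt_iff_lt_mul hpos).2 ?_))
          (Nat.div_le_div_right hs)
        exact lt_of_lt_of_le (by omega) hmid
      obtain ⟨ℓ, c, hQ0, hc, hw⟩ := hC.job j0 hj0n hj0a
      have hcr := hQ _ _ hQ0
      rw [← hd]
      refine card_le_of_supp hy (hc.choose_spec.2.2.2.1.trans hcr) hc.choose_spec.2.2.2.2 _ s e
        fun j hj => ?_
      simp only [Finset.mem_filter, Finset.mem_range] at hj
      obtain ⟨hjn, hja, hjs, hje⟩ := hj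
      refine ⟨hjn, fun t ht => ?_⟩
      obtain ⟨ℓ', c', -, hc', hw'⟩ := hC.job j hjn hja
      have hcb := hC.code j hjn j0 hj0n hja hj0a
        ((hblk j hjn hja hjs hje).trans (hblk j0 hj0n hj0a hj0s hj0e).symm)
      rw [hcb] at hc'
      rw [hc.unique hc'] at ht
      have := hw'.mem t ht
      omega
    · push Not at hmid
      have hs : s < (s / 2 ^ h + 1) * 2 ^ h := by
        have := Nat.lt_mul_div_succ s hpos
        rwa [mul_comm] at this
      have h1 := ih _ (by omega) s ((s / 2 ^ h + 1) * 2 ^ h) rfl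
      have h2 := ih _ (by omega) ((s / 2 ^ h + 1) * 2 ^ h) e rfl
      refine (Finset.card_le_card (t := _ ∪ _) ?_).trans
        ((Finset.card_union_le _ _).trans ((Nat.add_le_add h1 h2).trans ?_))
      · intro j hj
        simp only [Finset.mem_filter, Finset.mem_range, Finset.mem_union] at hj ⊢
        obtain ⟨hjn, hja, hjs, hje⟩ := hj
        rcases lt_or_ge (C.a j) ((s / 2 ^ h + 1) * 2 ^ h) with hlt | hge
        · refine Or.inl ⟨hjn, hja, hjs, ?_⟩
          have := (Nat.div_lt_iff_lt_mul hpos).2 hlt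
          rw [hC.block j hjn hja] at this
          exact (Nat.div_lt_iff_lt_mul hpos).1 this
        · exact Or.inr ⟨hjn, hja, hge, hje⟩
      · rw [← hd, ← mul_add]
        exact Nat.mul_le_mul_left _ (by omega)

/-- The jobs that make the configuration violate the condition at job `j`. -/
noncomputable def Conf.late (S : SchedInstance) (C : Conf) (f j : ℕ) : Finset ℕ :=
  (Finset.range S.n).filter fun i =>
    C.act i ∧ (i = j ∨ Pr S i j) ∧ C.a j / 2 ^ f < C.b i / 2 ^ f

/-- The number of blocks of length `2 ^ f` between the ends of the window of job `i`. -/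
def Conf.width (C : Conf) (f i : ℕ) : ℕ := C.b i / 2 ^ f - C.a i / 2 ^ f

/-- The total width of the windows in the block of job `j`. -/
noncomputable def Conf.pot (n : ℕ) (C : Conf) (h f j : ℕ) : ℕ :=
  ∑ i ∈ (Finset.range n).filter fun i => C.act i ∧ C.a i / 2 ^ h = C.a j / 2 ^ h, C.width f i

/-- The total width of all windows. -/
noncomputable def Conf.totalPot (n : ℕ) (C : Conf) (f : ℕ) : ℕ :=
  ∑ i ∈ (Finset.range n).filter fun i => C.act i, C.width f i

/-- The block of job `js` is conditioned on job `js` being at the left end of its window. -/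
structure Conf.Step (S : SchedInstance) (T : ℕ) (yR : ℕ → ℝ) (C C' : Conf) (h js : ℕ) :
    Prop where
  act : C'.act = C.act
  H : C'.H = C.H
  lo : C'.lo = C.lo
  hi : C'.hi = C.hi
  key : C'.key = C.key
  out : ∀ j < S.n, C.act j → C.a j / 2 ^ h ≠ C.a js / 2 ^ h →
    C'.cb j = C.cb j ∧ C'.a j = C.a j ∧ C'.b j = C.b j
  cb : ∀ j < S.n, C.act j → C.a j / 2 ^ h = C.a js / 2 ^ h →
    C'.cb j = (C.cb js + (js * T + C.a js + 1)) * setBase S.n T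
  reads : ∀ j < S.n, C.act j → C.a j / 2 ^ h = C.a js / 2 ^ h →
    Reads yR T (C'.cb j + j * T) (C'.a j) (C'.b j)

/-- A late job satisfies `a i ≤ a j < b i`, and its window stays in one block, so it is the block of
`j`. The strict inequality of pieces makes its width positive. -/
theorem Conf.Valid.late_block (hC : C.Valid y h Q) {f i j : ℕ} (hi : i ∈ C.late S f j)
    (hj : j < S.n) (ha : C.act j) :
    i < S.n ∧ C.act i ∧ C.a i / 2 ^ h = C.a j / 2 ^ h ∧ 0 < C.width f i := by
  simp only [Conf.late, Finset.mem_filter, Finset.mem_range] at hi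
  obtain ⟨hin, hia, hor, hlt⟩ := hi
  have hle : C.a i ≤ C.a j := by
    rcases hor with rfl | hp
    · exact le_rfl
    · exact (hC.lt i hin j hj hia ha hp).1.le
  have hlt' : C.a j < C.b i := by
    by_contra hge
    exact absurd (Nat.div_le_div_right (c := 2 ^ f) (not_lt.1 hge)) (not_le.2 hlt)
  refine ⟨hin, hia, le_antisymm (Nat.div_le_div_right hle) ?_, ?_⟩
  · rw [hC.block i hin hia]
    exact Nat.div_le_div_right hlt'.le
  · have := Nat.div_le_div_right (c := 2 ^ f) hle
    unfold Conf.width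
    omega

/-- Once `js` is fixed at its first slot, its window and those of its predecessors end there at the
latest. Each late window ended in a later piece, so its width drops by at least one. The drop of at
least `θ` in the block pays for the additional variable in `θ * ℓ + pot ≤ θ * Λ`. -/
theorem Conf.Valid.step (hy : y ∈ schedLasserre S T r) (hT : IsTable y yR r)
    {θ Λ f js : ℕ} (hθ : 0 < θ) (hΛ : Λ ≤ r)
    (hC : C.Valid y h fun j ℓ => θ * ℓ + C.pot S.n h f j ≤ θ * Λ)
    (hjs : js < S.n) (ha : C.act js) (hv : θ ≤ (C.late S f js).card)
    (hst : C.Step S T yR C' h js) :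
    (C'.Valid y h fun j ℓ => θ * ℓ + C'.pot S.n h f j ≤ θ * Λ) ∧
      C'.totalPot S.n f + θ ≤ C.totalPot S.n f ∧
      ∀ j < S.n, C.act j → C.a j ≤ C'.a j ∧ C'.b j ≤ C.b j := by
  obtain ⟨ℓ, c, hQ, hc, hw⟩ := hC.job js hjs ha
  obtain ⟨hjs', hat, hc'⟩ := hc.append hw.left
  set c' := insert (LPVar.slot ⟨js, hjs'⟩ ⟨C.a js, hat⟩) c with hc'def
  have hpot : θ ≤ C.pot S.n h f js := by
    refine hv.trans ?_
    rw [Finset.card_eq_sum_ones]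
    refine (Finset.sum_le_sum (g := C.width f) fun i hi =>
      (hC.late_block hi hjs ha).2.2.2).trans (Finset.sum_le_sum_of_subset fun i hi => ?_)
    obtain ⟨h1, h2, h3, -⟩ := hC.late_block hi hjs ha
    simp [h1, h2, h3]
  -- The late jobs alone contribute `θ` to the potential, so there is room for one more variable.
  have hℓ : ℓ + 1 ≤ Λ := by
    have : θ * (ℓ + 1) ≤ θ * Λ := by rw [mul_add, mul_one]; omega
    exact Nat.le_of_mul_le_mul_left this hθ
  have hcard : c.card < r := lt_of_le_of_lt hc.choose_spec.2.2.2.1 (by omega)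
  -- the windows after the step
  have hwin : ∀ j < S.n, C.act j → C.a j / 2 ^ h = C.a js / 2 ^ h →
      IsWindow y c' j (C'.a j) (C'.b j) ∧ IsWindow y c j (C.a j) (C.b j) := by
    intro j hj hja hb
    have hr := hst.reads j hj hja hb
    rw [hst.cb j hj hja hb] at hr
    refine ⟨hr.isWindow hy hT hc' (by omega) hj, ?_⟩
    obtain ⟨ℓ2, c2, -, hc2, hw2⟩ := hC.job j hj hja
    rw [hC.code j hj js hjs hja ha hb] at hc2
    rwa [hc.unique hc2]
  have hsub : ∀ j < S.n, C.act j → C.a j ≤ C'.a j ∧ C'.b j ≤ C.b j := by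
    intro j hj hja
    by_cases hb : C.a j / 2 ^ h = C.a js / 2 ^ h
    · obtain ⟨h1, h2⟩ := hwin j hj hja hb
      exact ⟨(h2.mem _ (h1.left.of_insert hy hcard)).1, (h2.mem _ (h1.right.of_insert hy hcard)).2⟩
    · obtain ⟨-, h2, h3⟩ := hst.out j hj hja hb
      omega
  have hle' : ∀ j < S.n, C.act j → C'.a j ≤ C'.b j := by
    intro j hj hja
    by_cases hb : C.a j / 2 ^ h = C.a js / 2 ^ h
    · exact (hwin j hj hja hb).1.le
    · obtain ⟨-, h2, h3⟩ := hst.out j hj hja hb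
      rw [h2, h3]
      exact (hC.le hj hja).1
  have hblk : ∀ j < S.n, C.act j → C'.a j / 2 ^ h = C.a j / 2 ^ h ∧
      C'.b j / 2 ^ h = C.a j / 2 ^ h := by
    intro j hj hja
    obtain ⟨h1, h2⟩ := hsub j hj hja
    have h3 := hle' j hj hja
    have h4 := hC.block j hj hja
    have g1 := Nat.div_le_div_right (c := 2 ^ h) h1
    have g2 := Nat.div_le_div_right (c := 2 ^ h) h2
    have g3 := Nat.div_le_div_right (c := 2 ^ h) h3
    omega
  -- All widths are monotone; for late jobs the right end now lies in the piece of `a js` or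
  -- earlier.
  have hwid : ∀ i < S.n, C.act i →
      C'.width f i + (if i ∈ C.late S f js then 1 else 0) ≤ C.width f i := by
    intro i hi hia
    obtain ⟨h1, h2⟩ := hsub i hi hia
    have g1 := Nat.div_le_div_right (c := 2 ^ f) h1
    have g2 := Nat.div_le_div_right (c := 2 ^ f) h2
    have g3 := Nat.div_le_div_right (c := 2 ^ f) (hle' i hi hia)
    unfold Conf.width
    split_ifs with hl
    · obtain ⟨-, -, hb, -⟩ := hC.late_block hl hjs ha
      have hjw := (hwin js hjs ha rfl).1
      have hbj : C'.b js = C.a js := hjw.right.eq_of_insert hy hcard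
      simp only [Conf.late, Finset.mem_filter, Finset.mem_range] at hl
      have : C'.b i ≤ C.a js := by
        rcases hl.2.2.1 with rfl | hp
        · exact hbj.le
        · rw [← hbj]
          exact (IsWindow.lt_of_pr hy (hc'.choose_spec.2.2.2.1.trans (by omega)) hp
            (hwin i hi hia hb).1 hjw).2.le
      have g4 := Nat.div_le_div_right (c := 2 ^ f) this
      omega
    · omega
  have hsum : ∀ A : Finset ℕ, (∀ i ∈ A, i < S.n ∧ C.act i) →
      ∑ i ∈ A, C'.width f i + (A ∩ C.late S f js).card ≤ ∑ i ∈ A, C.width f i := by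
    intro A hA
    rw [← Finset.filter_mem_eq_inter, Finset.card_filter, ← Finset.sum_add_distrib]
    exact Finset.sum_le_sum fun i hi => hwid i (hA i hi).1 (hA i hi).2
  have hset : ∀ j < S.n, C.act j →
      ((Finset.range S.n).filter fun i => C'.act i ∧ C'.a i / 2 ^ h = C'.a j / 2 ^ h) =
        (Finset.range S.n).filter fun i => C.act i ∧ C.a i / 2 ^ h = C.a j / 2 ^ h := by
    intro j hj hja
    refine Finset.filter_congr fun i hi => ?_
    rw [hst.act]
    refine and_congr_right fun hia => ?_
    rw [(hblk i (Finset.mem_range.1 hi) hia).1, (hblk j hj hja).1]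
  refine ⟨⟨fun j hj hja => ?_, fun i hi j hj hia hja hb => ?_, fun j hj hja => ?_,
    fun i hi j hj hia hja hp => ?_⟩, ?_, hsub⟩
  · rw [hst.act] at hja
    have hs := hsum ((Finset.range S.n).filter fun i => C.act i ∧ C.a i / 2 ^ h = C.a j / 2 ^ h)
      (fun i hi => by simp only [Finset.mem_filter, Finset.mem_range] at hi; exact ⟨hi.1, hi.2.1⟩)
    by_cases hb : C.a j / 2 ^ h = C.a js / 2 ^ h
    · refine ⟨ℓ + 1, c', ?_, by rw [hst.cb j hj hja hb]; exact hc', (hwin j hj hja hb).1⟩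
      have hin : C.late S f js ⊆
          (Finset.range S.n).filter fun i => C.act i ∧ C.a i / 2 ^ h = C.a j / 2 ^ h := fun i hi => by
        obtain ⟨h1, h2, h3, -⟩ := hC.late_block hi hjs ha
        simp [h1, h2, h3, hb]
      rw [Finset.inter_eq_right.2 hin] at hs
      unfold Conf.pot at hQ ⊢
      rw [hset j hj hja, mul_add, mul_one]
      rw [hb] at hs ⊢
      omega
    · obtain ⟨ℓ2, c2, hQ2, hc2, hw2⟩ := hC.job j hj hja
      obtain ⟨g1, g2, g3⟩ := hst.out j hj hja hb
      refine ⟨ℓ2, c2, ?_, by rw [g1]; exact hc2, by rw [g2, g3]; exact hw2⟩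
      unfold Conf.pot at hQ2 ⊢
      rw [hset j hj hja]
      omega
  · rw [hst.act] at hia hja
    rw [(hblk i hi hia).1, (hblk j hj hja).1] at hb
    by_cases hbj : C.a j / 2 ^ h = C.a js / 2 ^ h
    · rw [hst.cb j hj hja hbj, hst.cb i hi hia (hb.trans hbj)]
    · rw [(hst.out j hj hja hbj).1, (hst.out i hi hia fun e => hbj (hb.symm.trans e)).1]
      exact hC.code i hi j hj hia hja hb
  · rw [hst.act] at hja
    obtain ⟨h1, h2⟩ := hblk j hj hja
    rw [h1, h2]
  · rw [hst.act] at hia hja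
    obtain ⟨h1, h2⟩ := hC.lt i hi j hj hia hja hp
    by_cases hb : C.a i / 2 ^ h = C.a j / 2 ^ h
    · by_cases hbj : C.a j / 2 ^ h = C.a js / 2 ^ h
      · exact IsWindow.lt_of_pr hy (hc'.choose_spec.2.2.2.1.trans (by omega)) hp
          (hwin i hi hia (hb.trans hbj)).1 (hwin j hj hja hbj).1
      · rw [(hst.out j hj hja hbj).2.1, (hst.out j hj hja hbj).2.2,
          (hst.out i hi hia fun e => hbj (hb.symm.trans e)).2.1,
          (hst.out i hi hia fun e => hbj (hb.symm.trans e)).2.2]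
        exact ⟨h1, h2⟩
    -- In different blocks the order is inherited from the blocks, which the shrunken windows do not
    -- leave.
    · have hlt : C.a i / 2 ^ h < C.a j / 2 ^ h :=
        lt_of_le_of_ne (Nat.div_le_div_right h1.le) hb
      obtain ⟨e1, e2⟩ := hblk i hi hia
      obtain ⟨e3, e4⟩ := hblk j hj hja
      constructor
      · by_contra hge
        have := Nat.div_le_div_right (c := 2 ^ h) (not_lt.1 hge)
        omega
      · by_contra hge
        have := Nat.div_le_div_right (c := 2 ^ h) (not_lt.1 hge)
        omega
  · have hs := hsum ((Finset.range S.n).filter fun i => C.act i)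
      (fun i hi => by simpa using hi)
    have hin : C.late S f js ⊆ (Finset.range S.n).filter fun i => C.act i := fun i hi => by
      obtain ⟨h1, h2, -, -⟩ := hC.late_block hi hjs ha
      simp [h1, h2]
    rw [Finset.inter_eq_right.2 hin] at hs
    unfold Conf.totalPot
    rw [hst.act]
    omega

end Pass

end SchedRounding

/-! ### Removal of jobs and the stages they form -/

namespace SchedRounding

section Stages
open scoped Classical

variable {S : SchedInstance} {T r : ℕ} {y : Finset (LPVar S.n T) → ℝ} {yR : ℕ → ℝ}
variable {C C' : Conf} {Q Q' : ℕ → ℕ → Prop} {q P k K h h1 : ℕ}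

/-- An established stage survives the rest of the pass: its own class only loses jobs, and the
intervals of lower jobs only shrink. -/
theorem GreedyInput.Stage.mono {G G' : GreedyInput} {L kk θ : ℕ} {a b : ℕ → ℕ} {bot : ℕ → Prop}
    {blk : ℕ → ℕ} (hS : G.Stage h L kk θ a b bot blk) (hn : G'.n = G.n) (hm : G'.m = G.m)
    (hpr : G'.pr = G.pr)
    (heq : ∀ j < G.n, G'.H j = h →
      G.H j = h ∧ G'.key j = G.key j ∧ G'.lo j = G.lo j ∧ G'.hi j = G.hi j)
    (hlow : ∀ j < G.n, G'.H j < h → G.H j < h ∧ G.lo j ≤ G'.lo j ∧ G'.hi j ≤ G.hi j) :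
    G'.Stage h L kk θ a b bot blk := by
  refine ⟨fun j hj hh => ?_, fun j hj hh => ?_, fun j hj hh => ?_, fun j hj hh => ?_,
    fun j hj hh => ?_, fun i hi hh hlt => ?_, fun u v huv => ?_, fun i hi j hj hh hh' hp => ?_,
    fun i hi j hj hh hh' hp => ?_, fun i hi j hj hh hh' hp => ?_, fun j hj hh => ?_⟩
  all_goals rw [hn] at *
  · obtain ⟨h1, h2, h3, h4⟩ := heq j hj hh
    rw [h2, hS.key_eq j hj h1]
  · obtain ⟨h1, h2, h3, h4⟩ := heq j hj hh
    rw [h3, hS.lo_eq j hj h1]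
  · obtain ⟨h1, h2, h3, h4⟩ := heq j hj hh
    rw [h4, hS.hi_eq j hj h1]
  · exact hS.cross j hj (heq j hj hh).1
  · exact hS.right_lt j hj (heq j hj hh).1
  · obtain ⟨h1, h2, h3⟩ := hlow i hi hh
    obtain ⟨g1, g2, g3⟩ := hS.low i hi h1 (by omega)
    exact ⟨g1, g2.trans h2, h3.trans g3⟩
  · rw [hm]
    refine le_trans (Nat.add_le_add_right (Finset.card_le_card fun j hj => ?_) _) (hS.hall u v huv)
    simp only [Finset.mem_filter, Finset.mem_range] at hj ⊢
    exact ⟨hj.1, (heq j hj.1 hj.2.1).1, hj.2.2⟩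
  · rw [hpr] at hp
    exact hS.top_top i hi j hj (heq i hi hh).1 (heq j hj hh').1 hp
  · rw [hpr] at hp
    exact hS.bot_top i hi j hj hh (heq j hj hh').1 hp
  · rw [hpr] at hp
    exact hS.top_bot i hi j hj hh (heq j hj hh').1 hp
  · refine (Finset.card_le_card fun i hi => ?_).trans (hS.count j hj (heq j hj hh).1)
    simp only [Finset.mem_filter, Finset.mem_range] at hi ⊢
    rw [hpr] at hi
    exact ⟨hi.1, (heq i hi.1 hi.2.1).1, hi.2.2⟩

/-- The greedy placement that results if no more jobs are removed. -/
noncomputable def Conf.toGreedy (S : SchedInstance) (C : Conf) : GreedyInput where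
  n := S.n
  m := S.m
  pr := Pr S
  H j := if C.act j then 0 else C.H j
  key j := if C.act j then C.b j else C.key j
  lo j := if C.act j then C.a j else C.lo j
  hi j := if C.act j then C.b j + 1 else C.hi j

/-- The facts about the jobs that have been removed before the level `h`. -/
structure Conf.Rest (S : SchedInstance) (T : ℕ) (C : Conf) (q P k h : ℕ) : Prop where
  height : ∀ j < S.n, ¬ C.act j →
    C.H j = S.n ∨ h < C.H j ∧ C.H j ≤ q ∧ C.hi j ≤ T ∧ C.key j < T
  stage : ∀ h', h < h' → h' ≤ q →
    (∃ L kk θ a b bot blk, (C.toGreedy S).Stage h' L kk θ a b bot blk ∧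
      2 ^ k * (2 * S.m * L * ((T - 1) / L / kk) + S.m * θ * ((T - 1) / L)) ≤ 3 * S.m * T ∧
      0 < L ∧ 0 < kk) ∨
    ∀ j < S.n, ¬ C.act j → C.H j ≠ h'
  -- The account of the jobs given up, of height `S.n`, against those assigned to stages. Every
  -- stage adds at most one term `S.m * T` and lowers the level, so at level `0` these terms sum to
  -- at most `q * (S.m * T)`.
  mid : q * P * ((Finset.range S.n).filter fun j => ¬ C.act j ∧ C.H j = S.n).card ≤
    q * ((Finset.range S.n).filter fun j => ¬ C.act j ∧ C.H j ≠ S.n).card + (q - h) * (S.m * T)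

theorem Conf.Rest.shrink (hR : C.Rest S T q P k h) (hact : C'.act = C.act) (hH : C'.H = C.H)
    (hlo : C'.lo = C.lo) (hhi : C'.hi = C.hi) (hkey : C'.key = C.key)
    (hsub : ∀ j < S.n, C.act j → C.a j ≤ C'.a j ∧ C'.b j ≤ C.b j) : C'.Rest S T q P k h := by
  refine ⟨?_, ?_, ?_⟩
  · rw [hact, hH, hhi, hkey]; exact hR.height
  · rw [hact, hH]
    intro h' hh hq
    refine (hR.stage h' hh hq).imp_left ?_
    rintro ⟨L, kk, θ, a, b, bot, blk, hS, hrest⟩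
    refine ⟨L, kk, θ, a, b, bot, blk, hS.mono rfl rfl rfl (fun j hj => ?_) (fun j hj => ?_), hrest⟩
    all_goals
      change j < S.n at hj
      have := hsub j hj
      simp only [Conf.toGreedy, hact, hH, hlo, hhi, hkey]
      split_ifs with ha
    · omega
    · exact fun h => ⟨h, rfl, rfl, rfl⟩
    · have := this ha
      omega
    · exact fun h => ⟨h, le_rfl, le_rfl⟩
  · rw [hact, hH]; exact hR.mid

/-- The active jobs whose windows meet two blocks of length `L2` are removed and get height `h`,
the other ones whose windows meet two blocks of length `L` are given up. -/
structure Conf.Remove (n : ℕ) (C C' : Conf) (h L L2 : ℕ) : Prop where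
  a : C'.a = C.a
  b : C'.b = C.b
  cb : C'.cb = C.cb
  inactive : ∀ j < n, ¬ C.act j → ¬ C'.act j ∧ C'.H j = C.H j ∧ C'.lo j = C.lo j ∧
    C'.hi j = C.hi j ∧ C'.key j = C.key j
  top : ∀ j < n, C.act j → C.a j / L2 ≠ C.b j / L2 → ¬ C'.act j ∧ C'.H j = h ∧
    C'.lo j = (C.a j / L + 1) * L ∧ C'.hi j = C.b j / L * L ∧ C'.key j = C.b j
  mid : ∀ j < n, C.act j → C.a j / L2 = C.b j / L2 → C.a j / L ≠ C.b j / L →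
    ¬ C'.act j ∧ C'.H j = n
  keep : ∀ j < n, C.act j → C.a j / L2 = C.b j / L2 → C.a j / L = C.b j / L → C'.act j

theorem Conf.Remove.of_act {n L L2 j : ℕ} (hr : Conf.Remove n C C' h L L2) (hj : j < n)
    (ha : C'.act j) : C.act j ∧ C.a j / L2 = C.b j / L2 ∧ C.a j / L = C.b j / L := by
  by_cases h1 : C.act j
  · by_cases h2 : C.a j / L2 = C.b j / L2
    · by_cases h3 : C.a j / L = C.b j / L
      · exact ⟨h1, h2, h3⟩
      · exact absurd ha (hr.mid j hj h1 h2 h3).1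
    · exact absurd ha (hr.top j hj h1 h2).1
  · exact absurd ha (hr.inactive j hj h1).1

theorem Conf.Valid.remove {L2 : ℕ} (hC : C.Valid y h Q) (hle : h1 ≤ h)
    (hr : Conf.Remove S.n C C' h (2 ^ h1) L2)
    (hQ : ∀ j < S.n, C'.act j → ∀ ℓ, Q j ℓ → Q' j ℓ) : C'.Valid y h1 Q' := by
  have hdvd : (2 : ℕ) ^ h1 ∣ 2 ^ h := pow_dvd_pow 2 hle
  refine ⟨fun j hj ha => ?_, fun i hi j hj hia hja hb => ?_, fun j hj ha => ?_,
    fun i hi j hj hia hja => ?_⟩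
  · obtain ⟨ℓ, c, h1, h2, h3⟩ := hC.job j hj (hr.of_act hj ha).1
    rw [hr.cb, hr.a, hr.b]
    exact ⟨ℓ, c, hQ j hj ha ℓ h1, h2, h3⟩
  · rw [hr.a] at hb
    rw [hr.cb]
    refine hC.code i hi j hj (hr.of_act hi hia).1 (hr.of_act hj hja).1 ?_
    obtain ⟨d, hd⟩ := hdvd
    rw [hd, ← Nat.div_div_eq_div_mul, ← Nat.div_div_eq_div_mul, hb]
  · rw [hr.a, hr.b]
    exact (hr.of_act hj ha).2.2
  · rw [hr.a, hr.b]
    exact hC.lt i hi j hj (hr.of_act hi hia).1 (hr.of_act hj hja).1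

/-- The number of active jobs whose windows meet two blocks of length `2 ^ x`. -/
noncomputable def Conf.cross (n : ℕ) (C : Conf) (x : ℕ) : ℕ :=
  ((Finset.range n).filter fun j => C.act j ∧ C.a j / 2 ^ x ≠ C.b j / 2 ^ x).card

theorem div_pow_congr {a b x z : ℕ} (hxz : x ≤ z) (h : a / 2 ^ x = b / 2 ^ x) :
    a / 2 ^ z = b / 2 ^ z := by
  obtain ⟨d, hd⟩ := pow_dvd_pow 2 hxz
  rw [hd, ← Nat.div_div_eq_div_mul, ← Nat.div_div_eq_div_mul, h]

/-- The new stage. -/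
theorem Conf.Valid.stage (hy : y ∈ schedLasserre S T r) (hTn : T < S.n) (hC : C.Valid y h Q)
    (hQ : ∀ j ℓ, Q j ℓ → ℓ ≤ r) (h0 : 0 < h) (hhn : h < S.n) {f θ : ℕ}
    (hf : f ≤ h1) (hheight : ∀ j < S.n, ¬ C.act j → C.H j = S.n ∨ h < C.H j)
    (hr : Conf.Remove S.n C C' h (2 ^ h1) (2 ^ (h1 + k)))
    (hlate : ∀ j < S.n, C.act j → (C.late S f j).card ≤ θ) :
    (C'.toGreedy S).Stage h (2 ^ h1) (2 ^ k) θ C.a C.b (fun i => C'.act i)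
      (fun i => C.a i / 2 ^ h1) := by
  have hL : 0 < 2 ^ h1 := Nat.two_pow_pos h1
  -- the jobs of height h
  have htop : ∀ j < S.n, (C'.toGreedy S).H j = h →
      ¬ C'.act j ∧ C.act j ∧ C.a j / 2 ^ (h1 + k) ≠ C.b j / 2 ^ (h1 + k) := by
    intro j hj hh
    simp only [Conf.toGreedy] at hh
    split_ifs at hh with ha
    · omega
    · by_cases g1 : C.act j
      · refine ⟨ha, g1, fun g2 => ?_⟩
        by_cases g3 : C.a j / 2 ^ h1 = C.b j / 2 ^ h1
        · exact ha (hr.keep j hj g1 g2 g3)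
        · have := (hr.mid j hj g1 g2 g3).2
          omega
      · have := hheight j hj g1
        have g2 := (hr.inactive j hj g1).2.1
        omega
  refine ⟨fun j hj hh => ?_, fun j hj hh => ?_, fun j hj hh => ?_, fun j hj hh => ?_,
    fun j hj hh => ?_, fun i hi hh hlt => ?_, fun u v huv => ?_, fun i hi j hj hh hh' hp => ?_,
    fun i hi j hj hh hh' hp => ?_, fun i hi j hj hh hh' hp => ?_, fun j hj hh => ?_⟩
  all_goals first | change j < S.n at hj | skip
  all_goals first | change i < S.n at hi | skip
  · obtain ⟨g1, g2, g3⟩ := htop j hj hh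
    simp only [Conf.toGreedy, if_neg g1]
    exact (hr.top j hj g2 g3).2.2.2.2
  · obtain ⟨g1, g2, g3⟩ := htop j hj hh
    simp only [Conf.toGreedy, if_neg g1]
    exact (hr.top j hj g2 g3).2.2.1
  · obtain ⟨g1, g2, g3⟩ := htop j hj hh
    simp only [Conf.toGreedy, if_neg g1]
    exact (hr.top j hj g2 g3).2.2.2.1
  · obtain ⟨g1, g2, g3⟩ := htop j hj hh
    rw [Nat.div_div_eq_div_mul, Nat.div_div_eq_div_mul, ← pow_add]
    exact lt_of_le_of_ne (Nat.div_le_div_right (hC.le hj g2).1) g3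
  · exact ((hC.le hj (htop j hj hh).2.1).2).trans hTn
  · have ha : C'.act i := by
      by_contra ha
      simp only [Conf.toGreedy, if_neg ha] at hh
      by_cases g1 : C.act i
      · by_cases g2 : C.a i / 2 ^ (h1 + k) = C.b i / 2 ^ (h1 + k)
        · by_cases g3 : C.a i / 2 ^ h1 = C.b i / 2 ^ h1
          · exact ha (hr.keep i hi g1 g2 g3)
          · have := (hr.mid i hi g1 g2 g3).2
            omega
        · have := (hr.top i hi g1 g2).2.1
          omega
      · have := hheight i hi g1
        have h2 := (hr.inactive i hi g1).2.1
        omega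
    simp only [Conf.toGreedy, if_pos ha, hr.a, hr.b]
    refine ⟨ha, Nat.div_mul_le_self _ _, ?_⟩
    rw [(hr.of_act hi ha).2.2]
    have := Nat.lt_mul_div_succ (C.b i) hL
    rw [mul_comm] at this
    exact this
  · have hall := hC.card_le hy hQ (u * 2 ^ h1) ((v + 1) * 2 ^ h1)
    rw [← Nat.sub_mul, show v + 1 - u = v - u + 1 by omega] at hall
    refine le_trans ?_ hall
    have hmem : ∀ j, C.act j → u ≤ C.a j / 2 ^ h1 → C.b j / 2 ^ h1 ≤ v →
        C.act j ∧ u * 2 ^ h1 ≤ C.a j ∧ C.b j < (v + 1) * 2 ^ h1 := fun j ha hu hv =>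
      ⟨ha, (Nat.le_div_iff_mul_le hL).1 hu, (Nat.div_lt_iff_lt_mul hL).1 (by omega)⟩
    rw [← Finset.card_union_of_disjoint]
    · refine Finset.card_le_card fun j hj => ?_
      simp only [Finset.mem_union, Finset.mem_filter, Finset.mem_range] at hj ⊢
      rcases hj with ⟨hj, hh, hu, hv⟩ | ⟨hj, ha, hu, hv⟩
      · exact ⟨hj, hmem j (htop j hj hh).2.1 hu hv⟩
      · obtain ⟨g1, -, g3⟩ := hr.of_act hj ha
        exact ⟨hj, hmem j g1 hu (by rw [← g3]; exact hv)⟩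
    · rw [Finset.disjoint_left]
      intro j hj hj'
      simp only [Finset.mem_filter, Finset.mem_range] at hj hj'
      exact (htop j hj.1 hj.2.1).1 hj'.2.1
  · exact hC.lt i hi j hj (htop i hi hh).2.1 (htop j hj hh').2.1 hp
  · exact Nat.div_le_div_right
      (hC.lt i hi j hj (hr.of_act hi hh).1 (htop j hj hh').2.1 hp).1.le
  · simp only [(hr.of_act hi hh).2.2]
    exact Nat.div_le_div_right
      (hC.lt j hj i hi (htop j hj hh').2.1 (hr.of_act hi hh).1 hp).2.le
  -- Blocks of length `2 ^ h1` are unions of pieces of length `2 ^ f`, so predecessors that reach a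
  -- later block are late.
  · refine (Finset.card_le_card fun i hi => ?_).trans (hlate j hj (htop j hj hh).2.1)
    simp only [Finset.mem_filter, Conf.late] at hi ⊢
    obtain ⟨hi1, hi2, hi3, hi4⟩ := hi
    refine ⟨hi1, (htop i (Finset.mem_range.1 hi1) hi2).2.1, Or.inr hi3, ?_⟩
    refine lt_of_le_of_ne (Nat.div_le_div_right ?_) fun e => hi4.ne (div_pow_congr hf e)
    by_contra hlt
    exact absurd (Nat.div_le_div_right (c := 2 ^ h1) (not_le.1 hlt).le) (not_le.2 hi4)

end Stages

end SchedRounding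

/-! ### The loss per stage and the budget of conditionings -/

namespace SchedRounding

section Budget
open scoped Classical

variable {S : SchedInstance} {T r : ℕ} {y : Finset (LPVar S.n T) → ℝ} {yR : ℕ → ℝ}
variable {C C' : Conf} {Q Q' : ℕ → ℕ → Prop} {q P k K h h1 : ℕ}

/-- The factor `2 ^ k` is absorbed twice: by the division by `kk = 2 ^ k` in the boundary term and
by `2 ^ k * θ ≤ 2 ^ h1` in the gap term. For `h ≤ K + k` the latter holds or is vacuous, as `θ = 0`.
-/
theorem two_pow_mul_stage_le {m θ : ℕ} (hK : h ≤ h1 + K) (hθ : θ + 1 = 2 ^ (h - (K + k))) :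
    2 ^ k * (2 * m * 2 ^ h1 * ((T - 1) / 2 ^ h1 / 2 ^ k) + m * θ * ((T - 1) / 2 ^ h1)) ≤
      3 * m * T := by
  have g1 : 2 ^ k * ((T - 1) / 2 ^ h1 / 2 ^ k) ≤ (T - 1) / 2 ^ h1 := Nat.mul_div_le _ _
  have g2 : 2 ^ h1 * ((T - 1) / 2 ^ h1) ≤ T := (Nat.mul_div_le _ _).trans (Nat.sub_le _ _)
  have g3 : 2 ^ k * θ ≤ 2 ^ h1 := by
    rcases le_or_gt (K + k) h with hl | hl
    · have : 2 ^ k * (θ + 1) ≤ 2 ^ h1 := by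
        rw [hθ, ← pow_add]
        exact Nat.pow_le_pow_right two_pos (by omega)
      exact (Nat.mul_le_mul_left _ (Nat.le_succ θ)).trans this
    · have : θ = 0 := by
        rw [Nat.sub_eq_zero_of_le hl.le, pow_zero] at hθ
        omega
      rw [this, mul_zero]
      exact Nat.zero_le _
  calc _ = 2 * m * 2 ^ h1 * (2 ^ k * ((T - 1) / 2 ^ h1 / 2 ^ k)) +
        m * (2 ^ k * θ) * ((T - 1) / 2 ^ h1) := by ring
    _ ≤ 2 * m * 2 ^ h1 * ((T - 1) / 2 ^ h1) + m * 2 ^ h1 * ((T - 1) / 2 ^ h1) := by gcongr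
    _ = 3 * m * (2 ^ h1 * ((T - 1) / 2 ^ h1)) := by ring
    _ ≤ _ := Nat.mul_le_mul_left _ g2

/-- Heights strictly between `h1` and `h` stay empty, height `h` gets the new stage, and higher
stages persist by monotonicity. The jobs given up are those crossing level `h1` but not level `h1 +
k`; `hcrit` charges them to the new stage. -/
theorem Conf.Rest.remove (hy : y ∈ schedLasserre S T r) (hTn : T < S.n) (hC : C.Valid y h Q)
    (hQ : ∀ j ℓ, Q j ℓ → ℓ ≤ r) (hR : C.Rest S T q P k h) (hhq : h ≤ q) (hqn : q < S.n)
    (hh1 : h1 < h) (hK : h ≤ h1 + K)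
    (hr : Conf.Remove S.n C C' h (2 ^ h1) (2 ^ (h1 + k)))
    (hlate : ∀ j < S.n, C.act j → (C.late S (h - K) j).card < 2 ^ (h - (K + k)))
    (hcrit : q * P * (C.cross S.n h1 - C.cross S.n (h1 + k)) ≤
      q * C.cross S.n (h1 + k) + S.m * T) : C'.Rest S T q P k h1 := by
  have hheight : ∀ j < S.n, ¬ C.act j → C.H j = S.n ∨ h < C.H j := fun j hj ha =>
    (hR.height j hj ha).imp_right fun h => h.1
  refine ⟨fun j hj ha => ?_, fun h' hh hq => ?_, ?_⟩
  · by_cases g1 : C.act j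
    · by_cases g2 : C.a j / 2 ^ (h1 + k) = C.b j / 2 ^ (h1 + k)
      · by_cases g3 : C.a j / 2 ^ h1 = C.b j / 2 ^ h1
        · exact absurd (hr.keep j hj g1 g2 g3) ha
        · exact Or.inl (hr.mid j hj g1 g2 g3).2
      · obtain ⟨-, e1, -, e2, e3⟩ := hr.top j hj g1 g2
        have := (hC.le hj g1).2
        have := Nat.div_mul_le_self (C.b j) (2 ^ h1)
        omega
    · obtain ⟨-, e1, e2, e3, e4⟩ := hr.inactive j hj g1
      rw [e1, e3, e4]
      have := hR.height j hj g1
      omega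
  · rcases lt_trichotomy h' h with hlt | rfl | hlt
    · refine Or.inr fun j hj ha => ?_
      by_cases g1 : C.act j
      · by_cases g2 : C.a j / 2 ^ (h1 + k) = C.b j / 2 ^ (h1 + k)
        · by_cases g3 : C.a j / 2 ^ h1 = C.b j / 2 ^ h1
          · exact absurd (hr.keep j hj g1 g2 g3) ha
          · rw [(hr.mid j hj g1 g2 g3).2]; omega
        · rw [(hr.top j hj g1 g2).2.1]; omega
      · rw [(hr.inactive j hj g1).2.1]
        have := hheight j hj g1
        omega
    · have hpos : 0 < 2 ^ (h' - (K + k)) := Nat.two_pow_pos _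
      refine Or.inl ⟨2 ^ h1, 2 ^ k, 2 ^ (h' - (K + k)) - 1, _, _, _, _,
        hC.stage hy hTn hQ (by omega) (by omega) (f := h' - K) (by omega) hheight hr
          fun j hj ha => Nat.le_sub_one_of_lt (hlate j hj ha),
        two_pow_mul_stage_le hK (Nat.sub_add_cancel hpos), Nat.two_pow_pos _, Nat.two_pow_pos _⟩
    · rcases hR.stage h' hlt hq with ⟨L, kk, θ, a, b, bot, blk, hS, hrest⟩ | hno
      · refine Or.inl ⟨L, kk, θ, a, b, bot, blk,
          hS.mono rfl rfl rfl (fun j hj => ?_) (fun j hj => ?_), hrest⟩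
        all_goals change j < S.n at hj
        · simp only [Conf.toGreedy]
          by_cases ha : C'.act j
          · rw [if_pos ha]; omega
          · rw [if_neg ha, if_neg ha, if_neg ha, if_neg ha]
            intro hH
            by_cases g1 : C.act j
            · exfalso
              by_cases g2 : C.a j / 2 ^ (h1 + k) = C.b j / 2 ^ (h1 + k)
              · by_cases g3 : C.a j / 2 ^ h1 = C.b j / 2 ^ h1
                · exact absurd (hr.keep j hj g1 g2 g3) ha
                · have := (hr.mid j hj g1 g2 g3).2; omega
              · have := (hr.top j hj g1 g2).2.1; omega
            · obtain ⟨-, e1, e2, e3, e4⟩ := hr.inactive j hj g1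
              simp only [if_neg g1]
              exact ⟨by rw [← e1, hH], e4, e2, e3⟩
        · simp only [Conf.toGreedy]
          by_cases ha : C'.act j
          · have g1 := (hr.of_act hj ha).1
            simp only [if_pos ha, if_pos g1, hr.a, hr.b]
            exact fun h => ⟨h, le_rfl, le_rfl⟩
          · simp only [if_neg ha]
            intro hH
            by_cases g1 : C.act j
            · simp only [if_pos g1]
              refine ⟨by omega, ?_⟩
              by_cases g2 : C.a j / 2 ^ (h1 + k) = C.b j / 2 ^ (h1 + k)
              · exfalso
                by_cases g3 : C.a j / 2 ^ h1 = C.b j / 2 ^ h1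
                · exact absurd (hr.keep j hj g1 g2 g3) ha
                · have := (hr.mid j hj g1 g2 g3).2; omega
              · obtain ⟨-, -, e1, e2, -⟩ := hr.top j hj g1 g2
                rw [e1, e2]
                have h3 := Nat.lt_mul_div_succ (C.a j) (Nat.two_pow_pos h1)
                rw [mul_comm] at h3
                exact ⟨h3.le, (Nat.div_mul_le_self _ _).trans (Nat.le_succ _)⟩
            · obtain ⟨-, e1, e2, e3, e4⟩ := hr.inactive j hj g1
              simp only [if_neg g1]
              omega
      · refine Or.inr fun j hj ha => ?_
        by_cases g1 : C.act j
        · by_cases g2 : C.a j / 2 ^ (h1 + k) = C.b j / 2 ^ (h1 + k)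
          · by_cases g3 : C.a j / 2 ^ h1 = C.b j / 2 ^ h1
            · exact absurd (hr.keep j hj g1 g2 g3) ha
            · rw [(hr.mid j hj g1 g2 g3).2]; omega
          · rw [(hr.top j hj g1 g2).2.1]; omega
        · rw [(hr.inactive j hj g1).2.1]
          exact hno j hj g1
  · have hmid : ((Finset.range S.n).filter fun j => ¬ C'.act j ∧ C'.H j = S.n).card ≤
        ((Finset.range S.n).filter fun j => ¬ C.act j ∧ C.H j = S.n).card +
          (C.cross S.n h1 - C.cross S.n (h1 + k)) := by
      unfold Conf.cross
      rw [← Finset.card_sdiff_of_subset fun j hj => ?_]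
      · refine (Finset.card_le_card fun j hj => ?_).trans (Finset.card_union_le _ _)
        simp only [Finset.mem_filter, Finset.mem_range, Finset.mem_union,
          Finset.mem_sdiff] at hj ⊢
        obtain ⟨hj, ha, hH⟩ := hj
        by_cases g1 : C.act j
        · by_cases g2 : C.a j / 2 ^ (h1 + k) = C.b j / 2 ^ (h1 + k)
          · by_cases g3 : C.a j / 2 ^ h1 = C.b j / 2 ^ h1
            · exact absurd (hr.keep j hj g1 g2 g3) ha
            · exact Or.inr ⟨⟨hj, g1, g3⟩, fun h => h.2.2 g2⟩
          · have := (hr.top j hj g1 g2).2.1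
            omega
        · rw [(hr.inactive j hj g1).2.1] at hH
          exact Or.inl ⟨hj, g1, hH⟩
      · simp only [Finset.mem_filter] at hj ⊢
        exact ⟨hj.1, hj.2.1, fun h => hj.2.2 (div_pow_congr (Nat.le_add_right _ _) h)⟩
    have htop : ((Finset.range S.n).filter fun j => ¬ C.act j ∧ C.H j ≠ S.n).card +
        C.cross S.n (h1 + k) ≤
        ((Finset.range S.n).filter fun j => ¬ C'.act j ∧ C'.H j ≠ S.n).card := by
      unfold Conf.cross
      rw [← Finset.card_union_of_disjoint]
      · refine Finset.card_le_card fun j hj => ?_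
        simp only [Finset.mem_union, Finset.mem_filter, Finset.mem_range] at hj ⊢
        rcases hj with ⟨hj, ha, hH⟩ | ⟨hj, ha, hx⟩
        · obtain ⟨e1, e2, -⟩ := hr.inactive j hj ha
          exact ⟨hj, e1, by rw [e2]; exact hH⟩
        · obtain ⟨e1, e2, -⟩ := hr.top j hj ha hx
          exact ⟨hj, e1, by omega⟩
      · rw [Finset.disjoint_left]
        intro j hj hj'
        simp only [Finset.mem_filter] at hj hj'
        exact hj.2.1 hj'.2.1
    have h4 := hR.mid
    have h5 := Nat.mul_le_mul_left (q * P) hmid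
    have h6 := Nat.mul_le_mul_left q htop
    have h7 : (q - h) * (S.m * T) + S.m * T ≤ (q - h1) * (S.m * T) := by
      rw [← Nat.succ_mul]
      exact Nat.mul_le_mul_right _ (by omega)
    rw [mul_add] at h5 h6
    omega

/-- Nothing is removed if all windows are points. -/
theorem Conf.Rest.remove_of_points {L L2 : ℕ} (hR : C.Rest S T q P k h) (hle : h1 ≤ h)
    (hqn : q < S.n) (hhq : h ≤ q)
    (hpt : ∀ j < S.n, C.act j → C.a j = C.b j) (hr : Conf.Remove S.n C C' h L L2) :
    C'.Rest S T q P k h1 ∧ ∀ j < S.n, (C'.act j ↔ C.act j) := by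
  have hact : ∀ j < S.n, (C'.act j ↔ C.act j) := fun j hj =>
    ⟨fun ha => (hr.of_act hj ha).1, fun ha => hr.keep j hj ha (by rw [hpt j hj ha])
      (by rw [hpt j hj ha])⟩
  have hin : ∀ j < S.n, ¬ C'.act j → ¬ C.act j ∧ C'.H j = C.H j ∧ C'.lo j = C.lo j ∧
      C'.hi j = C.hi j ∧ C'.key j = C.key j := fun j hj ha =>
    have h1 := fun h => ha ((hact j hj).2 h)
    ⟨h1, (hr.inactive j hj h1).2⟩
  refine ⟨⟨fun j hj ha => ?_, fun h' hh hq => ?_, ?_⟩, hact⟩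
  · obtain ⟨h1, e1, e2, e3, e4⟩ := hin j hj ha
    rw [e1, e3, e4]
    have := hR.height j hj h1
    omega
  · rcases le_or_gt h' h with hlt | hlt
    · refine Or.inr fun j hj ha => ?_
      obtain ⟨h1, e1, -⟩ := hin j hj ha
      rw [e1]
      have := hR.height j hj h1
      omega
    · rcases hR.stage h' hlt hq with ⟨L, kk, θ, a, b, bot, blk, hS, hrest⟩ | hno
      · refine Or.inl ⟨L, kk, θ, a, b, bot, blk,
          hS.mono rfl rfl rfl (fun j hj => ?_) (fun j hj => ?_), hrest⟩
        all_goals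
          change j < S.n at hj
          simp only [Conf.toGreedy, hact j hj]
          by_cases ha : C.act j
        · rw [if_pos ha]; omega
        · obtain ⟨h1, e1, e2, e3, e4⟩ := hin j hj fun h => ha ((hact j hj).1 h)
          simp only [if_neg ha, e1, e2, e3, e4]
          exact fun h => ⟨h, trivial, trivial, trivial⟩
        · simp only [if_pos ha, hr.a, hr.b]
          exact fun h => ⟨h, le_rfl, le_rfl⟩
        · obtain ⟨h1, e1, e2, e3, e4⟩ := hin j hj fun h => ha ((hact j hj).1 h)
          simp only [if_neg ha, e1, e2, e3]
          exact fun h => ⟨h, le_rfl, le_rfl⟩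
      · refine Or.inr fun j hj ha => ?_
        obtain ⟨h1, e1, -⟩ := hin j hj ha
        rw [e1]
        exact hno j hj h1
  · have hcongr : ∀ j ∈ Finset.range S.n, ∀ p : ℕ → Prop,
        (¬ C'.act j ∧ p (C'.H j) ↔ ¬ C.act j ∧ p (C.H j)) := fun j hj p => by
      rw [Finset.mem_range] at hj
      rw [hact j hj]
      refine and_congr_right fun ha => ?_
      rw [(hr.inactive j hj ha).2.1]
    rw [Finset.filter_congr fun j hj => hcongr j hj (· = S.n),
      Finset.filter_congr fun j hj => hcongr j hj (· ≠ S.n)]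
    exact hR.mid.trans (Nat.add_le_add_left (Nat.mul_le_mul_right _ (by omega)) _)

/-- Some level is crossed by not much more jobs than the level above. -/
theorem exists_level {q P k A : ℕ} {N : ℕ → ℕ} (hP : 1 ≤ P) (hA : 0 < A)
    (hN : ∀ s, N s ≤ A) (hk : q + 1 < 2 ^ k) :
    ∃ s < P * k, q * P * (N (s + 1) - N s) ≤ q * N s + A := by
  by_contra! hcon
  -- If every level fails, `q * N s + A` gains a factor `1 + 1 / P` per step. After `P * k` steps it
  -- is at least `2 ^ k * A`, more than the possible `(q + 1) * A`.
  have key : ∀ s ≤ P * k, (1 + 1 / (P : ℝ)) ^ s * A ≤ q * N s + A := by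
    intro s hs
    induction s with
    | zero =>
      rw [pow_zero, one_mul]
      have : (0 : ℝ) ≤ q * N 0 := by positivity
      linarith
    | succ s ih =>
      have h1 := ih (by omega)
      have h2 := hcon s (by omega)
      have hle : N s ≤ N (s + 1) := by
        by_contra hlt
        rw [Nat.sub_eq_zero_of_le (not_le.1 hlt).le] at h2
        omega
      have h3 : (q : ℝ) * N s + A < q * P * (N (s + 1) - N s) := by
        rw [← Nat.cast_sub hle]
        exact_mod_cast h2
      have hP' : (0 : ℝ) < P := by exact_mod_cast hP
      have h4 : (1 + 1 / (P : ℝ)) * (q * N s + A) ≤ q * N (s + 1) + A := by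
        have : (1 / (P : ℝ)) * (q * N s + A) ≤ q * (N (s + 1) - N s) := by
          rw [one_div, inv_mul_le_iff₀ hP']
          linarith
        linarith
      calc (1 + 1 / (P : ℝ)) ^ (s + 1) * A = (1 + 1 / (P : ℝ)) * ((1 + 1 / (P : ℝ)) ^ s * A) := by
            ring
        _ ≤ (1 + 1 / (P : ℝ)) * (q * N s + A) := by gcongr
        _ ≤ _ := h4
  have h1 := key _ le_rfl
  have hP' : (0 : ℝ) < P := by exact_mod_cast hP
  -- Bernoulli's inequality: `P` steps double the quantity.
  have h2 : (2 : ℝ) ≤ (1 + 1 / (P : ℝ)) ^ P := by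
    have := one_add_mul_le_pow (a := 1 / (P : ℝ)) (by
      have : (0 : ℝ) ≤ 1 / P := by positivity
      linarith) P
    rw [mul_one_div_cancel hP'.ne'] at this
    linarith
  have h3 : (2 : ℝ) ^ k ≤ (1 + 1 / (P : ℝ)) ^ (P * k) := by
    rw [pow_mul]
    gcongr
  have h4 : (N (P * k) : ℝ) ≤ A := by exact_mod_cast hN _
  have h5 : ((q : ℝ) + 1) < 2 ^ k := by exact_mod_cast hk
  have hA' : (0 : ℝ) < A := by exact_mod_cast hA
  have h6 : (2 : ℝ) ^ k * A ≤ q * A + A := by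
    calc (2 : ℝ) ^ k * A ≤ (1 + 1 / (P : ℝ)) ^ (P * k) * A := by gcongr
      _ ≤ q * N (P * k) + A := h1
      _ ≤ _ := by gcongr
  nlinarith

theorem Conf.width_le {C : Conf} {f j : ℕ}
    (hblk : C.a j / 2 ^ h = C.b j / 2 ^ h) : C.width f j ≤ 2 ^ (h - f) := by
  unfold Conf.width
  rcases le_or_gt f h with hf | hf
  · have hpow : 2 ^ h = 2 ^ f * 2 ^ (h - f) := by rw [← pow_add]; congr 1; omega
    rw [hpow, ← Nat.div_div_eq_div_mul, ← Nat.div_div_eq_div_mul] at hblk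
    have h1 := Nat.div_mul_le_self (C.a j / 2 ^ f) (2 ^ (h - f))
    have h2 := Nat.lt_mul_div_succ (C.b j / 2 ^ f) (Nat.two_pow_pos (h - f))
    rw [hblk] at h1
    rw [mul_add, mul_one, mul_comm] at h2
    generalize 2 ^ (h - f) = D at h1 h2 ⊢
    omega
  · rw [div_pow_congr hf.le hblk]
    simp

/-- The total width of the windows in a block. -/
theorem Conf.Valid.pot_le (hy : y ∈ schedLasserre S T r) (hC : C.Valid y h Q)
    (hQ : ∀ j ℓ, Q j ℓ → ℓ ≤ r) (f j : ℕ) : C.pot S.n h f j ≤ S.m * 2 ^ h * 2 ^ (h - f) := by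
  unfold Conf.pot
  have h1 : ∀ i ∈ (Finset.range S.n).filter fun i => C.act i ∧ C.a i / 2 ^ h = C.a j / 2 ^ h,
      C.width f i ≤ 2 ^ (h - f) := fun i hi => by
    simp only [Finset.mem_filter, Finset.mem_range] at hi
    exact Conf.width_le (hC.block i hi.1 hi.2.1)
  refine (Finset.sum_le_card_nsmul _ _ _ h1).trans ?_
  rw [smul_eq_mul]
  refine Nat.mul_le_mul_right _ ?_
  have hpos := Nat.two_pow_pos h
  have h2 := hC.card_le hy hQ (C.a j / 2 ^ h * 2 ^ h) ((C.a j / 2 ^ h + 1) * 2 ^ h)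
  rw [← Nat.sub_mul, Nat.add_sub_cancel_left, one_mul] at h2
  refine (Finset.card_le_card fun i hi => ?_).trans h2
  simp only [Finset.mem_filter, Finset.mem_range] at hi ⊢
  obtain ⟨hi, ha, hb⟩ := hi
  refine ⟨hi, ha, ?_, ?_⟩
  · rw [← hb]; exact Nat.div_mul_le_self _ _
  · rw [← hb, hC.block i hi ha]
    exact (Nat.div_lt_iff_lt_mul hpos).1 (Nat.lt_succ_self _)

theorem Conf.pot_eq_zero {n f j : ℕ} (h0 : ∀ i < n, C.act i → C.width f i = 0) :
    C.pot n h f j = 0 :=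
  Finset.sum_eq_zero fun i hi => by
    simp only [Finset.mem_filter, Finset.mem_range] at hi
    exact h0 i hi.1 hi.2.1

/-- The number of conditionings on a block in one stage is at most this. -/
def stageBudget (m k K : ℕ) : ℕ := m * 2 ^ (2 * K + k)

/-- The bound for the number of variables conditioned on. -/
def Conf.Budget (S : SchedInstance) (r : ℕ) (C : Conf) (q k K h j ℓ : ℕ) : Prop :=
  -- Two regimes. Normally each completed level earns one stage budget. Otherwise `q ≤ K`, the
  -- pieces are single slots throughout, and one potential of at most `S.n * S.n` covers the whole
  -- pass.
  if q * stageBudget S.m k K ≤ r then ℓ ≤ (q - h) * stageBudget S.m k K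
  else q ≤ K ∧ ℓ + C.pot S.n h 0 j ≤ S.n * S.n

/-- The bound for the number of variables conditioned on during a stage. -/
def stageLimit (S : SchedInstance) (r q k K h : ℕ) : ℕ :=
  if q * stageBudget S.m k K ≤ r then (q - (h - 1)) * stageBudget S.m k K else S.n * S.n

theorem stageLimit_le (hr : q * stageBudget S.m k K ≤ r ∨ q ≤ K ∧ S.n * S.n ≤ r) :
    stageLimit S r q k K h ≤ r := by
  unfold stageLimit
  split_ifs with h1
  · exact (Nat.mul_le_mul_right _ (Nat.sub_le _ _)).trans h1
  · omega

theorem Conf.Budget.le (hr : q * stageBudget S.m k K ≤ r ∨ q ≤ K ∧ S.n * S.n ≤ r) {j ℓ : ℕ}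
    (hb : C.Budget S r q k K h j ℓ) : ℓ ≤ r := by
  unfold Conf.Budget at hb
  split_ifs at hb with h1
  · exact hb.trans ((Nat.mul_le_mul_right _ (Nat.sub_le _ _)).trans h1)
  · omega

/-- By Hall's condition a block has potential at most `m * 2 ^ h * 2 ^ K`, which is at most `θ`
times one stage budget; the limit provides exactly one more. At `h = 0` the limit provides none, but
then all widths vanish. In the second regime `θ = 1` and the claim is the budget itself. -/
theorem Conf.Budget.start (hy : y ∈ schedLasserre S T r) (hC : C.Valid y h Q)
    (hQ : ∀ j ℓ, Q j ℓ → ℓ ≤ r) (hhq : h ≤ q) {j ℓ : ℕ} (hb : C.Budget S r q k K h j ℓ) :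
    2 ^ (h - (K + k)) * ℓ + C.pot S.n h (h - K) j ≤
      2 ^ (h - (K + k)) * stageLimit S r q k K h := by
  unfold Conf.Budget at hb
  unfold stageLimit
  split_ifs at hb ⊢ with h1
  · rcases Nat.eq_zero_or_pos h with rfl | hpos
    · rw [Conf.pot_eq_zero fun i hi ha => ?_]
      · simpa using hb
      · have := hC.block i hi ha
        simp only [pow_zero, Nat.div_one] at this
        simp [Conf.width, this]
    · have h2 := hC.pot_le hy hQ (h - K) j
      have h3 : S.m * 2 ^ h * 2 ^ (h - (h - K)) ≤
          2 ^ (h - (K + k)) * stageBudget S.m k K := by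
        calc S.m * 2 ^ h * 2 ^ (h - (h - K)) ≤ S.m * 2 ^ (h - (K + k) + (K + k)) * 2 ^ K :=
              Nat.mul_le_mul (Nat.mul_le_mul_left _ (Nat.pow_le_pow_right two_pos (by omega)))
                (Nat.pow_le_pow_right two_pos (by omega))
          _ = _ := by unfold stageBudget; ring
      have h4 : q - (h - 1) = q - h + 1 := by omega
      rw [h4, add_mul, one_mul, mul_add]
      have := Nat.mul_le_mul_left (2 ^ (h - (K + k))) hb
      omega
  · have e1 : h - (K + k) = 0 := by omega
    have e2 : h - K = 0 := by omega
    rw [e1, e2, pow_zero, one_mul, one_mul]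
    exact hb.2

theorem Conf.Budget.finish (hr : q * stageBudget S.m k K ≤ r ∨ q ≤ K ∧ S.n * S.n ≤ r)
    (hhq : h ≤ q) (hle : h1 ≤ h - 1) (ha : C'.a = C.a) (hb : C'.b = C.b)
    (hact : ∀ i < S.n, C'.act i → C.act i) {j ℓ : ℕ}
    (h2 : 2 ^ (h - (K + k)) * ℓ + C.pot S.n h (h - K) j ≤
      2 ^ (h - (K + k)) * stageLimit S r q k K h) : C'.Budget S r q k K h1 j ℓ := by
  unfold stageLimit at h2
  unfold Conf.Budget
  split_ifs at h2 ⊢ with g1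
  · have : ℓ ≤ (q - (h - 1)) * stageBudget S.m k K :=
      Nat.le_of_mul_le_mul_left ((Nat.le_add_right _ _).trans h2) (Nat.two_pow_pos _)
    exact this.trans (Nat.mul_le_mul_right _ (by omega))
  · have hqK : q ≤ K := by omega
    have e1 : h - (K + k) = 0 := by omega
    have e2 : h - K = 0 := by omega
    rw [e1, e2, pow_zero, one_mul, one_mul] at h2
    refine ⟨hqK, le_trans (Nat.add_le_add_left ?_ _) h2⟩
    unfold Conf.pot Conf.width
    rw [ha, hb]
    refine Finset.sum_le_sum_of_subset fun i hi => ?_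
    simp only [Finset.mem_filter, Finset.mem_range] at hi ⊢
    exact ⟨hi.1, hact i hi.1 hi.2.1, div_pow_congr (by omega) hi.2.2⟩

/-- The configuration at the beginning. -/
theorem Conf.valid_init (hy : y ∈ schedLasserre S T r) (hT : IsTable y yR r) (hTn : T < S.n)
    (hr : q * stageBudget S.m k K ≤ r ∨ q ≤ K ∧ S.n * S.n ≤ r) (hq : T ≤ 2 ^ q)
    (hact : ∀ j < S.n, C.act j) (hcb : ∀ j < S.n, C.cb j = 0)
    (hrd : ∀ j < S.n, Reads yR T (C.cb j + j * T) (C.a j) (C.b j)) :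
    C.Valid y q (C.Budget S r q k K q) ∧ C.Rest S T q P k q := by
  have hw : ∀ j < S.n, IsWindow y ∅ j (C.a j) (C.b j) := fun j hj => by
    have := hrd j hj
    rw [hcb j hj] at this
    exact this.isWindow hy hT (isCode_zero hy) (Nat.zero_le _) hj
  refine ⟨⟨fun j hj _ => ⟨0, ∅, ?_, by rw [hcb j hj]; exact isCode_zero hy, hw j hj⟩,
    fun i hi j hj _ _ _ => by rw [hcb i hi, hcb j hj], fun j hj _ => ?_,
    fun i hi j hj _ _ hp => IsWindow.lt_of_pr hy (by simp) hp (hw i hi) (hw j hj)⟩,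
    fun j hj h => absurd (hact j hj) h, fun h' h1 h2 => by omega, ?_⟩
  · unfold Conf.Budget
    split_ifs with h1
    · exact Nat.zero_le _
    · refine ⟨by omega, ?_⟩
      rw [zero_add]
      unfold Conf.pot
      refine (Finset.sum_le_card_nsmul _ _ S.n fun i hi => ?_).trans ?_
      · simp only [Finset.mem_filter, Finset.mem_range] at hi
        have := (hw i hi.1).right.lt
        unfold Conf.width
        rw [pow_zero, Nat.div_one]
        omega
      · rw [smul_eq_mul]
        refine Nat.mul_le_mul_right _ ((Finset.card_filter_le _ _).trans ?_)
        rw [Finset.card_range]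
  · rw [Nat.div_eq_of_lt ((hw j hj).left.lt.trans_le hq),
      Nat.div_eq_of_lt ((hw j hj).right.lt.trans_le hq)]
  · have : ((Finset.range S.n).filter fun j => ¬ C.act j ∧ C.H j = S.n) = ∅ :=
      Finset.filter_eq_empty_iff.2 fun j hj h => h.1 (hact j (Finset.mem_range.1 hj))
    rw [this]
    simp

end Budget

end SchedRounding

/-! ### The jobs that are lost by the greedy placement -/

namespace SchedRounding

section Final
open scoped Classical

variable {S : SchedInstance} {T r : ℕ} {y : Finset (LPVar S.n T) → ℝ}
variable {C : Conf} {Q : ℕ → ℕ → Prop} {q P k : ℕ} {G : GreedyInput} {pl : ℕ → Prop} {sg : ℕ → ℕ}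

/-- The input `G` of the greedy placement agrees with the one that belongs to the
configuration. -/
structure Conf.Agrees (S : SchedInstance) (C : Conf) (G : GreedyInput) : Prop where
  n_eq : G.n = S.n
  m_eq : G.m = S.m
  pr_eq : G.pr = Pr S
  H_eq : ∀ j < S.n, G.H j = (C.toGreedy S).H j
  key_eq : ∀ j < S.n, G.key j = (C.toGreedy S).key j
  lo_eq : ∀ j < S.n, G.lo j = (C.toGreedy S).lo j
  hi_eq : ∀ j < S.n, G.hi j = (C.toGreedy S).hi j

/-- The jobs that are active until the end are placed. -/
theorem Conf.Agrees.placed (hA : C.Agrees S G) (hy : y ∈ schedLasserre S T r) (hTn : T < S.n)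
    (hC : C.Valid y 0 Q) (hQ : ∀ j ℓ, Q j ℓ → ℓ ≤ r) (hR : C.Rest S T q P k 0)
    (hG : G.Spec (fun j => G.key j < S.n ∧ G.H j < S.n) pl sg) {j : ℕ} (hj : j < S.n)
    (ha : C.act j) : pl j := by
  have hpt : ∀ i < S.n, C.act i → C.a i = C.b i := fun i hi hia => by
    simpa using hC.block i hi hia
  have hH : G.H j = 0 := by rw [hA.H_eq j hj]; simp [Conf.toGreedy, ha]
  have hkey : G.key j = C.b j := by rw [hA.key_eq j hj]; simp [Conf.toGreedy, ha]
  have hlo : ∀ i < S.n, C.act i → G.lo i = C.a i := fun i hi hia => by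
    rw [hA.lo_eq i hi]; simp [Conf.toGreedy, hia]
  have hhi : ∀ i < S.n, C.act i → G.hi i = C.a i + 1 := fun i hi hia => by
    rw [hA.hi_eq i hi, hpt i hi hia]; simp [Conf.toGreedy, hia]
  obtain ⟨h1, h2⟩ := hC.le hj ha
  -- At level `0` windows are points. Jobs placed before `j` have height `0`, so they are active and
  -- occupy their points; Hall's condition for a single slot leaves room for `j`.
  have hpl : ∀ i < S.n, pl i → G.Before i j → C.act i ∧ sg i = C.a i := by
    intro i hi hp hb
    have hHi : G.H i = 0 := by unfold GreedyInput.Before at hb; omega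
    have hia : C.act i := by
      by_contra hia
      rw [hA.H_eq i hi] at hHi
      simp only [Conf.toGreedy, if_neg hia] at hHi
      have := hR.height i hi hia
      omega
    have := hG.placed i (by rw [hA.n_eq]; exact hi) hp
    rw [hlo i hi hia, hhi i hi hia] at this
    exact ⟨hia, by omega⟩
  by_contra hnp
  refine hG.first j (by rw [hA.n_eq]; exact hj) ⟨by rw [hkey]; omega, by rw [hH]; omega⟩ (C.a j)
    (by rw [hA.n_eq]; omega) (fun h => absurd h hnp)
    ⟨(hlo j hj ha).le, by rw [hhi j hj ha]; omega, ?_, fun i hi hp => ?_⟩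
  · have hall := hC.card_le hy hQ (C.a j) (C.a j + 1)
    rw [Nat.add_sub_cancel_left, mul_one] at hall
    rw [hA.m_eq]
    refine lt_of_lt_of_le (Finset.card_lt_card (Finset.ssubset_iff_of_subset ?_ |>.2
      ⟨j, ?_, ?_⟩)) hall
    · intro i hi
      simp only [Finset.mem_filter, Finset.mem_range, hA.n_eq] at hi ⊢
      obtain ⟨hi, ⟨hp, hb⟩, hs⟩ := hi
      obtain ⟨hia, hsi⟩ := hpl i hi hp hb
      have := hpt i hi hia
      exact ⟨hi, hia, by omega, by omega⟩
    · simp only [Finset.mem_filter, Finset.mem_range]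
      have := hpt j hj ha
      exact ⟨hj, ha, le_rfl, by omega⟩
    · simp only [Finset.mem_filter]
      exact fun h => hnp h.2.1.1
  · rw [hA.n_eq] at hi
    rw [hA.pr_eq]
    obtain ⟨hia, hsi⟩ := hpl i hi hp.1 hp.2
    rw [hsi]
    exact ⟨fun h => (hC.lt i hi j hj hia ha h).1, fun h => (hC.lt j hj i hi ha hia h).1⟩

/-- The jobs of one stage that cannot be placed. -/
theorem Conf.Agrees.card_stage_le (hA : C.Agrees S G) (hTn : T < S.n) (hR : C.Rest S T q P k 0)
    (hqn : q < S.n) (hG : G.Spec (fun j => G.key j < S.n ∧ G.H j < S.n) pl sg) {h : ℕ}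
    (h0 : 0 < h) (hhq : h ≤ q) :
    2 ^ k * ((Finset.range S.n).filter fun j => G.H j = h ∧ ¬ pl j).card ≤ 3 * S.m * T := by
  have hin : ∀ j < S.n, G.H j = h → ¬ C.act j ∧ C.H j = h ∧ G.key j < T := by
    intro j hj hH
    rw [hA.H_eq j hj] at hH
    rw [hA.key_eq j hj]
    simp only [Conf.toGreedy] at hH ⊢
    split_ifs at hH ⊢ with ha
    · omega
    · have := hR.height j hj ha
      exact ⟨ha, hH, by omega⟩
  rcases hR.stage h h0 hhq with ⟨L, kk, θ, a, b, bot, blk, hS, hnum, hL, hkk⟩ | hno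
  · have hS' : G.Stage h L kk θ a b bot blk := by
      refine hS.mono hA.n_eq hA.m_eq hA.pr_eq (fun j hj => ?_) fun j hj => ?_
      all_goals
        change j < S.n at hj
        rw [hA.H_eq j hj, hA.lo_eq j hj, hA.hi_eq j hj]
      · exact fun h => ⟨h, hA.key_eq j hj, rfl, rfl⟩
      · exact fun h => ⟨h, le_rfl, le_rfl⟩
    have hc := hS'.card_unplaced hG (fun j hj hH => by
      rw [hA.n_eq] at hj
      have := (hin j hj hH).2.2
      constructor <;> omega) (fun i j k => by rw [hA.pr_eq]; exact Pr.trans) ((T - 1) / L)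
    rw [hA.m_eq] at hc
    refine (Nat.mul_le_mul_left _ (le_trans (Finset.card_le_card fun j hj => ?_) hc)).trans hnum
    simp only [Finset.mem_filter, Finset.mem_range, hA.n_eq] at hj ⊢
    refine ⟨hj.1, hj.2, Nat.div_le_div_right ?_⟩
    rw [← hS'.key_eq j (by rw [hA.n_eq]; exact hj.1) hj.2.1]
    have := (hin j hj.1 hj.2.1).2.2
    omega
  · have : ((Finset.range S.n).filter fun j => G.H j = h ∧ ¬ pl j) = ∅ :=
      Finset.filter_eq_empty_iff.2 fun j hj hH => by
        obtain ⟨h1, h2, -⟩ := hin j (Finset.mem_range.1 hj) hH.1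
        exact hno j (Finset.mem_range.1 hj) h1 h2
    rw [this]
    simp

/-- All jobs that are placed are placed before `T`, and few jobs are not placed. -/
theorem Conf.Agrees.bound (hA : C.Agrees S G) (hy : y ∈ schedLasserre S T r) (hTn : T < S.n)
    (hC : C.Valid y 0 Q) (hQ : ∀ j ℓ, Q j ℓ → ℓ ≤ r) (hR : C.Rest S T q P k 0) (hqn : q < S.n)
    (hG : G.Spec (fun j => G.key j < S.n ∧ G.H j < S.n) pl sg) :
    (∀ i < S.n, pl i → sg i + 1 ≤ T) ∧
    (∃ mid, 2 ^ k * ((Finset.range S.n).filter fun d => ¬ pl d).card ≤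
      2 ^ k * mid + q * (3 * S.m * T) ∧ q * P * mid ≤ q * S.n + q * (S.m * T)) ∧
    ((∀ j < S.n, C.act j) → ((Finset.range S.n).filter fun d => ¬ pl d).card = 0) := by
  refine ⟨fun i hi hp => ?_, ⟨_, ?_, hR.mid.trans (Nat.add_le_add (Nat.mul_le_mul_left _ ?_) ?_)⟩,
    fun hact => ?_⟩
  · obtain ⟨⟨-, h1⟩, -, -, h2⟩ := hG.placed i (by rw [hA.n_eq]; exact hi) hp
    rw [hA.H_eq i hi] at h1
    rw [hA.hi_eq i hi] at h2
    simp only [Conf.toGreedy] at h1 h2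
    split_ifs at h1 h2 with ha
    · have := (hC.le hi ha).2
      omega
    · have := hR.height i hi ha
      omega
  -- An unplaced job has been given up or belongs to one of the `q` stages.
  · have hsub : ((Finset.range S.n).filter fun d => ¬ pl d) ⊆
        ((Finset.range S.n).filter fun j => ¬ C.act j ∧ C.H j = S.n) ∪
          (Finset.Ioc 0 q).biUnion fun h =>
            (Finset.range S.n).filter fun j => G.H j = h ∧ ¬ pl j := by
      intro j hj
      simp only [Finset.mem_filter, Finset.mem_range, Finset.mem_union, Finset.mem_biUnion,
        Finset.mem_Ioc] at hj ⊢
      obtain ⟨hj, hp⟩ := hj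
      have ha : ¬ C.act j := fun ha => hp (hA.placed hy hTn hC hQ hR hG hj ha)
      rcases hR.height j hj ha with h1 | h1
      · exact Or.inl ⟨hj, ha, h1⟩
      · refine Or.inr ⟨C.H j, by omega, hj, ?_, hp⟩
        rw [hA.H_eq j hj]
        simp [Conf.toGreedy, ha]
    refine (Nat.mul_le_mul_left _ ((Finset.card_le_card hsub).trans
      ((Finset.card_union_le _ _).trans (Nat.add_le_add_left Finset.card_biUnion_le _)))).trans ?_
    rw [mul_add, Finset.mul_sum]
    refine Nat.add_le_add_left ((Finset.sum_le_card_nsmul _ _ (3 * S.m * T) fun h hh => ?_).trans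
      ?_) _
    · rw [Finset.mem_Ioc] at hh
      exact hA.card_stage_le hTn hR hqn hG hh.1 hh.2
    · simp
  · exact (Finset.card_filter_le _ _).trans (by rw [Finset.card_range])
  · exact Nat.mul_le_mul_right _ (Nat.sub_le _ _)
  · rw [Finset.card_eq_zero, Finset.filter_eq_empty_iff]
    exact fun j hj => not_not.2
      (hA.placed hy hTn hC hQ hR hG (Finset.mem_range.1 hj) (hact j (Finset.mem_range.1 hj)))

end Final

end SchedRounding

namespace SchedRounding

open BoundedLoops

section Fill
open scoped Classical

variable {S : SchedInstance} {T r : ℕ} {y : Finset (LPVar S.n T) → ℝ} {yR : ℕ → ℝ}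
variable {q P k K h : ℕ} {ρ : ℕ → ℕ} {M M' : Mem}

/-! ### The program for the forward pass

The arrays `3, 4, 5, 6` hold the active jobs, their codes and windows, array `15` holds the current
level and array `16` the next one. The variables `1, 2, 3, 4` are the parameters. -/

/-- The configuration in the memory. -/
def confOf (M : Mem) : Conf :=
  ⟨fun j => M 3 j ≠ 0, M 4, M 5, M 6, M 7, M 8, M 9, M 10⟩

/-- The values of the parameters. -/
structure Params (q P k K : ℕ) (ρ : ℕ → ℕ) : Prop where
  q_eq : ρ 1 = q
  P_eq : ρ 2 = P
  k_eq : ρ 3 = k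
  K_eq : ρ 4 = K

theorem Params.update (hρ : Params q P k K ρ) {x : ℕ} (hx : 10 ≤ x) (v : ℕ) :
    Params q P k K (Function.update ρ x v) := by
  constructor
  · rw [Function.update_of_ne (by omega), hρ.q_eq]
  · rw [Function.update_of_ne (by omega), hρ.P_eq]
  · rw [Function.update_of_ne (by omega), hρ.k_eq]
  · rw [Function.update_of_ne (by omega), hρ.K_eq]

def cellEx (a i : ℕ) : Ex := .get a (.lit i)
def levelEx : Ex := cellEx 15 0
def powEx (e : Ex) : Ex := .get 17 e

@[simp] theorem eval_cellEx (a i : ℕ) : (cellEx a i).eval yR M ρ = M a i := rfl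
@[simp] theorem eval_levelEx : levelEx.eval yR M ρ = M 15 0 := rfl
@[simp] theorem eval_powEx (e : Ex) : (powEx e).eval yR M ρ = M 17 (e.eval yR M ρ) := rfl
@[simp] theorem eval_nEx : nEx.eval yR M ρ = M 0 0 := rfl
@[simp] theorem eval_mEx : mEx.eval yR M ρ = M 0 1 := rfl
@[simp] theorem eval_tEx : tEx.eval yR M ρ = M 0 2 := rfl

/-- Slot `t` is possible for job `x`. -/
def suppEx (x t : Ex) : Ex :=
  .and (.lt t tEx) (.pos (.add (.add (.add (.get 4 x) (.get 27 x)) t) (.lit 1)))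

/-- Find the window of the job in variable `x`. -/
def windowStmt (x : ℕ) : Stmt :=
  .seq (.set 5 (.var x) (.first 20 21 fun t => suppEx (.var x) t))
    (.set 6 (.var x) (.last 20 21 fun t => suppEx (.var x) t))

theorem put_cell (M : Mem) {a b i j : ℕ} (v : ℕ) (h : j ≠ i) : put M a i v b j = M b j := by
  by_cases hb : b = a
  · subst hb; exact put_cell_of_ne _ _ _ h
  · rw [put_of_ne _ _ _ hb]

theorem run_windowStmt (hM : Static S T M) (hTn : T < S.n) {x j : ℕ} (hx : x ≠ 20) (hx' : x ≠ 21)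
    (hρ : ρ x = j) (hj : j < S.n) :
    (∀ a i, i ≠ j → (windowStmt x).run yR ρ M a i = M a i) ∧
      (∀ a, a ≠ 5 → a ≠ 6 → (windowStmt x).run yR ρ M a = M a) ∧
      Reads yR T (M 4 j + j * T) ((windowStmt x).run yR ρ M 5 j)
        ((windowStmt x).run yR ρ M 6 j) := by
  have hφ : ∀ M' : Mem, (∀ a, a ≠ 5 → M' a = M a) → ∀ i < M' 0 0, ∀ t < M' 0 0,
      ((suppEx (.var x) (.var 21)).Holds yR M' (Function.update (Function.update ρ 20 i) 21 t) ↔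
        t < T ∧ 0 < yR (M 4 j + j * T + t + 1)) := by
    intro M' hM' i _ t _
    simp only [suppEx, holds_and, holds_lt, eval_var, Function.update_self, eval_tEx, holds_pos,
      eval_add, eval_get, eval_lit, Function.update_of_ne hx, Function.update_of_ne hx', hρ,
      hM' 0 (by decide), hM' 4 (by decide), hM' 27 (by decide), hM.T_eq, hM.row hTn.le j hj]
  set v := (Ex.first 20 21 fun t => suppEx (.var x) t).eval yR M ρ with hv
  set M1 := put M 5 j v with hM1
  have e1 : ∀ a, a ≠ 5 → M1 a = M a := fun a ha => put_of_ne _ _ _ ha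
  set w := (Ex.last 20 21 fun t => suppEx (.var x) t).eval yR M1 ρ with hw
  have hrun : (windowStmt x).run yR ρ M = put M1 6 j w := by
    simp only [windowStmt, Stmt.run, eval_var, hρ, ← hv, ← hM1, ← hw]
  rw [hrun]
  refine ⟨fun a i hi => ?_, fun a h5 h6 => ?_, fun hex => ?_⟩
  · rw [put_cell _ _ hi, hM1, put_cell _ _ hi]
  · rw [put_of_ne _ _ _ h6, e1 a h5]
  · obtain ⟨f1, f2, f3⟩ := eval_first yR M ρ (hφ M fun _ _ => rfl) (by decide)
    rw [← hv] at f1 f2 f3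
    have hex1 : ∃ t < M1 0 0, t < T ∧ 0 < yR (M 4 j + j * T + t + 1) := by
      obtain ⟨t, ht, hp⟩ := hex
      exact ⟨t, by rw [e1 0 (by decide), hM.n_eq]; omega, ht, hp⟩
    obtain ⟨g1, g2, g3⟩ := eval_last yR M1 ρ (hφ M1 e1) (by decide) hex1
    rw [← hw] at g1 g2 g3
    rw [e1 0 (by decide), hM.n_eq] at g3
    rw [hM.n_eq] at f1 f2 f3
    rw [put_self, put_of_ne _ _ _ (by decide), hM1, put_self]
    have hmin : ∀ t < T, 0 < yR (M 4 j + j * T + t + 1) → v ≤ t := fun t ht hp => by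
      by_contra hlt
      exact f3 t (by omega) (not_le.1 hlt) ⟨ht, hp⟩
    have hvn : v < S.n := by
      obtain ⟨t, ht, hp⟩ := hex
      have := hmin t ht hp
      omega
    exact ⟨f2 hvn, g2, fun t ht hp => ⟨hmin t ht hp, g3 t (by omega) ⟨ht, hp⟩⟩⟩

/-- The condition of the stage is violated at job `j`. -/
def lateEx (j : Ex) : Ex :=
  .le (powEx (.sub levelEx (.add (.var 4) (.var 3))))
    (.count 22 (.and (.get 3 (.var 22)) (.and (.or (.eq (.var 22) j) (prEx (.var 22) j))
      (.lt (.div (.get 5 j) (powEx (.sub levelEx (.var 4))))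
        (.div (.get 6 (.var 22)) (powEx (.sub levelEx (.var 4))))))))

def chooseEx : Ex := .first 20 21 fun j => .and (.get 3 j) (lateEx j)

theorem holds_lateEx (hM : Static S T M) (hρ : Params q P k K ρ) (hl : M 15 0 = h) (hh : h ≤ S.n)
    {j : ℕ} (hj : j < S.n) (i : ℕ) :
    (Ex.and (.get 3 (.var 21)) (lateEx (.var 21))).Holds yR M
        (Function.update (Function.update ρ 20 i) 21 j) ↔
      (confOf M).act j ∧ 2 ^ (h - (K + k)) ≤ ((confOf M).late S (h - K) j).card := by
  have hcount : ((Finset.range (M 0 0)).filter fun i => M 3 i ≠ 0 ∧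
      (i = j ∨ M 1 (M 26 i + j) ≠ 0) ∧ M 5 j / 2 ^ (h - K) < M 6 i / 2 ^ (h - K)) =
      (confOf M).late S (h - K) j := by
    ext i
    rw [Conf.late, Finset.mem_filter, Finset.mem_filter, Finset.mem_range, Finset.mem_range,
      hM.n_eq]
    refine and_congr_right fun hi => ?_
    rw [hM.prec i (by rw [hM.n_eq]; exact hi) j (by rw [hM.n_eq]; exact hj)]
    exact Iff.rfl
  have e1 := hM.pow (h - (K + k)) (by omega)
  have e2 := hM.pow (h - K) (by omega)
  simp only [lateEx, prEx, holds_and, holds_get, holds_le, eval_powEx, eval_sub, eval_levelEx,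
    eval_add, eval_var, eval_count, holds_or, holds_eq, holds_lt, eval_div, eval_get,
    Function.update_apply]
  simp only [Nat.reduceEqDiff, if_true, if_false, hρ.k_eq, hρ.K_eq, hl, e1, e2, hcount]
  rfl

theorem eval_chooseEx (hM : Static S T M) (hρ : Params q P k K ρ) (hl : M 15 0 = h)
    (hh : h ≤ S.n) :
    (chooseEx.eval yR M ρ < S.n → (confOf M).act (chooseEx.eval yR M ρ) ∧
      2 ^ (h - (K + k)) ≤ ((confOf M).late S (h - K) (chooseEx.eval yR M ρ)).card) ∧
    (¬ chooseEx.eval yR M ρ < S.n → ∀ j < S.n, (confOf M).act j →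
      ((confOf M).late S (h - K) j).card < 2 ^ (h - (K + k))) := by
  obtain ⟨f1, f2, f3⟩ := eval_first yR M ρ (x := 20) (x' := 21)
    (φ := fun j => .and (.get 3 j) (lateEx j))
    (P := fun j => (confOf M).act j ∧ 2 ^ (h - (K + k)) ≤ ((confOf M).late S (h - K) j).card)
    (fun i _ j hj => holds_lateEx hM hρ hl hh (by rwa [hM.n_eq] at hj) i) (by decide)
  rw [hM.n_eq] at f1 f2 f3
  refine ⟨f2, fun hn j hj ha => ?_⟩
  by_contra hlt
  refine f3 j hj ?_ ⟨ha, not_lt.1 hlt⟩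
  change j < chooseEx.eval yR M ρ
  omega

/-- Give job number `13` the new code if it is in the block. -/
def recodeStmt : Stmt :=
  .ite (.and (.get 3 (.var 13)) (.eq (.div (.get 5 (.var 13)) (powEx levelEx)) (cellEx 24 0)))
    (.seq (.set 4 (.var 13) (cellEx 23 4)) (windowStmt 13)) .skip

/-- Compute the new code for the block of the job in array `25`. -/
def codeStmt : Stmt :=
  -- Multiplication of `v` by `setBase` without products: `v + n * (v * T) + n * (v * T) * T`, each
  -- factor handled by a loop.
  .seq (.set 23 (.lit 0) (.add (.add (.add (.get 4 (cellEx 25 0)) (.get 27 (cellEx 25 0)))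
    (.get 5 (cellEx 25 0))) (.lit 1)))
  (.seq (.set 23 (.lit 1) (.mul 20 (cellEx 23 0) tEx))
  (.seq (.set 23 (.lit 2) (.sum 20 (cellEx 23 1)))
  (.seq (.set 23 (.lit 3) (.mul 20 (cellEx 23 2) tEx))
  (.seq (.set 23 (.lit 4) (.add (.add (cellEx 23 0) (cellEx 23 2)) (cellEx 23 3)))
  (.set 24 (.lit 0) (.div (.get 5 (cellEx 25 0)) (powEx levelEx)))))))

def applyStmt : Stmt := .seq codeStmt (.for' 13 recodeStmt)

theorem run_codeStmt (hM : Static S T M) (hTn : T < S.n) (hl : M 15 0 = h) (hh : h ≤ S.n)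
    {js : ℕ} (hjs : M 25 0 = js) (hjn : js < S.n) :
    codeStmt.run yR ρ M 23 4 = (M 4 js + (js * T + M 5 js + 1)) * setBase S.n T ∧
      codeStmt.run yR ρ M 24 0 = M 5 js / 2 ^ h := by
  have hmul : ∀ (M' : Mem) (i : ℕ), M' 0 = M 0 →
      (Ex.mul 20 (cellEx 23 i) tEx).eval yR M' ρ = M' 23 i * T := fun M' i h0 => by
    refine eval_mul _ _ _ _ _ _ (fun _ => rfl) (fun _ => ?_) ?_
    · rw [eval_tEx, h0, hM.T_eq]
    · rw [h0, hM.n_eq]; exact hTn.le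
  have hsum : ∀ (M' : Mem) (i : ℕ), M' 0 = M 0 →
      (Ex.sum 20 (cellEx 23 i)).eval yR M' ρ = S.n * M' 23 i := fun M' i h0 => by
    rw [eval_sum, h0, hM.n_eq]
    simp
  set v := M 4 js + js * T + M 5 js + 1 with hv
  set M1 := put M 23 0 v with hM1
  set M2 := put M1 23 1 (v * T) with hM2
  set M3 := put M2 23 2 (S.n * (v * T)) with hM3
  set M4 := put M3 23 3 (S.n * (v * T) * T) with hM4
  set M5 := put M4 23 4 (v + S.n * (v * T) + S.n * (v * T) * T) with hM5
  have hrun : codeStmt.run yR ρ M = put M5 24 0 (M 5 js / 2 ^ h) := by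
    have g1 : M1 0 = M 0 := put_of_ne _ _ _ (by decide)
    have g2 : M2 0 = M 0 := (put_of_ne _ _ _ (by decide)).trans g1
    have g3 : M3 0 = M 0 := (put_of_ne _ _ _ (by decide)).trans g2
    have r1 : M1 23 0 = v := put_self _ _ _ _
    have r2 : M2 23 1 = v * T := put_self _ _ _ _
    have r3 : M3 23 2 = S.n * (v * T) := put_self _ _ _ _
    have r4 : M4 23 3 = S.n * (v * T) * T := put_self _ _ _ _
    have r5 : M4 23 0 = v := by
      rw [hM4, put_cell _ _ (by decide), hM3, put_cell _ _ (by decide), hM2,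
        put_cell _ _ (by decide), r1]
    have r6 : M4 23 2 = S.n * (v * T) := by rw [hM4, put_cell _ _ (by decide), r3]
    have s : ∀ a, a ≠ 23 → M5 a = M a := fun a ha => by
      rw [hM5, put_of_ne _ _ _ ha, hM4, put_of_ne _ _ _ ha, hM3, put_of_ne _ _ _ ha, hM2,
        put_of_ne _ _ _ ha, hM1, put_of_ne _ _ _ ha]
    have ev : M 4 js + M 27 js + M 5 js + 1 = v := by rw [hM.row hTn.le js hjn]
    simp only [codeStmt, Stmt.run, eval_lit, eval_add, eval_get, eval_cellEx, hjs, ev]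
    rw [← hM1, hmul M1 0 g1, r1, ← hM2, hsum M2 1 g2, r2, ← hM3, hmul M3 2 g3, r3, ← hM4, r4, r5,
      r6, ← hM5]
    simp only [eval_div, eval_get, eval_cellEx, eval_powEx, eval_levelEx, s 25 (by decide),
      s 5 (by decide), s 17 (by decide), s 15 (by decide), hjs, hl, hM.pow h hh]
  rw [hrun, put_of_ne _ _ _ (by decide), put_self, hM5, put_self]
  refine ⟨?_, rfl⟩
  rw [hv, setBase]
  ring

theorem run_recodeStmt (hM : Static S T M) (hTn : T < S.n) (hl : M 15 0 = h) (hh : h ≤ S.n)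
    {j : ℕ} (hρ : ρ 13 = j) (hj : j < S.n) :
    (∀ a i, i ≠ j → recodeStmt.run yR ρ M a i = M a i) ∧
    if M 3 j ≠ 0 ∧ M 5 j / 2 ^ h = M 24 0 then
      recodeStmt.run yR ρ M 4 j = M 23 4 ∧
        Reads yR T (M 23 4 + j * T) (recodeStmt.run yR ρ M 5 j) (recodeStmt.run yR ρ M 6 j)
    else ∀ a, recodeStmt.run yR ρ M a j = M a j := by
  have hc : (Ex.and (.get 3 (.var 13)) (.eq (.div (.get 5 (.var 13)) (powEx levelEx))
      (cellEx 24 0))).Holds yR M ρ ↔ M 3 j ≠ 0 ∧ M 5 j / 2 ^ h = M 24 0 := by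
    simp [hρ, hl, hM.pow h hh]
  rw [recodeStmt, run_ite]
  by_cases hcond : M 3 j ≠ 0 ∧ M 5 j / 2 ^ h = M 24 0
  · rw [if_pos (hc.2 hcond), if_pos hcond, Stmt.run, Stmt.run, eval_var, hρ, eval_cellEx]
    have hM1 : Static S T (put M 4 j (M 23 4)) := hM.congr fun a ha =>
      put_of_ne _ _ _ (by rintro rfl; simp at ha)
    obtain ⟨h1, h2, h3⟩ := run_windowStmt (yR := yR) (x := 13) hM1 hTn (by decide) (by decide) hρ hj
    refine ⟨fun a i hi => ?_, ?_, ?_⟩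
    · rw [h1 a i hi, put_cell _ _ hi]
    · rw [h2 4 (by decide) (by decide), put_self]
    · rwa [put_self] at h3
  · rw [if_neg fun h' => hcond (hc.1 h'), if_neg hcond]
    exact ⟨fun _ _ _ => rfl, fun _ => rfl⟩

/-- The new code and the block number are saved in the arrays `23` and `24` beforehand, because the
loop also overwrites the code and the window of `js`. -/
theorem run_applyStmt (hM : Static S T M) (hTn : T < S.n) (hl : M 15 0 = h) (hh : h ≤ S.n)
    {js : ℕ} (hjs : M 25 0 = js) (hjn : js < S.n) :
    Conf.Step S T yR (confOf M) (confOf (applyStmt.run yR ρ M)) h js := by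
  obtain ⟨h1, h2⟩ := run_codeStmt (yR := yR) (ρ := ρ) hM hTn hl hh hjs hjn
  set M1 := codeStmt.run yR ρ M with hM1
  have e1 : ∀ a, a ∉ [23, 24] → M1 a = M a := fun a ha =>
    Stmt.run_of_notMem_writes yR a _ _ _ (by simpa [codeStmt, Stmt.writes] using ha)
  have hS1 : Static S T M1 := hM.run (by decide)
  have hfin := run_for_inv (y := yR) (x := 13) (c := recodeStmt) (ρ := ρ) (M := M1)
    (fun i M' => ∀ j < S.n, if j < i ∧ M1 3 j ≠ 0 ∧ M1 5 j / 2 ^ h = M1 24 0 then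
      M' 4 j = M1 23 4 ∧ Reads yR T (M1 23 4 + j * T) (M' 5 j) (M' 6 j)
      else ∀ a, M' a j = M1 a j)
    (fun j _ => by rw [if_neg (by omega)]; exact fun _ => rfl)
    (fun i hi M2 hM2 hI j hj => by
      rw [hS1.n_eq] at hi
      have hS2 : Static S T M2 := hS1.congr fun a ha => hM2 a (by
        revert a; decide)
      have hl2 : M2 15 0 = h := by
        rw [hM2 15 (by decide), e1 15 (by decide), hl]
      obtain ⟨g1, g2⟩ := run_recodeStmt (yR := yR) (ρ := Function.update ρ 13 i) hS2 hTn hl2 hh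
        (Function.update_self _ _ _) hi
      have hIj := hI j hj
      by_cases hji : j = i
      · subst hji
        rw [if_neg (by omega)] at hIj
        rw [hIj 3, hIj 5, hM2 24 (by decide), hM2 23 (by decide)] at g2
        by_cases hc : M1 3 j ≠ 0 ∧ M1 5 j / 2 ^ h = M1 24 0
        · rw [if_pos hc] at g2
          rw [if_pos ⟨Nat.lt_succ_self _, hc⟩]
          exact g2
        · rw [if_neg hc] at g2
          rw [if_neg fun h => hc h.2]
          exact fun a => (g2 a).trans (hIj a)
      · have e : (j < i + 1 ∧ M1 3 j ≠ 0 ∧ M1 5 j / 2 ^ h = M1 24 0) ↔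
            (j < i ∧ M1 3 j ≠ 0 ∧ M1 5 j / 2 ^ h = M1 24 0) :=
          and_congr_left fun _ => by omega
        simp only [e, g1 _ j hji]
        exact hIj)
  rw [hS1.n_eq] at hfin
  have hrun : applyStmt.run yR ρ M = (Stmt.for' 13 recodeStmt).run yR ρ M1 := rfl
  rw [hrun]
  set M3 := (Stmt.for' 13 recodeStmt).run yR ρ M1 with hM3
  have e3 : ∀ a, a ∉ [4, 5, 6, 23, 24] → M3 a = M a := fun a ha => by
    have ha' : a ∉ [4, 5, 6] ∧ a ∉ [23, 24] := by simpa [not_or, and_assoc] using ha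
    exact (Stmt.run_of_notMem_writes yR a _ _ _
      (by simpa [recodeStmt, windowStmt, Stmt.writes] using ha'.1)).trans (e1 a ha'.2)
  rw [e1 3 (by decide), e1 5 (by decide), h1, h2] at hfin
  refine ⟨?_, ?_, ?_, ?_, ?_, fun j hj ha hb => ?_, fun j hj ha hb => ?_, fun j hj ha hb => ?_⟩
  · simp only [confOf, e3 3 (by decide)]
  · simp only [confOf, e3 7 (by decide)]
  · simp only [confOf, e3 8 (by decide)]
  · simp only [confOf, e3 9 (by decide)]
  · simp only [confOf, e3 10 (by decide)]
  all_goals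
    have hj1 := hfin j hj
    simp only [confOf] at ha hb ⊢
  · rw [if_neg fun h => hb h.2.2] at hj1
    rw [hj1 4, hj1 5, hj1 6, e1 4 (by decide), e1 5 (by decide), e1 6 (by decide)]
    exact ⟨rfl, rfl, rfl⟩
  · rw [if_pos ⟨hj, ha, hb⟩] at hj1
    exact hj1.1
  · rw [if_pos ⟨hj, ha, hb⟩] at hj1
    rw [hj1.1]
    exact hj1.2

/-- One round of conditioning. -/
def condStmt : Stmt :=
  .seq (.set 25 (.lit 0) chooseEx) (.ite (.lt (cellEx 25 0) nEx) applyStmt .skip)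

/-- The invariant of the rounds of conditioning. -/
structure Rounds (S : SchedInstance) (T : ℕ) (y : Finset (LPVar S.n T) → ℝ) (M0 : Mem)
    (q P k K h θ Λ c : ℕ) (M : Mem) : Prop where
  static : Static S T M
  level : M 15 0 = h
  act : M 3 = M0 3
  valid : (confOf M).Valid y h fun j ℓ => θ * ℓ + (confOf M).pot S.n h (h - K) j ≤ θ * Λ
  rest : (confOf M).Rest S T q P k h
  -- Either there is nothing left to do, or each of the `c` rounds has lowered the total width by at
  -- least one.
  pot : (∀ j < S.n, (confOf M).act j → ((confOf M).late S (h - K) j).card < θ) ∨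
    (confOf M).totalPot S.n (h - K) + c ≤ S.n * S.n

theorem run_condStmt (hy : y ∈ schedLasserre S T r) (hT : IsTable y yR r) (hTn : T < S.n)
    (hρ : Params q P k K ρ) (hh : h ≤ S.n) {Λ c : ℕ} (hΛ : Λ ≤ r) {M0 : Mem}
    (hI : Rounds S T y M0 q P k K h (2 ^ (h - (K + k))) Λ c M) :
    Rounds S T y M0 q P k K h (2 ^ (h - (K + k))) Λ (c + 1) (condStmt.run yR ρ M) := by
  obtain ⟨hc1, hc2⟩ := eval_chooseEx (yR := yR) hI.static hρ hI.level hh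
  set js := chooseEx.eval yR M ρ with hjs
  have hconf : confOf (put M 25 0 js) = confOf M := rfl
  have hS1 : Static S T (put M 25 0 js) := hI.static.congr fun a ha =>
    put_of_ne _ _ _ (by rintro rfl; simp at ha)
  have hl1 : put M 25 0 js 15 0 = h := hI.level
  have hcond : (Ex.lt (cellEx 25 0) nEx).Holds yR (put M 25 0 js) ρ ↔ js < S.n := by
    simp only [holds_lt, eval_cellEx, eval_nEx, put_self, hS1.n_eq]
  rw [condStmt, Stmt.run, Stmt.run, eval_lit, ← hjs, run_ite]
  by_cases hn : js < S.n
  · rw [if_pos (hcond.2 hn)]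
    obtain ⟨ha, hv⟩ := hc1 hn
    have hstep := run_applyStmt (yR := yR) (ρ := ρ) hS1 hTn hl1 hh (put_self _ _ _ _) hn
    rw [hconf] at hstep
    obtain ⟨h1, h2, h3⟩ := hI.valid.step hy hT (Nat.two_pow_pos _) hΛ hn ha hv hstep
    refine ⟨hS1.run (by decide), ?_, ?_, h1, hI.rest.shrink hstep.act hstep.H hstep.lo hstep.hi
      hstep.key h3, ?_⟩
    · rw [applyStmt.run_of_notMem_writes yR 15 _ _ (by decide)]; exact hl1
    · rw [applyStmt.run_of_notMem_writes yR 3 _ _ (by decide)]; exact hI.act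
    · rcases hI.pot with h4 | h4
      · exact absurd hv (not_le.2 (h4 js hn ha))
      · have := Nat.two_pow_pos (h - (K + k))
        exact Or.inr (by omega)
  · rw [if_neg fun h => hn (hcond.1 h), Stmt.run]
    exact ⟨hS1, hl1, hI.act, hI.valid, hI.rest, Or.inl (hc2 hn)⟩

theorem Rounds.congr {θ Λ c c' : ℕ} {M0 : Mem} (hI : Rounds S T y M0 q P k K h θ Λ c M)
    (hc : c = c') : Rounds S T y M0 q P k K h θ Λ c' M := hc ▸ hI

/-- The total width is at most `S.n * T ≤ S.n * S.n` at the start, so `S.n * S.n` rounds exhaust it;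
with width zero there are no late jobs. -/
theorem run_rounds (hy : y ∈ schedLasserre S T r) (hT : IsTable y yR r) (hTn : T < S.n)
    (hρ : Params q P k K ρ) (hh : h ≤ S.n) {Λ : ℕ} (hΛ : Λ ≤ r) (hM : Static S T M)
    (hl : M 15 0 = h)
    (hC : (confOf M).Valid y h fun j ℓ => 2 ^ (h - (K + k)) * ℓ +
      (confOf M).pot S.n h (h - K) j ≤ 2 ^ (h - (K + k)) * Λ)
    (hR : (confOf M).Rest S T q P k h) {M1 : Mem}
    (hM1 : (Stmt.for' 11 (.for' 12 condStmt)).run yR ρ M = M1) :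
    Static S T M1 ∧ M1 15 0 = h ∧ M1 3 = M 3 ∧
      ((confOf M1).Valid y h fun j ℓ => 2 ^ (h - (K + k)) * ℓ +
        (confOf M1).pot S.n h (h - K) j ≤ 2 ^ (h - (K + k)) * Λ) ∧
      (confOf M1).Rest S T q P k h ∧
      ∀ j < S.n, (confOf M1).act j →
        ((confOf M1).late S (h - K) j).card < 2 ^ (h - (K + k)) := by
  have h0 : Rounds S T y M q P k K h (2 ^ (h - (K + k))) Λ 0 M := by
    refine ⟨hM, hl, rfl, hC, hR, Or.inr ?_⟩
    rw [add_zero]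
    unfold Conf.totalPot
    refine (Finset.sum_le_card_nsmul _ _ S.n fun i hi => ?_).trans ?_
    · simp only [Finset.mem_filter, Finset.mem_range] at hi
      have h1 := (hC.le hi.1 hi.2).2
      have h2 := Nat.div_le_self ((confOf M).b i) (2 ^ (h - K))
      exact (Nat.sub_le _ _).trans (h2.trans (by omega))
    · rw [smul_eq_mul]
      refine Nat.mul_le_mul_right _ ((Finset.card_filter_le _ _).trans ?_)
      rw [Finset.card_range]
  have hfin := run_for_inv (y := yR) (x := 11) (c := .for' 12 condStmt) (ρ := ρ) (M := M)
    (fun i M' => Rounds S T y M q P k K h (2 ^ (h - (K + k))) Λ (i * S.n) M')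
    (h0.congr (by simp))
    (fun i hi M2 _ hI => by
      have := run_for_inv (y := yR) (x := 12) (c := condStmt) (ρ := Function.update ρ 11 i)
        (M := M2)
        (fun i' M' => Rounds S T y M q P k K h (2 ^ (h - (K + k))) Λ (i * S.n + i') M')
        hI
        (fun i' hi' M3 _ hI3 => run_condStmt hy hT hTn
          ((hρ.update (by decide) _).update (by decide) _) hh hΛ hI3)
      exact this.congr (by rw [hI.static.n_eq]; ring))
  rw [hM1, hM.n_eq] at hfin
  refine ⟨hfin.static, hfin.level, hfin.act, hfin.valid, hfin.rest, ?_⟩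
  rcases hfin.pot with h1 | h1
  · exact h1
  · intro j hj ha
    have hz : (confOf M1).totalPot S.n (h - K) = 0 := by omega
    unfold Conf.totalPot at hz
    rw [Finset.sum_eq_zero_iff] at hz
    have : (confOf M1).late S (h - K) j = ∅ := by
      rw [Finset.eq_empty_iff_forall_notMem]
      intro i hi
      obtain ⟨g1, g2, -, g3⟩ := hfin.valid.late_block hi hj ha
      have := hz i (by simp [g1, g2])
      omega
    rw [this, Finset.card_empty]
    exact Nat.two_pow_pos _

end Fill

end SchedRounding

/-! ### The test for a suitable next level -/

namespace SchedRounding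

open BoundedLoops

section Fill
open scoped Classical

variable {S : SchedInstance} {T r : ℕ} {y : Finset (LPVar S.n T) → ℝ} {yR : ℕ → ℝ}
variable {q P k K h : ℕ} {ρ : ℕ → ℕ} {M M' : Mem}

theorem run_seq (c d : Stmt) : (Stmt.seq c d).run yR ρ M = d.run yR ρ (c.run yR ρ M) := rfl

theorem run_set_lit (a i : ℕ) (e : Ex) :
    (Stmt.set a (.lit i) e).run yR ρ M = put M a i (e.eval yR M ρ) := rfl

/-- The number of active jobs whose windows meet two blocks. -/
def crossEx (x : Ex) : Ex :=
  .count 22 (.and (.get 3 (.var 22)) (.not (.eq (.div (.get 5 (.var 22)) (powEx x))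
    (.div (.get 6 (.var 22)) (powEx x)))))

noncomputable def crossMem (n : ℕ) (M : Mem) (x : ℕ) : ℕ :=
  ((Finset.range n).filter fun i => M 3 i ≠ 0 ∧ M 5 i / M 17 x ≠ M 6 i / M 17 x).card

theorem eval_crossEx {x : Ex} {v : ℕ} (hM : Static S T M)
    (hx : ∀ i, x.eval yR M (Function.update ρ 22 i) = v) :
    (crossEx x).eval yR M ρ = crossMem S.n M v := by
  simp only [crossEx, eval_count, holds_and, holds_get, holds_not, holds_eq, eval_div, eval_get,
    eval_var, Function.update_self, eval_powEx, hx, hM.n_eq, crossMem]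

theorem crossMem_eq (hM : Static S T M) {x : ℕ} (hx : x ≤ S.n) :
    crossMem S.n M x = (confOf M).cross S.n x := by
  unfold crossMem Conf.cross
  rw [hM.pow x hx]
  congr 1
  ext i
  rw [Finset.mem_filter, Finset.mem_filter]
  exact Iff.rfl

/-- The level in array `16` is suitable. -/
def Suitable (S : SchedInstance) (T : ℕ) (M : Mem) (q P k x : ℕ) : Prop :=
  q * P * (crossMem S.n M x - crossMem S.n M (x + k)) ≤
    q * crossMem S.n M (x + k) + S.m * T

/-- Go to the next level if the level in array `16` is not suitable. -/
def critStmt : Stmt :=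
  .seq (.set 28 (.lit 0) (crossEx (cellEx 16 0)))
  (.seq (.set 28 (.lit 1) (crossEx (.add (cellEx 16 0) (.var 3))))
  (.seq (.set 28 (.lit 2) (.mul 20 (.sub (cellEx 28 0) (cellEx 28 1)) (.var 1)))
  (.seq (.set 28 (.lit 3) (.mul 20 (cellEx 28 2) (.var 2)))
  (.seq (.set 28 (.lit 4) (.mul 20 (cellEx 28 1) (.var 1)))
  (.seq (.set 28 (.lit 5) (.mul 20 mEx tEx))
  (.ite (.le (cellEx 28 3) (.add (cellEx 28 4) (cellEx 28 5))) .skip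
    (.set 16 (.lit 0) (.sub (cellEx 16 0) (.var 3)))))))))

theorem run_critStmt (hM : Static S T M) (hTn : T < S.n) (hρ : Params q P k K ρ) (hq : q ≤ S.n)
    (hP : P ≤ S.n) :
    critStmt.run yR ρ M 16 0 =
      if Suitable S T M q P k (M 16 0) then M 16 0 else M 16 0 - k := by
  set x := M 16 0 with hx
  set u := crossMem S.n M x with hu
  set w := crossMem S.n M (x + k) with hw
  set M1 := put M 28 0 u with hM1
  set M2 := put M1 28 1 w with hM2
  set M3 := put M2 28 2 ((u - w) * q) with hM3
  set M4 := put M3 28 3 ((u - w) * q * P) with hM4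
  set M5 := put M4 28 4 (w * q) with hM5
  set M6 := put M5 28 5 (S.m * T) with hM6
  have f1 : ∀ a, a ≠ 28 → M1 a = M a := fun a ha => put_of_ne _ _ _ ha
  have f2 : ∀ a, a ≠ 28 → M2 a = M a := fun a ha => (put_of_ne _ _ _ ha).trans (f1 a ha)
  have f3 : ∀ a, a ≠ 28 → M3 a = M a := fun a ha => (put_of_ne _ _ _ ha).trans (f2 a ha)
  have f4 : ∀ a, a ≠ 28 → M4 a = M a := fun a ha => (put_of_ne _ _ _ ha).trans (f3 a ha)
  have f5 : ∀ a, a ≠ 28 → M5 a = M a := fun a ha => (put_of_ne _ _ _ ha).trans (f4 a ha)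
  have f6 : ∀ a, a ≠ 28 → M6 a = M a := fun a ha => (put_of_ne _ _ _ ha).trans (f5 a ha)
  have v1 : (crossEx (cellEx 16 0)).eval yR M ρ = u := eval_crossEx hM fun _ => rfl
  have v2 : (crossEx (.add (cellEx 16 0) (.var 3))).eval yR M1 ρ = w := by
    rw [eval_crossEx (v := x + k) (hM.congr fun a ha => f1 a (by rintro rfl; simp at ha))
      fun i => by simp [f1 16 (by decide), hρ.k_eq, hx]]
    simp only [hw, crossMem, f1 3 (by decide), f1 5 (by decide), f1 6 (by decide),
      f1 17 (by decide)]
  have c1 : M2 28 0 = u := by rw [hM2, put_cell _ _ (by decide), hM1, put_self]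
  have c2 : M2 28 1 = w := put_self _ _ _ _
  have c3 : M3 28 2 = (u - w) * q := put_self _ _ _ _
  have c4 : M4 28 1 = w := by
    rw [hM4, put_cell _ _ (by decide), hM3, put_cell _ _ (by decide), c2]
  have c5 : M6 28 3 = (u - w) * q * P := by
    rw [hM6, put_cell _ _ (by decide), hM5, put_cell _ _ (by decide), hM4, put_self]
  have c6 : M6 28 4 = w * q := by rw [hM6, put_cell _ _ (by decide), hM5, put_self]
  have c7 : M6 28 5 = S.m * T := put_self _ _ _ _
  have v3 : (Ex.mul 20 (.sub (cellEx 28 0) (cellEx 28 1)) (.var 1)).eval yR M2 ρ =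
      (u - w) * q := by
    refine eval_mul _ _ _ _ _ _ (fun i => ?_) (fun i => ?_) ?_
    · simp only [eval_sub, eval_cellEx, c1, c2]
    · rw [eval_var, Function.update_of_ne (by decide), hρ.q_eq]
    · rw [f2 0 (by decide), hM.n_eq]; exact hq
  have v4 : (Ex.mul 20 (cellEx 28 2) (.var 2)).eval yR M3 ρ = (u - w) * q * P := by
    refine eval_mul _ _ _ _ _ _ (fun i => ?_) (fun i => ?_) ?_
    · rw [eval_cellEx, c3]
    · rw [eval_var, Function.update_of_ne (by decide), hρ.P_eq]
    · rw [f3 0 (by decide), hM.n_eq]; exact hP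
  have v5 : (Ex.mul 20 (cellEx 28 1) (.var 1)).eval yR M4 ρ = w * q := by
    refine eval_mul _ _ _ _ _ _ (fun i => ?_) (fun i => ?_) ?_
    · rw [eval_cellEx, c4]
    · rw [eval_var, Function.update_of_ne (by decide), hρ.q_eq]
    · rw [f4 0 (by decide), hM.n_eq]; exact hq
  have v6 : (Ex.mul 20 mEx tEx).eval yR M5 ρ = S.m * T := by
    refine eval_mul _ _ _ _ _ _ (fun i => ?_) (fun i => ?_) ?_
    · rw [eval_mEx, f5 0 (by decide), hM.m_eq]
    · rw [eval_tEx, f5 0 (by decide), hM.T_eq]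
    · rw [f5 0 (by decide), hM.n_eq]; exact hTn.le
  have hrun : critStmt.run yR ρ M = (Stmt.ite (.le (cellEx 28 3) (.add (cellEx 28 4) (cellEx 28 5)))
      .skip (.set 16 (.lit 0) (.sub (cellEx 16 0) (.var 3)))).run yR ρ M6 := by
    rw [critStmt, run_seq, run_set_lit, v1, ← hM1, run_seq, run_set_lit, v2, ← hM2, run_seq,
      run_set_lit, v3, ← hM3, run_seq, run_set_lit, v4, ← hM4, run_seq, run_set_lit, v5, ← hM5,
      run_seq, run_set_lit, v6]
  rw [hrun, run_ite]
  have hcond : (Ex.le (cellEx 28 3) (.add (cellEx 28 4) (cellEx 28 5))).Holds yR M6 ρ ↔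
      Suitable S T M q P k x := by
    simp only [holds_le, eval_add, eval_cellEx, c5, c6, c7, Suitable, ← hu, ← hw]
    rw [mul_comm w q, mul_comm (u - w) q, mul_right_comm]
  by_cases hs : Suitable S T M q P k x
  · rw [if_pos hs, if_pos (hcond.2 hs), Stmt.run, f6 16 (by decide)]
  · rw [if_neg hs, if_neg fun h => hs (hcond.1 h), run_set_lit, put_self, eval_sub, eval_cellEx,
      eval_var, f6 16 (by decide), hρ.k_eq]

end Fill

end SchedRounding

/-! ### The search for the next level and the removal of jobs -/

namespace SchedRounding

open BoundedLoops

section Fill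
open scoped Classical

variable {S : SchedInstance} {T r : ℕ} {y : Finset (LPVar S.n T) → ℝ} {yR : ℕ → ℝ}
variable {q P k K h : ℕ} {ρ : ℕ → ℕ} {M M' : Mem}

theorem Suitable.congr {x : ℕ} (h3 : M' 3 = M 3) (h5 : M' 5 = M 5) (h6 : M' 6 = M 6)
    (h17 : M' 17 = M 17) : Suitable S T M' q P k x ↔ Suitable S T M q P k x := by
  simp only [Suitable, crossMem, h3, h5, h6, h17]

/-- The candidates `h - k`, `h - 2 * k`, … are tried in turn. By `exists_level` one of the first `P
* k` is suitable, and `P * k * k ≤ K` keeps it at distance at most `K` from `h`. The bound `x ≤ h -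
k` holds in any case and guarantees progress. -/
theorem run_levels (hM : Static S T M) (hTn : T < S.n) (hρ : Params q P k K ρ) (hq : q < S.n)
    (hP : P < S.n) (h16 : M 16 0 = h - k) {x : ℕ}
    (hx : (Stmt.for' 11 critStmt).run yR ρ M 16 0 = x) :
    x ≤ h - k ∧ (1 ≤ P → q + 1 < 2 ^ k → P * k * k ≤ K → K < h → h ≤ q → 0 < S.m * T →
      S.n ≤ S.m * T → h ≤ x + K ∧ x + k ≤ h ∧ x < h ∧
        q * P * ((confOf M).cross S.n x - (confOf M).cross S.n (x + k)) ≤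
          q * (confOf M).cross S.n (x + k) + S.m * T) := by
  have hfin := run_for_inv (y := yR) (x := 11) (c := critStmt) (ρ := ρ) (M := M)
    (fun i M' => ∃ s ≤ i, M' 16 0 = h - k * (s + 1) ∧
      (∀ s' < s, ¬ Suitable S T M q P k (h - k * (s' + 1))) ∧
      (s = i ∨ Suitable S T M q P k (M' 16 0)))
    ⟨0, le_rfl, by rw [h16, zero_add, mul_one], fun s' hs => by omega, Or.inl rfl⟩
    (fun i hi M1 hM1 hI => by
      obtain ⟨s, hs, h1, h2, h3⟩ := hI
      have hS1 : Static S T M1 := hM.congr fun a ha => hM1 a (by revert a; decide)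
      have hsu : Suitable S T M1 q P k (M1 16 0) ↔ Suitable S T M q P k (M1 16 0) :=
        Suitable.congr (hM1 3 (by decide)) (hM1 5 (by decide)) (hM1 6 (by decide))
          (hM1 17 (by decide))
      rw [run_critStmt hS1 hTn (hρ.update (by decide) i) hq.le hP.le]
      by_cases hc : Suitable S T M q P k (M1 16 0)
      · rw [if_pos (hsu.2 hc)]
        exact ⟨s, by omega, h1, h2, Or.inr hc⟩
      · rw [if_neg fun h => hc (hsu.1 h)]
        obtain rfl : s = i := h3.resolve_right hc
        refine ⟨s + 1, le_rfl, ?_, fun s' hs' => ?_, Or.inl rfl⟩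
        · rw [h1, Nat.sub_sub, mul_add k (s + 1) 1, mul_one]
        · rcases Nat.lt_succ_iff_lt_or_eq.1 hs' with h4 | rfl
          · exact h2 s' h4
          · rwa [h1] at hc)
  rw [hM.n_eq, hx] at hfin
  obtain ⟨s, -, h1, h2, h3⟩ := hfin
  refine ⟨by rw [h1]; exact Nat.sub_le_sub_left (Nat.le_mul_of_pos_right _ (Nat.succ_pos _)) _,
    fun hP1 hk hPK hKh hhq hmT hnT => ?_⟩
  obtain ⟨s0, hs0, hsu⟩ := exists_level (q := q) (P := P) (k := k) (A := S.m * T)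
    (N := fun s => (confOf M).cross S.n (h - k * s)) hP1 hmT
    (fun s => by
      refine le_trans ?_ hnT
      exact (Finset.card_filter_le _ _).trans (by rw [Finset.card_range])) hk
  have hmulk : k * (s0 + 1) ≤ K := by
    calc k * (s0 + 1) ≤ k * (P * k) := Nat.mul_le_mul_left _ hs0
      _ = P * k * k := by ring
      _ ≤ K := hPK
  have hadd : ∀ s, s ≤ s0 → k * (s + 1) ≤ K ∧ h - k * (s + 1) + k = h - k * s := fun s hs => by
    have h4 : k * (s + 1) ≤ k * (s0 + 1) := Nat.mul_le_mul_left _ (by omega)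
    rw [mul_add k s 1, mul_one] at h4 ⊢
    omega
  have hcr : ∀ z, z ≤ h → crossMem S.n M z = (confOf M).cross S.n z := fun z hz =>
    crossMem_eq hM (by omega)
  have hss : s ≤ s0 := by
    by_contra hlt
    refine h2 s0 (by omega) ?_
    unfold Suitable
    rw [(hadd s0 le_rfl).2, hcr _ (Nat.sub_le _ _), hcr _ (Nat.sub_le _ _)]
    exact hsu
  obtain ⟨g1, g2⟩ := hadd s hss
  have hk0 : 0 < k := by
    rcases Nat.eq_zero_or_pos k with rfl | h0
    · simp at hk
    · exact h0
  have hk1 : k ≤ k * (s + 1) := Nat.le_mul_of_pos_right _ (Nat.succ_pos _)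
  -- The search has stopped early: `s ≤ s0 < K < h ≤ q < S.n`, so the loop did not run out of rounds
  -- and the level it holds is suitable.
  have hsn : s ≠ S.n := by
    have : s0 < K := hs0.trans_le (le_trans (Nat.le_mul_of_pos_right _ hk0) hPK)
    omega
  have h4 := h3.resolve_left hsn
  unfold Suitable at h4
  rw [hcr _ (by omega), hcr _ (by omega)] at h4
  exact ⟨by omega, by omega, by omega, h4⟩

/-- The greatest multiple of `f` that is at most `e`. -/
def floorEx (e f : Ex) : Ex := .sub e (.bin .mod e f)

theorem eval_floorEx (e f : Ex) :
    (floorEx e f).eval yR M ρ = e.eval yR M ρ / f.eval yR M ρ * f.eval yR M ρ := by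
  change e.eval yR M ρ - e.eval yR M ρ % f.eval yR M ρ = _
  have := Nat.div_add_mod' (e.eval yR M ρ) (f.eval yR M ρ)
  generalize e.eval yR M ρ / f.eval yR M ρ * f.eval yR M ρ = z at this ⊢
  omega

/-- Remove job number `11` if necessary. -/
def removeStmt : Stmt :=
  .ite (.get 3 (.var 11))
    (.ite (.eq (.div (.get 5 (.var 11)) (powEx (.add (cellEx 16 0) (.var 3))))
        (.div (.get 6 (.var 11)) (powEx (.add (cellEx 16 0) (.var 3)))))
      (.ite (.eq (.div (.get 5 (.var 11)) (powEx (cellEx 16 0)))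
          (.div (.get 6 (.var 11)) (powEx (cellEx 16 0))))
        .skip
        (.seq (.set 7 (.var 11) nEx) (.set 3 (.var 11) (.lit 0))))
      (.seq (.set 7 (.var 11) levelEx)
      (.seq (.set 8 (.var 11) (.add (floorEx (.get 5 (.var 11)) (powEx (cellEx 16 0)))
        (powEx (cellEx 16 0))))
      (.seq (.set 9 (.var 11) (floorEx (.get 6 (.var 11)) (powEx (cellEx 16 0))))
      (.seq (.set 10 (.var 11) (.get 6 (.var 11))) (.set 3 (.var 11) (.lit 0)))))))
    .skip

/-- What the removal does to job `j`. -/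
structure Removed (M M' : Mem) (n h L L2 j : ℕ) : Prop where
  same : M 3 j = 0 ∨ (M 5 j / L2 = M 6 j / L2 ∧ M 5 j / L = M 6 j / L) → ∀ a, M' a j = M a j
  mid : M 3 j ≠ 0 → M 5 j / L2 = M 6 j / L2 → M 5 j / L ≠ M 6 j / L → M' 3 j = 0 ∧ M' 7 j = n
  top : M 3 j ≠ 0 → M 5 j / L2 ≠ M 6 j / L2 → M' 3 j = 0 ∧ M' 7 j = h ∧
    M' 8 j = (M 5 j / L + 1) * L ∧ M' 9 j = M 6 j / L * L ∧ M' 10 j = M 6 j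

theorem run_removeStmt (hρ : Params q P k K ρ) {j : ℕ} (hj : ρ 11 = j) :
    Removed M (removeStmt.run yR ρ M) (M 0 0) (M 15 0) (M 17 (M 16 0)) (M 17 (M 16 0 + k)) j ∧
      ∀ a i, i ≠ j → removeStmt.run yR ρ M a i = M a i := by
  set L := M 17 (M 16 0) with hL
  set L2 := M 17 (M 16 0 + k) with hL2
  have c1 : (Ex.get 3 (.var 11)).Holds yR M ρ ↔ M 3 j ≠ 0 := by simp [hj]
  have c2 : (Ex.eq (.div (.get 5 (.var 11)) (powEx (.add (cellEx 16 0) (.var 3))))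
        (.div (.get 6 (.var 11)) (powEx (.add (cellEx 16 0) (.var 3))))).Holds yR M ρ ↔
      M 5 j / L2 = M 6 j / L2 := by simp [hj, hρ.k_eq, hL2]
  have c3 : (Ex.eq (.div (.get 5 (.var 11)) (powEx (cellEx 16 0)))
        (.div (.get 6 (.var 11)) (powEx (cellEx 16 0)))).Holds yR M ρ ↔
      M 5 j / L = M 6 j / L := by simp [hj, hL]
  rw [removeStmt, run_ite]
  by_cases h1 : M 3 j ≠ 0
  · rw [if_pos (c1.2 h1), run_ite]
    by_cases h2 : M 5 j / L2 = M 6 j / L2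
    · rw [if_pos (c2.2 h2), run_ite]
      by_cases h3 : M 5 j / L = M 6 j / L
      · rw [if_pos (c3.2 h3)]
        exact ⟨⟨fun _ _ => rfl, fun _ _ h => absurd h3 h, fun _ h => absurd h2 h⟩,
          fun _ _ _ => rfl⟩
      · rw [if_neg fun h => h3 (c3.1 h)]
        simp only [Stmt.run, eval_var, hj, eval_nEx, eval_lit]
        refine ⟨⟨fun h => ?_, fun _ _ _ => ⟨put_self _ _ _ _, ?_⟩, fun _ h => absurd h2 h⟩,
          fun a i hi => ?_⟩
        · exact absurd (h.resolve_left h1).2 h3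
        · rw [put_of_ne _ _ _ (by decide), put_self]
        · rw [put_cell _ _ hi, put_cell _ _ hi]
    · rw [if_neg fun h => h2 (c2.1 h)]
      simp only [Stmt.run, eval_var, hj, eval_levelEx, eval_lit, eval_floorEx, eval_add, eval_get,
        eval_powEx, eval_cellEx]
      refine ⟨⟨fun h => absurd (h.resolve_left h1).1 h2, fun _ h => absurd h h2, fun _ _ => ?_⟩,
        fun a i hi => ?_⟩
      · simp [put_self, put_of_ne, ← hL, add_mul]
      · rw [put_cell _ _ hi, put_cell _ _ hi, put_cell _ _ hi, put_cell _ _ hi, put_cell _ _ hi]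
  · rw [if_neg fun h => h1 (c1.1 h)]
    exact ⟨⟨fun _ _ => rfl, fun h => absurd h h1, fun h => absurd h h1⟩, fun _ _ _ => rfl⟩

theorem run_removal (hn : M 0 0 = S.n) (hρ : Params q P k K ρ) :
    Conf.Remove S.n (confOf M) (confOf ((Stmt.for' 11 removeStmt).run yR ρ M)) (M 15 0)
      (M 17 (M 16 0)) (M 17 (M 16 0 + k)) := by
  have hfin := run_for_inv (y := yR) (x := 11) (c := removeStmt) (ρ := ρ) (M := M)
    (fun i M' => (∀ j, j < i →
      Removed M M' S.n (M 15 0) (M 17 (M 16 0)) (M 17 (M 16 0 + k)) j) ∧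
      ∀ j, i ≤ j → ∀ a, M' a j = M a j)
    ⟨fun j hj => by omega, fun _ _ _ => rfl⟩
    (fun i hi M1 hM1 hI => by
      obtain ⟨h1, h2⟩ := run_removeStmt (yR := yR) (M := M1) (hρ.update (by decide) i : Params q P k K
        (Function.update ρ 11 i)) (Function.update_self _ _ _)
      refine ⟨fun j hj => ?_, fun j hj a => ?_⟩
      · by_cases hji : j = i
        · subst hji
          have e := hI.2 j le_rfl
          rw [hM1 0 (by decide), hM1 15 (by decide), hM1 16 (by decide), hM1 17 (by decide),
            hn] at h1
          obtain ⟨g1, g2, g3⟩ := h1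
          simp only [e] at g1 g2 g3
          exact ⟨g1, g2, g3⟩
        · obtain ⟨g1, g2, g3⟩ := hI.1 j (by omega)
          refine ⟨?_, ?_, ?_⟩
          all_goals simp only [h2 _ j hji]
          · exact g1
          · exact g2
          · exact g3
      · rw [h2 a j (by omega), hI.2 j (by omega) a])
  rw [hn] at hfin
  set M1 := (Stmt.for' 11 removeStmt).run yR ρ M with hM1
  have e : ∀ a, a ∉ [3, 7, 8, 9, 10] → M1 a = M a := fun a ha =>
    Stmt.run_of_notMem_writes yR a _ _ _ (by
      have : ∀ a, a ∈ (Stmt.for' 11 removeStmt).writes → a ∈ [3, 7, 8, 9, 10] := by decide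
      exact fun h => ha (this a h))
  refine ⟨e 5 (by decide), e 6 (by decide), e 4 (by decide), fun j hj ha => ?_,
    fun j hj ha h1 => ?_, fun j hj ha h1 h2 => ?_, fun j hj ha h1 h2 => ?_⟩
  all_goals
    have hj1 := hfin.1 j hj
    simp only [confOf] at *
  · have := hj1.same (Or.inl (not_not.1 ha))
    simp only [this]
    exact ⟨ha, trivial, trivial, trivial, trivial⟩
  · obtain ⟨g1, g2⟩ := hj1.top ha h1
    exact ⟨not_not.2 g1, g2⟩
  · obtain ⟨g1, g2⟩ := hj1.mid ha h1 h2
    exact ⟨not_not.2 g1, g2⟩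
  · rw [hj1.same (Or.inr ⟨h1, h2⟩)]
    exact ha

end Fill

end SchedRounding

/-! ### One stage and the whole forward pass -/

namespace SchedRounding

open BoundedLoops

section Fill
open scoped Classical

variable {S : SchedInstance} {T r : ℕ} {y : Finset (LPVar S.n T) → ℝ} {yR : ℕ → ℝ}
variable {q P k K h : ℕ} {ρ : ℕ → ℕ} {M M' : Mem}

/-- One stage: conditioning, choice of the next level, removal of jobs. -/
def stageStmt : Stmt :=
  .seq (.for' 11 (.for' 12 condStmt))
  (.seq (.set 16 (.lit 0) (.sub levelEx (.var 3)))
  (.seq (.for' 11 critStmt)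
  (.seq (.for' 11 removeStmt) (.set 15 (.lit 0) (cellEx 16 0)))))

/-- The parameters are suitable. -/
structure Admissible (S : SchedInstance) (T r q P k K : ℕ) : Prop where
  T_lt : T < S.n
  q_lt : q < S.n
  P_lt : P < S.n
  k_pos : 1 ≤ k
  pos : 0 < S.m * T
  n_le : S.n ≤ S.m * T
  T_le : T ≤ 2 ^ q
  budget : q * stageBudget S.m k K ≤ r ∨ q ≤ K ∧ S.n * S.n ≤ r
  -- Either no level has to be chosen, or `exists_level` applies and its level is within distance
  -- `K`.
  growth : q ≤ K ∨ 1 ≤ P ∧ q + 1 < 2 ^ k ∧ P * k * k ≤ K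

/-- The invariant of the stages. -/
structure PassInv (S : SchedInstance) (T r : ℕ) (y : Finset (LPVar S.n T) → ℝ) (q P k K h : ℕ)
    (M : Mem) : Prop where
  static : Static S T M
  level : M 15 0 = h
  le : h ≤ q
  valid : (confOf M).Valid y h ((confOf M).Budget S r q k K h)
  rest : (confOf M).Rest S T q P k h
  exact_act : q ≤ K → ∀ j < S.n, (confOf M).act j

theorem Conf.Valid.mono {C : Conf} {Q Q' : ℕ → ℕ → Prop} (hC : C.Valid y h Q)
    (hQ : ∀ j ℓ, Q j ℓ → Q' j ℓ) : C.Valid y h Q' :=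
  ⟨fun j hj ha => let ⟨ℓ, c, h1, h2⟩ := hC.job j hj ha; ⟨ℓ, c, hQ j ℓ h1, h2⟩, hC.code, hC.block,
    hC.lt⟩

theorem PassInv.stage (hy : y ∈ schedLasserre S T r) (hT : IsTable y yR r)
    (hA : Admissible S T r q P k K) (hρ : Params q P k K ρ) (hI : PassInv S T r y q P k K h M) :
    ∃ h' ≤ h - 1, PassInv S T r y q P k K h' (stageStmt.run yR ρ M) := by
  have hQ : ∀ j ℓ, (confOf M).Budget S r q k K h j ℓ → ℓ ≤ r := fun j ℓ hb => hb.le hA.budget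
  have hhn : h ≤ S.n := hI.le.trans hA.q_lt.le
  have hΛ : stageLimit S r q k K h ≤ r := stageLimit_le hA.budget
  obtain ⟨hS1, hl1, h31, hC1, hR1, hlate⟩ := run_rounds hy hT hA.T_lt hρ hhn hΛ hI.static hI.level
    (hI.valid.mono fun j ℓ hb => hb.start hy hI.valid hQ hI.le) hI.rest rfl
  set M1 := (Stmt.for' 11 (.for' 12 condStmt)).run yR ρ M with hM1
  set M2 := put M1 16 0 (h - k) with hM2
  have hS2 : Static S T M2 := hS1.congr fun a ha =>
    put_of_ne _ _ _ (by rintro rfl; simp at ha)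
  obtain ⟨hx, hlev⟩ := run_levels (yR := yR) hS2 hA.T_lt hρ hA.q_lt hA.P_lt (h := h)
    (put_self _ _ _ _) rfl
  set M3 := (Stmt.for' 11 critStmt).run yR ρ M2 with hM3
  set x := M3 16 0 with hx16
  have e3 : ∀ a, a ∉ [16, 28] → M3 a = M1 a := fun a ha => by
    have h1 : M3 a = M2 a := Stmt.run_of_notMem_writes yR a _ _ _ (by
      have : ∀ a, a ∈ (Stmt.for' 11 critStmt).writes → a ∈ [16, 28] := by decide
      exact fun h => ha (this a h))
    rw [h1]
    exact put_of_ne _ _ _ (by rintro rfl; simp at ha)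
  have hS3 : Static S T M3 := hS2.run (by decide)
  have hconf2 : confOf M2 = confOf M1 := rfl
  have hconf3 : confOf M3 = confOf M1 := by
    simp only [confOf, e3 3 (by decide), e3 4 (by decide), e3 5 (by decide), e3 6 (by decide),
      e3 7 (by decide), e3 8 (by decide), e3 9 (by decide), e3 10 (by decide)]
  have hrm := run_removal (yR := yR) hS3.n_eq hρ
  set M4 := (Stmt.for' 11 removeStmt).run yR ρ M3 with hM4
  rw [hconf3, e3 15 (by decide), hl1, ← hx16] at hrm
  have e4 : M4 16 = M3 16 := Stmt.run_of_notMem_writes yR 16 _ _ _ (by decide)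
  have hrun : stageStmt.run yR ρ M = put M4 15 0 x := by
    have : stageStmt.run yR ρ M = put M4 15 0 (M4 16 0) := by
      simp only [hM4, hM3, hM2, hM1, stageStmt, run_seq, run_set_lit, eval_sub, eval_levelEx,
        eval_var, eval_cellEx, hρ.k_eq]
      rw [← hM1, hl1]
    rw [this, e4]
  have hconf5 : confOf (put M4 15 0 x) = confOf M4 := rfl
  have hS5 : Static S T (put M4 15 0 x) :=
    (hS3.run (c := .for' 11 removeStmt) (by decide)).congr fun a ha =>
      put_of_ne _ _ _ (by rintro rfl; simp at ha)
  have hk := hA.k_pos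
  have hx1 : x ≤ h - 1 := by omega
  have hxh : x ≤ h := by omega
  have hp : M3 17 x = 2 ^ x := hS3.pow x (hxh.trans hhn)
  rw [hp] at hrm
  have hQ1 : ∀ j ℓ, 2 ^ (h - (K + k)) * ℓ + (confOf M1).pot S.n h (h - K) j ≤
      2 ^ (h - (K + k)) * stageLimit S r q k K h → ℓ ≤ r := fun j ℓ hb =>
    (Nat.le_of_mul_le_mul_left ((Nat.le_add_right _ _).trans hb) (Nat.two_pow_pos _)).trans hΛ
  have hvalid : (confOf M4).Valid y x ((confOf M4).Budget S r q k K x) :=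
    hC1.remove hxh hrm fun j hj ha ℓ hb =>
      Conf.Budget.finish hA.budget hI.le hx1 hrm.a hrm.b
        (fun i hi hia => (hrm.of_act hi hia).1) hb
  rw [hrun]
  -- For `h ≤ K` both exponents vanish: `θ = 1` and pieces are single slots. A job counts as late
  -- for itself, so the absence of late jobs makes all windows points and the removal does nothing.
  rcases le_or_gt h K with hhK | hhK
  · have hpt : ∀ j < S.n, (confOf M1).act j → (confOf M1).a j = (confOf M1).b j := by
      intro j hj ha
      have h1 := hlate j hj ha
      rw [Nat.sub_eq_zero_of_le (hhK.trans (Nat.le_add_right _ _)), Nat.sub_eq_zero_of_le hhK,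
        pow_zero, Nat.lt_one_iff, Finset.card_eq_zero] at h1
      refine le_antisymm (hC1.le hj ha).1 ?_
      by_contra hlt
      have : j ∈ (confOf M1).late S 0 j := by
        simp only [Conf.late, Finset.mem_filter, Finset.mem_range, pow_zero, Nat.div_one]
        exact ⟨hj, ha, Or.inl trivial, not_le.1 hlt⟩
      rw [h1] at this
      simp at this
    obtain ⟨g1, g2⟩ := hR1.remove_of_points hxh hA.q_lt hI.le hpt hrm
    refine ⟨x, hx1, hS5, put_self _ _ _ _, hxh.trans hI.le, hvalid, g1, fun hqK j hj => ?_⟩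
    rw [hconf5, g2 j hj]
    have := hI.exact_act hqK j hj
    simp only [confOf] at this ⊢
    rwa [h31]
  · obtain ⟨hP, hkq, hPK⟩ := hA.growth.resolve_left (by have := hI.le; omega)
    obtain ⟨g1, g2, g3, g4⟩ := hlev hP hkq hPK hhK hI.le hA.pos hA.n_le
    rw [hconf2] at g4
    have hp2 : M3 17 (x + k) = 2 ^ (x + k) := hS3.pow _ (g2.trans hhn)
    rw [hp2] at hrm
    have hrest := hR1.remove hy hA.T_lt hC1 hQ1 hI.le hA.q_lt g3 g1 hrm hlate g4
    exact ⟨x, hx1, hS5, put_self _ _ _ _, hxh.trans hI.le, hvalid, hrest,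
      fun hqK => absurd hI.le (by omega)⟩

/-- The preparation of the forward pass. -/
def startStmt : Stmt :=
  .seq (.set 15 (.lit 0) (.var 1))
  (.seq (.for' 10 (.set 3 (.var 10) (.lit 1)))
  (.seq (.for' 10 (.set 4 (.var 10) (.lit 0)))
  (.for' 10 (windowStmt 10))))

theorem PassInv.start (hy : y ∈ schedLasserre S T r) (hT : IsTable y yR r)
    (hA : Admissible S T r q P k K) (hρ : Params q P k K ρ) (hM : Static S T M) :
    PassInv S T r y q P k K q (startStmt.run yR ρ M) := by
  set M1 := put M 15 0 q with hM1
  have hS1 : Static S T M1 := hM.congr fun a ha =>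
    put_of_ne _ _ _ (by rintro rfl; simp at ha)
  set M2 := (Stmt.for' 10 (.set 3 (.var 10) (.lit 1))).run yR ρ M1 with hM2
  have hS2 : Static S T M2 := hS1.run (by decide)
  have v2 : ∀ j < M1 0 0, M2 3 j = 1 := run_fill (fun _ => 1) fun _ _ _ _ _ => rfl
  set M3 := (Stmt.for' 10 (.set 4 (.var 10) (.lit 0))).run yR ρ M2 with hM3
  have hS3 : Static S T M3 := hS2.run (by decide)
  have v3 : ∀ j < M2 0 0, M3 4 j = 0 := run_fill (fun _ => 0) fun _ _ _ _ _ => rfl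
  have v4 := run_for_inv (y := yR) (x := 10) (c := windowStmt 10) (ρ := ρ) (M := M3)
    (fun i M' => ∀ j < i, Reads yR T (M3 4 j + j * T) (M' 5 j) (M' 6 j))
    (fun j hj => by omega)
    (fun i hi M' hM' hI j hj => by
      rw [hS3.n_eq] at hi
      have hS' : Static S T M' := hS3.congr fun a ha => hM' a (by revert a; decide)
      obtain ⟨h1, -, h3⟩ := run_windowStmt (yR := yR) (x := 10) (ρ := Function.update ρ 10 i) hS'
        hA.T_lt (by decide) (by decide) (Function.update_self _ _ _) hi
      by_cases hji : j = i
      · subst hji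
        rwa [hM' 4 (by decide)] at h3
      · rw [h1 5 j hji, h1 6 j hji]
        exact hI j (by omega))
  set M4 := (Stmt.for' 10 (windowStmt 10)).run yR ρ M3 with hM4
  have hrun : startStmt.run yR ρ M = M4 := by
    rw [startStmt, run_seq, run_set_lit, eval_var, hρ.q_eq]
    rfl
  rw [hS1.n_eq] at v2
  rw [hS2.n_eq] at v3
  rw [hS3.n_eq] at v4
  have e4 : ∀ a, a ∉ [5, 6] → M4 a = M3 a := fun a ha =>
    Stmt.run_of_notMem_writes yR a _ _ _ (by
      have : ∀ a, a ∈ (Stmt.for' 10 (windowStmt 10)).writes → a ∈ [5, 6] := by decide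
      exact fun h => ha (this a h))
  have e3 : ∀ a, a ≠ 4 → M3 a = M2 a := fun a ha =>
    Stmt.run_of_notMem_writes yR a _ _ _ (by simpa [Stmt.writes] using ha)
  have e2 : ∀ a, a ≠ 3 → M2 a = M1 a := fun a ha =>
    Stmt.run_of_notMem_writes yR a _ _ _ (by simpa [Stmt.writes] using ha)
  have hact : ∀ j < S.n, (confOf M4).act j := fun j hj => by
    simp only [confOf, e4 3 (by decide), e3 3 (by decide), v2 j hj]
    exact one_ne_zero
  rw [hrun]
  obtain ⟨h1, h2⟩ := Conf.valid_init (C := confOf M4) (P := P) hy hT hA.T_lt hA.budget hA.T_le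
    hact
    (fun j hj => by simp only [confOf, e4 4 (by decide), v3 j hj])
    (fun j hj => by simp only [confOf, e4 4 (by decide)]; exact v4 j hj)
  refine ⟨hS3.run (by decide), ?_, le_rfl, h1, h2, fun _ => hact⟩
  rw [e4 15 (by decide), e3 15 (by decide), e2 15 (by decide), hM1, put_self]

/-- The input of the greedy placement for the jobs that are active at the end. -/
def settleStmt : Stmt :=
  .for' 10 (.ite (.get 3 (.var 10))
    (.seq (.set 7 (.var 10) (.lit 0))
    (.seq (.set 8 (.var 10) (.get 5 (.var 10)))
    (.seq (.set 9 (.var 10) (.add (.get 6 (.var 10)) (.lit 1)))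
    (.set 10 (.var 10) (.get 6 (.var 10)))))) .skip)

theorem run_settleStmt (hM : Static S T M) :
    (confOf M).Agrees S (greedyInput (Pr S) (settleStmt.run yR ρ M)) := by
  have hS : Static S T (settleStmt.run yR ρ M) := hM.run (by decide)
  have hfin := run_for_inv (y := yR) (x := 10) (c := .ite (.get 3 (.var 10))
    (.seq (.set 7 (.var 10) (.lit 0))
    (.seq (.set 8 (.var 10) (.get 5 (.var 10)))
    (.seq (.set 9 (.var 10) (.add (.get 6 (.var 10)) (.lit 1)))
    (.set 10 (.var 10) (.get 6 (.var 10)))))) .skip) (ρ := ρ) (M := M)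
    (fun i M' => (∀ j, j < i → if M 3 j ≠ 0 then
      M' 7 j = 0 ∧ M' 8 j = M 5 j ∧ M' 9 j = M 6 j + 1 ∧ M' 10 j = M 6 j
      else ∀ a, M' a j = M a j) ∧ ∀ j, i ≤ j → ∀ a, M' a j = M a j)
    ⟨fun j hj => by omega, fun _ _ _ => rfl⟩
    (fun i hi M1 hM1 hI => by
      have e := hI.2 i le_rfl
      rw [run_ite]
      by_cases h3 : M 3 i ≠ 0
      · have hc : (Ex.get 3 (.var 10)).Holds yR M1 (Function.update ρ 10 i) := by
          simp only [holds_get, eval_var, Function.update_self, e]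
          exact h3
        rw [if_pos hc]
        simp only [Stmt.run, eval_var, Function.update_self, eval_lit, eval_get, eval_add]
        refine ⟨fun j hj => ?_, fun j hj a => ?_⟩
        · by_cases hji : j = i
          · subst hji
            rw [if_pos h3]
            simp [put_self, put_of_ne, e]
          · simp only [put_cell _ _ hji]
            exact hI.1 j (by omega)
        · have hji : j ≠ i := by omega
          simp only [put_cell _ _ hji]
          exact hI.2 j (by omega) a
      · have hc : ¬ (Ex.get 3 (.var 10)).Holds yR M1 (Function.update ρ 10 i) := by
          simp only [holds_get, eval_var, Function.update_self, e]
          exact h3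
        rw [if_neg hc, Stmt.run]
        refine ⟨fun j hj => ?_, fun j hj => hI.2 j (by omega)⟩
        by_cases hji : j = i
        · subst hji
          rw [if_neg h3]
          exact e
        · exact hI.1 j (by omega))
  rw [hM.n_eq] at hfin
  change _ ∧ _ at hfin
  obtain ⟨hfin, -⟩ := hfin
  refine ⟨hS.n_eq, hS.m_eq, rfl, fun j hj => ?_, fun j hj => ?_, fun j hj => ?_, fun j hj => ?_⟩
  all_goals
    have hj1 := hfin j hj
    simp only [greedyInput, Conf.toGreedy, confOf]
    by_cases h3 : M 3 j ≠ 0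
  · rw [if_pos h3] at hj1
    simp only [h3, ne_eq, not_false_eq_true, if_true]
    exact hj1.1
  · rw [if_neg h3] at hj1
    simp only [h3, if_false]
    exact hj1 7
  · rw [if_pos h3] at hj1
    simp only [h3, ne_eq, not_false_eq_true, if_true]
    exact hj1.2.2.2
  · rw [if_neg h3] at hj1
    simp only [h3, if_false]
    exact hj1 10
  · rw [if_pos h3] at hj1
    simp only [h3, ne_eq, not_false_eq_true, if_true]
    exact hj1.2.1
  · rw [if_neg h3] at hj1
    simp only [h3, if_false]
    exact hj1 8
  · rw [if_pos h3] at hj1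
    simp only [h3, ne_eq, not_false_eq_true, if_true]
    exact hj1.2.2.1
  · rw [if_neg h3] at hj1
    simp only [h3, if_false]
    exact hj1 9

/-- The forward pass. -/
def fillStmt : Stmt := .seq startStmt (.seq (.for' 10 stageStmt) settleStmt)

/-- Every stage lowers the level by at least one, so more than `q` stages reach level `0`; the
remaining ones keep it there. -/
theorem run_fillStmt (hy : y ∈ schedLasserre S T r) (hT : IsTable y yR r)
    (hA : Admissible S T r q P k K) (hρ : Params q P k K ρ) (hM : Static S T M) :
    ∃ M0, PassInv S T r y q P k K 0 M0 ∧
      (confOf M0).Agrees S (greedyInput (Pr S) (fillStmt.run yR ρ M)) := by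
  have h1 := PassInv.start hy hT hA hρ hM
  set M1 := startStmt.run yR ρ M with hM1
  have h2 := run_for_inv (y := yR) (x := 10) (c := stageStmt) (ρ := ρ) (M := M1)
    (fun i M' => ∃ h ≤ q - i, PassInv S T r y q P k K h M')
    ⟨q, by omega, h1⟩
    (fun i hi M' _ hI => by
      obtain ⟨h, hh, hI⟩ := hI
      obtain ⟨h', hh', hI'⟩ := hI.stage hy hT hA (hρ.update (x := 10) (by decide) i)
      exact ⟨h', by omega, hI'⟩)
  rw [h1.static.n_eq] at h2
  obtain ⟨h, hh, hI⟩ := h2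
  obtain rfl : h = 0 := by have := hA.q_lt; omega
  exact ⟨_, hI, run_settleStmt hI.static⟩

/-- The schedule that is obtained from the forward pass with suitable parameters. -/
theorem run_eval_fillStmt (hy : y ∈ schedLasserre S T r) (hT : IsTable y yR r)
    (hA : Admissible S T r q P k K) (hρ : Params q P k K ρ) (hM : Static S T M) :
    ∃ U, (∀ j < S.n, evalStmt.run yR ρ (fillStmt.run yR ρ M) 13 j ≤ T + U) ∧
      (∃ mid, 2 ^ k * U ≤ 2 ^ k * mid + q * (3 * S.m * T) ∧
        q * P * mid ≤ q * S.n + q * (S.m * T)) ∧ (q ≤ K → U = 0) := by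
  obtain ⟨M0, hI, hAg⟩ := run_fillStmt hy hT hA hρ hM
  have hS : Static S T (fillStmt.run yR ρ M) := hM.run (by decide)
  obtain ⟨pl, sg, np, base, kap, hG, hIns⟩ := run_evalStmt (y := yR) (ρ := ρ) hS
  obtain ⟨h1, h2, h3⟩ := hAg.bound hy hA.T_lt hI.valid (fun j ℓ hb => hb.le hA.budget) hI.rest
    hA.q_lt hG
  exact ⟨_, fun j hj => hIns.le_add h1 hj, h2, fun hqK => h3 (hI.exact_act hqK)⟩

end Fill

end SchedRounding

/-! ### Deciding that a program is closed -/

namespace BoundedLoops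

instance Ex.decidableWF : ∀ (Γ : List ℕ) (e : Ex), Decidable (e.WF Γ)
  | _, .lit _ => isTrue trivial
  | Γ, .var x => inferInstanceAs (Decidable (x ∈ Γ))
  | Γ, .get a i =>
    have := Ex.decidableWF Γ i
    inferInstanceAs (Decidable (¬ Reserved a ∧ i.WF Γ))
  | Γ, .bin _ e f =>
    have := Ex.decidableWF Γ e
    have := Ex.decidableWF Γ f
    inferInstanceAs (Decidable (e.WF Γ ∧ f.WF Γ))
  | Γ, .pos e => Ex.decidableWF Γ e
  | Γ, .cond b e f =>
    have := Ex.decidableWF Γ b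
    have := Ex.decidableWF Γ e
    have := Ex.decidableWF Γ f
    inferInstanceAs (Decidable (b.WF Γ ∧ e.WF Γ ∧ f.WF Γ))
  | Γ, .sum x e =>
    have := Ex.decidableWF (x :: Γ) e
    inferInstanceAs (Decidable (x ∉ Γ ∧ e.WF (x :: Γ)))

instance Stmt.decidableWF : ∀ (Γ : List ℕ) (c : Stmt), Decidable (c.WF Γ)
  | _, .skip => isTrue trivial
  | Γ, .set a i e => inferInstanceAs (Decidable ((¬ Reserved a ∧ a ≠ 0) ∧ i.WF Γ ∧ e.WF Γ))
  | Γ, .seq c d =>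
    have := Stmt.decidableWF Γ c
    have := Stmt.decidableWF Γ d
    inferInstanceAs (Decidable (c.WF Γ ∧ d.WF Γ))
  | Γ, .ite b c d =>
    have := Stmt.decidableWF Γ c
    have := Stmt.decidableWF Γ d
    inferInstanceAs (Decidable (b.WF Γ ∧ c.WF Γ ∧ d.WF Γ))
  | Γ, .for' x c =>
    have := Stmt.decidableWF (x :: Γ) c
    inferInstanceAs (Decidable (x ∉ Γ ∧ c.WF (x :: Γ)))

end BoundedLoops

namespace SchedRounding

open BoundedLoops

theorem wf_searchStmt : (searchStmt fillStmt).WF [] := by decide +kernel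

theorem keepsStatic_fillStmt : KeepsStatic fillStmt := by decide

theorem notMem_writes_fillStmt : 2 ∉ fillStmt.writes := by decide

/-! ### Estimates with logarithms -/

section Logs

/-- The budget of all stages. -/
theorem budget_le_rpow {X L q m P k K : ℝ} (hX : 1 ≤ X) (hL : 1 / 2 ≤ L) (hm : 0 ≤ m)
    (hmX : m ≤ X) (hq : q ≤ 2 ^ (4 * L)) (hP : P ≤ 5 * X) (hk0 : 0 ≤ k)
    (hk : (2 : ℝ) ^ k ≤ 26 * 2 ^ (4 * L) * X) (hK : K = P * k * k) :
    q * (m * 2 ^ (2 * K + k)) ≤ 2 ^ (4000 * X ^ 2 * L ^ 2) := by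
  -- Since `k` is logarithmic in `X`, the crude bound `X ≤ 2 ^ (2 * √X)` still gives `k = O(L *
  -- √X)`. Thus `k * k` costs a single factor `X`, and `K = P * k * k` is `O(X ^ 2 * L ^ 2)`.
  set s := √X with hs
  have hs1 : 1 ≤ s := Real.one_le_sqrt.2 hX
  have hss : s ^ 2 = X := Real.sq_sqrt (by linarith)
  -- a logarithmic bound
  have hbern : ∀ u : ℝ, 1 ≤ u → u ≤ 2 ^ u := fun u hu => by
    have := one_add_mul_self_le_rpow_one_add (s := (1 : ℝ)) (by norm_num) hu
    norm_num at this
    linarith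
  have hX2 : X ≤ 2 ^ (2 * s) := by
    have h1 := hbern s hs1
    calc X = s * s := by rw [← hss]; ring
      _ ≤ 2 ^ s * 2 ^ s := by gcongr
      _ = 2 ^ (2 * s) := by rw [← Real.rpow_add two_pos]; ring_nf
  have hkle : k ≤ 5 + 4 * L + 2 * s := by
    have h1 : (2 : ℝ) ^ k ≤ 2 ^ (5 + 4 * L + 2 * s) := by
      calc (2 : ℝ) ^ k ≤ 26 * 2 ^ (4 * L) * X := hk
        _ ≤ 2 ^ (5 : ℝ) * 2 ^ (4 * L) * 2 ^ (2 * s) := by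
          gcongr
          norm_num
        _ = _ := by rw [← Real.rpow_add two_pos, ← Real.rpow_add two_pos]
    exact (Real.rpow_le_rpow_left_iff one_lt_two).1 h1
  have hLs : L ≤ L * s := le_mul_of_one_le_right (by linarith) hs1
  have hsL : s ≤ 2 * (L * s) := by nlinarith
  have hkle' : k ≤ 18 * (L * s) := by linarith
  have hLs0 : 0 ≤ L * s := by positivity
  have hk2 : k * k ≤ 324 * (L ^ 2 * X) := by
    calc k * k ≤ (18 * (L * s)) * (18 * (L * s)) := by gcongr
      _ = 324 * (L ^ 2 * s ^ 2) := by ring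
      _ = _ := by rw [hss]
  have hKle : K ≤ 1620 * (X ^ 2 * L ^ 2) := by
    calc K = P * (k * k) := by rw [hK]; ring
      _ ≤ 5 * X * (324 * (L ^ 2 * X)) := by gcongr
      _ = _ := by ring
  have hsX : s ≤ X := by nlinarith
  have hLX : L * X ≤ 2 * (X ^ 2 * L ^ 2) := by
    have : 1 / 2 ≤ L * X := by nlinarith
    nlinarith
  have hk3 : k ≤ 36 * (X ^ 2 * L ^ 2) := by
    have : L * s ≤ L * X := by gcongr
    linarith
  have h4L : 4 * L ≤ 8 * (X ^ 2 * L ^ 2) := by nlinarith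
  have hXX : X ≤ 4 * (X ^ 2 * L ^ 2) := by nlinarith
  have hm2 : m ≤ 2 ^ X := hmX.trans (hbern X hX)
  calc q * (m * 2 ^ (2 * K + k)) ≤ 2 ^ (4 * L) * (2 ^ X * 2 ^ (2 * K + k)) := by gcongr
    _ = 2 ^ (4 * L + (X + (2 * K + k))) := by
      rw [← Real.rpow_add two_pos, ← Real.rpow_add two_pos]
    _ ≤ _ := by
      -- In units of `X ^ 2 * L ^ 2` the exponents sum to at most `8 + 4 + 2 * 1620 + 36`, below
      -- `4000`.
      apply Real.rpow_le_rpow_of_exponent_le one_le_two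
      linarith

/-- The two bounds reduce to `2 ^ 3 ≤ 3 ^ 2` and `2 ≤ (3 / 2) ^ 2`. -/
theorem logb_logb_ge {n : ℕ} (hn : 3 ≤ n) :
    3 / 2 ≤ Real.logb 2 n ∧ 1 / 2 ≤ Real.logb 2 (Real.logb 2 n) := by
  have h1 : (3 : ℝ) / 2 ≤ Real.logb 2 n := by
    have hn' : (3 : ℝ) ≤ n := by exact_mod_cast hn
    rw [Real.le_logb_iff_rpow_le one_lt_two (by linarith)]
    refine le_trans ?_ hn'
    refine (pow_le_pow_iff_left₀ (by positivity) (by norm_num) two_ne_zero).1 ?_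
    rw [← Real.rpow_natCast, ← Real.rpow_mul two_pos.le]
    norm_num
  refine ⟨h1, ?_⟩
  rw [Real.le_logb_iff_rpow_le one_lt_two (by linarith)]
  refine le_trans ?_ h1
  refine (pow_le_pow_iff_left₀ (by positivity) (by norm_num) two_ne_zero).1 ?_
  rw [← Real.rpow_natCast, ← Real.rpow_mul two_pos.le]
  norm_num

end Logs

end SchedRounding

/-! ### Choice of the parameters and conclusion -/

namespace SchedRounding

open BoundedLoops

variable {S : SchedInstance} {T r : ℕ} {ε : ℝ} {y : Finset (LPVar S.n T) → ℝ}

theorem le_mul_of_mem_schedLasserre (hy : y ∈ schedLasserre S T r) : S.n ≤ S.m * T := by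
  have h := card_le_of_supp hy (c := ∅) (by simp) (by rw [y_empty hy]; exact one_pos)
    (Finset.range S.n) 0 T fun j hj => ⟨Finset.mem_range.1 hj, fun t ⟨_, ht, _⟩ => ⟨t.zero_le, ht⟩⟩
  simpa using h

/-- The first slots of the support are a grading of the precedence order. -/
theorem exists_grading (hy : y ∈ schedLasserre S T r) :
    ∃ a : ℕ → ℕ, (∀ i < S.n, ∀ j < S.n, Pr S i j → a i < a j) ∧ ∀ j < S.n, a j < T := by
  classical
  have hc : (∅ : Finset (LPVar S.n T)).card ≤ r := by simp
  have hy0 : 0 < y ∅ := by rw [y_empty hy]; exact one_pos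
  have hT : ∀ j t, Supp y ∅ j t → t < T := fun j t ⟨_, ht, _⟩ => ht
  have key : ∀ j, ∃ p : ℕ × ℕ, j < S.n → IsWindow y ∅ j p.1 p.2 := by
    intro j
    by_cases hj : j < S.n
    · have h := exists_supp hy hc hy0 hj
      obtain ⟨t, ht⟩ := h
      have hs := Nat.findGreatest_spec (P := Supp y ∅ j) (hT j t ht).le ht
      exact ⟨(Nat.find ⟨t, ht⟩, Nat.findGreatest (Supp y ∅ j) T), fun _ =>
        ⟨Nat.find_spec ⟨t, ht⟩, hs, fun u hu =>
          ⟨Nat.find_min' _ hu, Nat.le_findGreatest (hT j u hu).le hu⟩⟩⟩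
    · exact ⟨0, fun h => absurd h hj⟩
  choose p hp using key
  exact ⟨fun j => (p j).1,
    fun i hi j hj hij => (IsWindow.lt_of_pr hy hc hij (hp i hi) (hp j hj)).1,
    fun j hj => hT j _ (hp j hj).left⟩

theorem inputState_prec (i : ℕ) (hi : i < S.n) (j : ℕ) (hj : j < S.n) :
    (inputState S T r ε y).nat 1 (i * S.n + j) ≠ 0 ↔ Pr S i j := by
  simp only [inputState, one_ne_zero, if_false, if_true, ne_eq, ite_eq_right_iff, not_forall,
    not_false_eq_true, exists_prop, and_true]
  constructor
  · rintro ⟨a, b, hab, h⟩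
    obtain ⟨h1, h2⟩ := mul_add_inj hj b.2 h
    subst h1 h2
    exact ⟨a.2, b.2, hab⟩
  · rintro ⟨_, _, h⟩
    exact ⟨_, _, h, rfl⟩

theorem Feasible.isFeasibleSchedule {out : ℕ → ℕ} (h : Feasible S out) :
    IsFeasibleSchedule S fun j => out j.val := by
  refine ⟨fun j => h.one_le j j.2, fun t => ?_, fun i j hij =>
    h.lt_of_pr i i.2 j j.2 ⟨i.2, j.2, hij⟩⟩
  refine le_trans ?_ (h.load_le t)
  refine Finset.card_le_card_of_injOn Fin.val (fun j hj => ?_) Fin.val_injective.injOn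
  have hj' := (Finset.mem_filter.1 hj).2
  exact Finset.mem_filter.2 ⟨Finset.mem_range.2 j.2, hj'⟩

/-- A bound for the makespan from the estimates for the number of discarded jobs. -/
theorem add_le_of_discarded {m T q P k n U mid : ℕ} {X ε : ℝ} (hε : 0 < ε) (hX : 0 < X)
    (hm : (m : ℝ) = X * ε) (hq : 1 ≤ q) (hP : 4 * X ≤ P)
    (hk : 12 * ((q : ℝ) + 1) * X ≤ 2 ^ k) (hn : n ≤ m * T)
    (h1 : 2 ^ k * U ≤ 2 ^ k * mid + q * (3 * m * T))
    (h2 : q * P * mid ≤ q * n + q * (m * T)) : ((T + U : ℕ) : ℝ) ≤ (1 + ε) * T := by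
  have hT : (0 : ℝ) ≤ T := T.cast_nonneg
  have hq0 : (1 : ℝ) ≤ q := by exact_mod_cast hq
  -- Jobs given up cost at most `ε * T / 2`, because `4 * X ≤ P`; unplaced jobs of all stages cost
  -- at most `ε * T / 4`, because `12 * (q + 1) * X ≤ 2 ^ k`.
  have h3 : P * mid ≤ 2 * (m * T) := by
    refine le_of_mul_le_mul_left (a := q) ?_ hq
    have := Nat.mul_le_mul_left q hn
    calc q * (P * mid) = q * P * mid := by ring
      _ ≤ q * (m * T) + q * (m * T) := h2.trans (by omega)
      _ = _ := by ring
  have h3' : (P : ℝ) * mid ≤ 2 * (X * ε * T) := by rw [← hm]; exact_mod_cast h3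
  have h4 : 4 * X * mid ≤ 4 * X * (ε * T / 2) := by
    calc 4 * X * mid ≤ P * mid := by gcongr
      _ ≤ _ := h3'
      _ = _ := by ring
  have hmid : (mid : ℝ) ≤ ε * T / 2 := le_of_mul_le_mul_left h4 (by positivity)
  have h1' : (2 : ℝ) ^ k * U ≤ 2 ^ k * mid + q * (3 * (X * ε) * T) := by
    rw [← hm]; exact_mod_cast h1
  have h5 : (q : ℝ) * (3 * (X * ε) * T) ≤ 2 ^ k * (ε * T / 4) := by
    calc (q : ℝ) * (3 * (X * ε) * T) ≤ ((q : ℝ) + 1) * (3 * (X * ε) * T) := by gcongr; linarith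
      _ = 12 * ((q : ℝ) + 1) * X * (ε * T / 4) := by ring
      _ ≤ _ := by gcongr
  have h6 : (2 : ℝ) ^ k * U ≤ 2 ^ k * (ε * T) := by
    have h7 : (2 : ℝ) ^ k * mid ≤ 2 ^ k * (ε * T / 2) := by gcongr
    have h8 : 0 ≤ (2 : ℝ) ^ k * (ε * T) := by positivity
    nlinarith
  have h9 : (U : ℝ) ≤ ε * T := le_of_mul_le_mul_left h6 (by positivity)
  push_cast
  linarith

/-- Parameters for which the conditioning terminates within the given level. -/
theorem exists_admissible (hn : 3 ≤ S.n) (hT : T < S.n) (hε : 0 < ε) (hε1 : ε < 1)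
    (hm : 0 < S.m) (hT0 : 0 < T) (hnT : S.n ≤ S.m * T)
    (hr : (Real.logb 2 S.n) ^ (4000 * ((S.m : ℝ) ^ 2 / ε ^ 2) * Real.logb 2 (Real.logb 2 S.n)) ≤ r) :
    ∃ q P k K, k < S.n ∧ K < S.n ∧ Admissible S T r q P k K ∧
      (q ≤ K ∨ 1 ≤ q ∧ ∃ X : ℝ, 0 < X ∧ (S.m : ℝ) = X * ε ∧ 4 * X ≤ P ∧
        12 * ((q : ℝ) + 1) * X ≤ 2 ^ k) := by
  set q := Nat.clog 2 T with hq
  have hTq : T ≤ 2 ^ q := Nat.le_pow_clog one_lt_two T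
  have hqn : q < S.n := by
    rcases Nat.lt_or_ge 1 T with h | h
    · have h1 : q ≤ S.n - 1 := by
        rw [hq, Nat.clog_le_iff_le_pow one_lt_two]
        have := Nat.lt_two_pow_self (n := S.n - 1)
        omega
      omega
    · have : q = 0 := Nat.clog_of_right_le_one h 2
      omega
  -- Here `r` allows conditioning down to points. With `K = q` every stage is exact, and `P = 0` is
  -- harmless since no level is ever chosen.
  by_cases hcase : q = 0 ∨ S.n * S.n ≤ r
  · refine ⟨q, 0, 1, q, by omega, hqn, ⟨hT, hqn, by omega, le_rfl, by positivity, hnT, hTq, ?_,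
      Or.inl le_rfl⟩, Or.inl le_rfl⟩
    rcases hcase with h | h
    · left; simp [h]
    · exact Or.inr ⟨le_rfl, h⟩
  push Not at hcase
  obtain ⟨hq0, hrn⟩ := hcase
  have hq1 : 1 ≤ q := Nat.one_le_iff_ne_zero.2 hq0
  obtain ⟨hℒ, hL⟩ := logb_logb_ge hn
  set ℒ := Real.logb 2 S.n with hℒdef
  set L := Real.logb 2 ℒ with hLdef
  have hℒL : (2 : ℝ) ^ L = ℒ := Real.rpow_logb two_pos (by norm_num) (by linarith)
  have hm1 : (1 : ℝ) ≤ S.m := by exact_mod_cast hm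
  set X : ℝ := S.m / ε with hX
  have hmX : (S.m : ℝ) = X * ε := by rw [hX]; field_simp
  have hX1 : (S.m : ℝ) ≤ X := by
    rw [hX, le_div_iff₀ hε]
    nlinarith
  have hX1' : 1 ≤ X := hm1.trans hX1
  -- the number of levels
  have hqℒ : (q : ℝ) + 1 ≤ 2 ^ (4 * L) := by
    have h1 : 2 ^ (q - 1) < T := by
      rw [← Nat.pred_eq_sub_one]
      refine Nat.pow_pred_clog_lt_self one_lt_two ?_
      by_contra h
      exact hq0 (Nat.clog_of_right_le_one (not_lt.1 h) 2)
    have h2 : ((q - 1 : ℕ) : ℝ) ≤ ℒ := by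
      rw [hℒdef, Real.le_logb_iff_rpow_le one_lt_two (by positivity), Real.rpow_natCast]
      exact_mod_cast (h1.trans hT).le
    rw [Nat.cast_sub hq1] at h2
    push_cast at h2
    have h3 : (2 : ℝ) ^ (4 * L) = ℒ ^ 4 := by
      rw [mul_comm, Real.rpow_mul two_pos.le, hℒL]
      exact_mod_cast Real.rpow_natCast ℒ 4
    rw [h3]
    have h4 : (9 : ℝ) / 4 ≤ ℒ ^ 2 := by nlinarith
    have h5 : ℒ ^ 4 = ℒ ^ 2 * ℒ ^ 2 := by ring
    nlinarith
  set P := ⌈4 * X⌉₊ with hPdef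
  have hP1 : 4 * X ≤ P := Nat.le_ceil _
  have hP2 : (P : ℝ) ≤ 5 * X := by
    have := Nat.ceil_lt_add_one (a := 4 * X) (by linarith)
    linarith
  have hPpos : 1 ≤ P := Nat.one_le_iff_ne_zero.2 (by
    rintro h
    rw [h] at hP1
    push_cast at hP1
    linarith)
  set N := ⌈12 * ((q : ℝ) + 1) * X⌉₊ with hN
  have hq1' : (1 : ℝ) ≤ q := by exact_mod_cast hq1
  have hqX : 1 ≤ ((q : ℝ) + 1) * X := by nlinarith
  have hN1 : 12 * ((q : ℝ) + 1) * X ≤ N := Nat.le_ceil _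
  have hN2 : (N : ℝ) ≤ 13 * (((q : ℝ) + 1) * X) := by
    have := Nat.ceil_lt_add_one (a := 12 * ((q : ℝ) + 1) * X) (by positivity)
    nlinarith
  have hN3 : 1 < N := by
    have h : (1 : ℝ) < N := by nlinarith
    exact_mod_cast h
  set k := Nat.clog 2 N with hkdef
  have hk1 : 12 * ((q : ℝ) + 1) * X ≤ 2 ^ k := by
    refine hN1.trans ?_
    exact_mod_cast Nat.le_pow_clog one_lt_two N
  have hkpos : 1 ≤ k := Nat.clog_pos one_lt_two hN3
  have hk2 : (2 : ℝ) ^ k ≤ 26 * 2 ^ (4 * L) * X := by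
    have h1 : 2 ^ (k - 1) < N := by
      rw [← Nat.pred_eq_sub_one]
      exact Nat.pow_pred_clog_lt_self one_lt_two hN3
    have h2 : 2 ^ k ≤ 2 * N := by
      obtain ⟨k', hk'⟩ := Nat.exists_eq_add_of_le' hkpos
      rw [hk'] at h1 ⊢
      rw [pow_succ]
      simp only [Nat.add_sub_cancel] at h1
      omega
    have h2' : (2 : ℝ) ^ k ≤ 2 * N := by exact_mod_cast h2
    calc (2 : ℝ) ^ k ≤ 26 * ((q : ℝ) + 1) * X := by linarith
      _ ≤ _ := by gcongr
  set K := P * k * k with hKdef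
  have hbudget : q * stageBudget S.m k K ≤ r := by
    have h1 : (q : ℝ) * (S.m * 2 ^ (2 * (K : ℝ) + k)) ≤ 2 ^ (4000 * X ^ 2 * L ^ 2) := by
      refine budget_le_rpow hX1' hL (Nat.cast_nonneg _) hX1 (by linarith) hP2 (Nat.cast_nonneg _)
        ?_ (by rw [hKdef]; push_cast; rfl)
      rw [Real.rpow_natCast]
      exact hk2
    have h2 : (2 : ℝ) ^ (4000 * X ^ 2 * L ^ 2) ≤ r := by
      refine le_trans (le_of_eq ?_) hr
      rw [← hℒL, ← Real.rpow_mul two_pos.le, hX]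
      congr 1
      rw [div_pow]
      ring
    have h3 : (2 : ℝ) ^ (2 * (K : ℝ) + k) = ((2 ^ (2 * K + k) : ℕ) : ℝ) := by
      rw [Nat.cast_pow, ← Real.rpow_natCast]
      push_cast
      rfl
    rw [h3] at h1
    unfold stageBudget
    exact_mod_cast h1.trans h2
  -- The budget dominates `2 ^ K * 2 ^ K` and `r` is below `n * n` in this case, so `2 ^ K < n`: the
  -- parameters lie in the range of the search.
  have hKn : K < S.n := by
    have h1 : 2 ^ K * 2 ^ K ≤ q * stageBudget S.m k K := by
      unfold stageBudget
      rw [← pow_add]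
      calc 2 ^ (K + K) ≤ 2 ^ (2 * K + k) := Nat.pow_le_pow_right two_pos (by omega)
        _ ≤ S.m * 2 ^ (2 * K + k) := Nat.le_mul_of_pos_left _ hm
        _ ≤ _ := Nat.le_mul_of_pos_left _ hq1
    have h2 : 2 ^ K < S.n := lt_of_mul_self_lt_mul_self₀ (Nat.zero_le _)
      ((h1.trans hbudget).trans_lt hrn)
    exact Nat.lt_two_pow_self.trans h2
  have hPK : P ≤ K := by
    rw [hKdef, mul_assoc]
    exact Nat.le_mul_of_pos_right _ (by positivity)
  have hkK : k ≤ K := by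
    rw [hKdef]
    exact Nat.le_mul_of_pos_left _ (by positivity)
  refine ⟨q, P, k, K, by omega, hKn, ⟨hT, hqn, by omega, hkpos, by positivity, hnT, hTq,
    Or.inl hbudget, Or.inr ⟨hPpos, ?_, le_rfl⟩⟩, Or.inr ⟨hq1, X, by linarith, hmX, hP1, hk1⟩⟩
  have h : (q : ℝ) + 1 < 2 ^ k := by nlinarith
  exact_mod_cast h

/-- The makespan of the schedule that the search finds. -/
theorem searchStmt_le (hn : 2 ≤ S.n) (hε : 0 < ε)
    (hr : (Real.logb 2 S.n) ^ (4000 * ((S.m : ℝ) ^ 2 / ε ^ 2) * Real.logb 2 (Real.logb 2 S.n)) ≤ r)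
    (hy : y ∈ schedLasserre S T r) {ρ : ℕ → ℕ} :
    Feasible S ((searchStmt fillStmt).run ((inputState S T r ε y).real 1) ρ
        (inputState S T r ε y).nat 2) ∧
      ∀ j < S.n, ((searchStmt fillStmt).run ((inputState S T r ε y).real 1) ρ
        (inputState S T r ε y).nat 2 j : ℝ) ≤ (1 + ε) * T := by
  have hnT := le_mul_of_mem_schedLasserre hy
  have hmT : 0 < S.m * T := by omega
  have hm : 0 < S.m := Nat.pos_of_mul_pos_right hmT
  have hT0 : 0 < T := Nat.pos_of_mul_pos_left hmT
  have hT0' : (1 : ℝ) ≤ T := by exact_mod_cast hT0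
  obtain ⟨hF, hU⟩ := run_searchStmt (S := S) (T := T) (y := (inputState S T r ε y).real 1)
    (ρ := ρ) (M := (inputState S T r ε y).nat) keepsStatic_fillStmt notMem_writes_fillStmt hm
    rfl rfl rfl inputState_prec
  refine ⟨hF, fun j hj => ?_⟩
  obtain ⟨a, ha1, ha2⟩ := exists_grading hy
  rcases Nat.lt_or_ge T S.n with hTn | hTn
  swap
  -- A list schedule never needs more than `S.n` slots.
  · have h := hU S.n (Or.inl fun M' hM' j hj => (run_listStmt_le hM' hm hj).1) j hj
    calc _ ≤ (S.n : ℝ) := by exact_mod_cast h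
      _ ≤ T := by exact_mod_cast hTn
      _ ≤ (1 + ε) * T := by nlinarith
  -- Graham's bound `2 * T - 1` is enough in both cases: `S.n = 2` and `T < S.n` force `T = 1`.
  by_cases hsmall : S.n < 3 ∨ 1 ≤ ε
  · have h := hU (2 * T - 1)
      (Or.inl fun M' hM' j hj => (run_listStmt_le hM' hm hj).2 a ha1 ha2 hnT) j hj
    refine le_trans (Nat.cast_le.2 h) ?_
    rcases hsmall with h3 | h3
    · have : T = 1 := by omega
      subst this
      norm_num
      exact hε.le
    · calc ((2 * T - 1 : ℕ) : ℝ) ≤ ((2 * T : ℕ) : ℝ) := Nat.cast_le.2 (Nat.sub_le _ _)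
        _ = 2 * T := by push_cast; rfl
        _ ≤ (1 + ε) * T := by nlinarith
  push Not at hsmall
  have hB : IsTable y ((inputState S T r ε y).real 1) r := fun code ℓ hc hℓ j hj t ht =>
    inputState_real hc (by omega) hj ht
  obtain ⟨q, P, k, K, hk, hK, hA, hbound⟩ :=
    exists_admissible hsmall.1 hTn hε hsmall.2 hm hT0 hnT hr
  -- The search compares makespans with natural numbers, so the real bound is rounded down.
  set B := ⌊(1 + ε) * T⌋₊ with hBdef
  have hB0 : 0 ≤ (1 + ε) * T := by positivity
  have h := hU B (Or.inr ⟨hTn, q, hA.q_lt, P, hA.P_lt, k, hk, K, hK,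
    fun M' ρ' hM' h1 h2 h3 h4 j hj => ?_⟩) j hj
  · exact le_trans (Nat.cast_le.2 h) (Nat.floor_le hB0)
  obtain ⟨U, hU1, ⟨mid, hU2, hU3⟩, hU4⟩ := run_eval_fillStmt hy hB hA ⟨h1, h2, h3, h4⟩ hM'
  refine (hU1 j hj).trans (Nat.le_floor ?_)
  rcases hbound with hq | ⟨hq, X, hX, hmX, hPX, hkX⟩
  · rw [hU4 hq]
    push_cast
    nlinarith
  · exact add_le_of_discarded hε hX hmX hq hPX hkX hnT hU2 hU3

/-- The level is positive. -/
theorem one_le_of_rpow_le {e : ℝ} (hn : 2 ≤ S.n) (hr : (Real.logb 2 S.n) ^ e ≤ r) : 1 ≤ r := by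
  have hpos : 0 < Real.logb 2 S.n := Real.logb_pos one_lt_two (by exact_mod_cast hn)
  have : (0 : ℝ) < r := (Real.rpow_pos_of_pos hpos e).trans_le hr
  exact_mod_cast this

end SchedRounding

open BoundedLoops SchedRounding

theorem mainTheorem2 :
    ∃ (P : RealRam.Prog) (C : ℝ) (K : ℕ),
      ∀ (S : SchedInstance) (T r : ℕ) (ε : ℝ) (y : Finset (LPVar S.n T) → ℝ),
        2 ≤ S.n → 0 < ε →
        (Real.logb 2 S.n) ^ (C * ((S.m : ℝ) ^ 2 / ε ^ 2) * Real.logb 2 (Real.logb 2 S.n)) ≤ r →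
        y ∈ schedLasserre S T r →
        ∃ (s : RealRam.State) (t : ℕ),
          RealRam.Exec P (inputState S T r ε y) s t ∧
          t ≤ S.n ^ (K * r) ∧
          IsFeasibleSchedule S (outputSchedule S s) ∧
          ∀ j, (outputSchedule S s j : ℝ) ≤ (1 + ε) * T := by
  obtain ⟨K, hK⟩ := Stmt.exists_exec (searchStmt fillStmt) wf_searchStmt
  -- The constant `4000` is the one from `budget_le_rpow`.
  refine ⟨(searchStmt fillStmt).compile, 4000, K, fun S T r ε y hn hε hr hy => ?_⟩
  obtain ⟨s, t, hs, ht, hrun⟩ := hK (inputState S T r ε y) hn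
  obtain ⟨hF, hle⟩ := searchStmt_le hn hε hr hy (ρ := fun _ => 0)
  have hout : s.nat 2 = _ := hrun 2 (by decide)
  rw [← hout] at hF hle
  refine ⟨s, t, hs, ht.trans ?_, hF.isFeasibleSchedule, fun j => hle j j.2⟩
  have hr1 := one_le_of_rpow_le hn hr
  -- The running time is even `n ^ K`, independent of `r`; since `r ≥ 1` it is within the bound.
  exact Nat.pow_le_pow_right (n := S.n) (by omega) (Nat.le_mul_of_pos_right K hr1)
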